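/- Write $\mathbb T^2=\mathbb R^2/\mathbb Z^2$. For $i=1,2$ let $R_i$ be the Riesz transform on $L^2(\mathbb T^2)$, given on Fourier coefficients by $c_0(R_if)=0$ and $c_k(R_if)=\frac{k_i}{|k|}c_k(f)$ for $k\in\mathbb Z^2\setminus\{0\}$. Let $W^{k,2}(\mathbb T^2)$ be the usual Sobolev space, let $W^{-k,2}(\mathbb T^2)$ be its dual space, and let $L\log L(\mathbb T^2)$ be the set of $f\in L^1(\mathbb T^2)$ with $\int_{\mathbb T^2}|f|\ln(e+|f|)<\infty$. Let $L>0$ and let $\rho_0^{+},\rho_0^-\in L^2_{loc}(\mathbb R^2)$ satisfy, for almost every $x=(x_1,x_2)$, $$\rho_0^\pm(x_1+1,x_2)=\rho_0^\pm(x_1,x_2)+L,\qquad \rho_0^\pm(x_1,x_2+1)=\rho_0^\pm(x_1,x_2),\qquad \partial_{x_1}\rho_0^\pm\ge 0,$$ with $\partial_{x_1}\rho_0^\pm\in L\log L(\mathbb T^2)$ (a distributional derivative). Let $\eta\in C_c^\infty(\mathbb R^2)$, $\eta\ge0$, $\int\eta=1$, and $\eta_\varepsilon=\varepsilon^{-2}\eta(\cdot/\varepsilon)$.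 For $\varepsilon\in(0,1]$ and $T>0$, a smooth solution on $[0,T)$ means a pair $\rho^{\pm,\varepsilon}\in C^\infty(\mathbb R^2\times[0,T))$ with, for $\rho^\varepsilon=\rho^{+,\varepsilon}-\rho^{-,\varepsilon}$, $$\partial_t\rho^{\pm,\varepsilon}-\varepsilon\Delta\rho^{\pm,\varepsilon}=\mp\,(R_1^2R_2^2\rho^\varepsilon)\,\partial_{x_1}\rho^{\pm,\varepsilon}\quad\text{in }\mathbb R^2\times(0,T),$$ $$\rho^{\pm,\varepsilon}(x,0)=\big((\rho_0^\pm-Lx_1)*\eta_\varepsilon\big)(x)+(L+\varepsilon)x_1,$$ such that for all $t\in[0,T)$ one has $\rho^{\pm,\varepsilon}(x_1+1,x_2,t)=\rho^{\pm,\varepsilon}(x_1,x_2,t)+L+\varepsilon$, $\rho^{\pm,\varepsilon}(x_1,x_2+1,t)=\rho^{\pm,\varepsilon}(x_1,x_2,t)$ and $\partial_{x_1}\rho^{\pm,\varepsilon}\ge0$. Then: (i) There is a constant $C>0$, independent of $T>0$ and of $\varepsilon\in(0,1]$, such that for all $T>0$, all $\varepsilon\in(0,1]$, every smooth solution on $[0,T)$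 and every $\psi\in L^2((0,T);W^{1,2}(\mathbb T^2))$, $$\left|\int_0^T\!\!\int_{\mathbb T^2}\psi\,R_1^2R_2^2(\partial_t\rho^\varepsilon)\,dx\,dt\right|\le C\,\|\psi\|_{L^2((0,T);W^{1,2}(\mathbb T^2))},$$ and moreover $R_1^2R_2^2(\partial_t\rho^\varepsilon)\in L^2((0,T);W^{-1,2}(\mathbb T^2))$ with norm at most $C$. (ii) For every $T>0$ there is a constant $C_T>0$, independent of $\varepsilon\in(0,1]$, such that for all $\varepsilon\in(0,1]$, every smooth solution on $[0,T)$ and every $\psi\in L^2((0,T);W^{2,2}(\mathbb T^2))$, $$\left|\int_0^T\!\!\int_{\mathbb T^2}\psi\,\partial_t\rho^{\pm,\varepsilon}\,dx\,dt\right|\le C_T\,\|\psi\|_{L^2((0,T);W^{2,2}(\mathbb T^2))},$$ and moreover $\partial_t\rho^{\pm,\varepsilon}\in L^2((0,T);W^{-2,2}(\mathbb T^2))$ with norm at most $C_T$. In both parts the inner integral over $\mathbb T^2$ is an integrable function of $t\in(0,T)$. -/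

import Mathlib

open MeasureTheory Set
open scoped ContDiff ENNReal

noncomputable section

namespace Dislocation

/-! ### The plane, the torus and periodic functions -/

/-- The plane `ℝ²`; coordinates `0` and `1` stand for `x₁` and `x₂`. -/
abbrev Plane := Fin 2 → ℝ

/-- The torus `ℝ² / ℤ²`. -/
abbrev Torus := UnitAddTorus (Fin 2)

/-- The normalised Haar measure of the torus, i.e. Lebesgue measure of the unit cell. -/
abbrev torusMeasure : Measure Torus :=
  Measure.pi fun _ : Fin 2 => (AddCircle.haarAddCircle : Measure UnitAddCircle)

/-- Real `L²(𝕋²)`. -/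
abbrev L2R := Lp ℝ 2 torusMeasure

/-- Complex `L²(𝕋²)`. -/
abbrev L2C := Lp ℂ 2 torusMeasure

/-- The unit vector `e_i` of the plane. -/
def e (i : Fin 2) : Plane := Pi.single i 1

/-- `ℤ²`-periodicity of a function on the plane. -/
def IsPeriodic (f : Plane → ℝ) : Prop := ∀ i x, f (x + e i) = f x

/-- The function on the torus induced by a function on the plane through its values on the
fundamental cell `(0,1]²`; for a periodic function this is the usual passage to the quotient. -/
def descend (f : Plane → ℝ) (x : Torus) : ℝ :=
  f (UnitAddTorus.measurableEquivPiIoc (fun _ : Fin 2 => (0 : ℝ)) x).1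

open Classical in
/-- The class in `L²(𝕋²)` of a square integrable function (and `0` for other functions). -/
def toL2 (f : Torus → ℝ) : L2R :=
  if h : MemLp f 2 torusMeasure then h.toLp f else 0

/-- The partial derivative `∂f/∂x_i`. -/
def pd (i : Fin 2) (f : Plane → ℝ) (x : Plane) : ℝ := fderiv ℝ f x (e i)

/-- The Laplacian. -/
def lap (f : Plane → ℝ) (x : Plane) : ℝ := pd 0 (pd 0 f) x + pd 1 (pd 1 f) x

/-- The time derivative `∂ρ/∂t` at time `t`, as a function of the space variable. -/
def dt (ρ : ℝ → Plane → ℝ) (t : ℝ) (x : Plane) : ℝ := deriv (fun s => ρ s x) t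

/-! ### Riesz transforms -/

/-- The Fourier symbol `k_i / |k|` of the Riesz transform `R_i` (`0` for `k = 0`). -/
def rieszSymbol (i : Fin 2) (k : Fin 2 → ℤ) : ℝ :=
  if k = 0 then 0 else (k i : ℝ) / Real.sqrt ((k 0 : ℝ) ^ 2 + (k 1 : ℝ) ^ 2)

theorem abs_rieszSymbol_le (i : Fin 2) (k : Fin 2 → ℤ) : |rieszSymbol i k| ≤ 1 := by
  unfold rieszSymbol
  split_ifs with h
  · simp
  · rw [abs_div, abs_of_nonneg (Real.sqrt_nonneg _)]
    refine div_le_one_of_le₀ (Real.abs_le_sqrt ?_) (Real.sqrt_nonneg _)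
    fin_cases i
    · simpa using sq_nonneg (k 1 : ℝ)
    · simpa using sq_nonneg (k 0 : ℝ)

theorem memℓp_riesz (i : Fin 2) (f : L2C) :
    Memℓp (fun k : Fin 2 → ℤ =>
      (rieszSymbol i k : ℂ) * UnitAddTorus.mFourierCoeff (d := Fin 2) f k) 2 := by
  refine Memℓp.mono' (lp.memℓp ((UnitAddTorus.mFourierBasis (d := Fin 2)).repr f)) fun k => ?_
  rw [UnitAddTorus.mFourierBasis_repr, norm_mul, Complex.norm_real, Real.norm_eq_abs]
  exact mul_le_of_le_one_left (norm_nonneg _) (abs_rieszSymbol_le i k)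

/-- The Riesz transform `R_i` on `L²(𝕋²)`: the function whose `k`-th Fourier coefficient is
`rieszSymbol i k * c_k(f)`. -/
def riesz (i : Fin 2) (f : L2C) : L2C :=
  (UnitAddTorus.mFourierBasis (d := Fin 2)).repr.symm ⟨_, memℓp_riesz i f⟩

theorem mFourierCoeff_riesz (i : Fin 2) (f : L2C) (k : Fin 2 → ℤ) :
    UnitAddTorus.mFourierCoeff (d := Fin 2) (riesz i f) k =
      (rieszSymbol i k : ℂ) * UnitAddTorus.mFourierCoeff (d := Fin 2) f k := by
  rw [← UnitAddTorus.mFourierBasis_repr, riesz, LinearIsometryEquiv.apply_symm_apply]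

/-- A real `L²` function regarded as a complex one. -/
def complexify (f : L2R) : L2C := Complex.ofRealCLM.compLp f

/-- The operator `R₁²R₂²` on real `L²(𝕋²)`. Its Fourier symbol is real and even, so it maps real
functions to real functions, and the real part only restores the type
(see `complexify_rieszSq`). -/
def rieszSq (f : L2R) : L2R :=
  Complex.reCLM.compLp (riesz 0 (riesz 0 (riesz 1 (riesz 1 (complexify f)))))

theorem rieszSymbol_neg (i : Fin 2) (k : Fin 2 → ℤ) :
    rieszSymbol i (-k) = -rieszSymbol i k := by
  simp only [rieszSymbol, neg_eq_zero, Pi.neg_apply, Int.cast_neg, neg_sq]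
  split_ifs <;> simp [neg_div]

theorem mFourierCoeff_star (g : Torus → ℂ) (k : Fin 2 → ℤ) :
    UnitAddTorus.mFourierCoeff (d := Fin 2) (fun x => star (g x)) k =
      star (UnitAddTorus.mFourierCoeff (d := Fin 2) g (-k)) := by
  unfold UnitAddTorus.mFourierCoeff
  rw [← starRingEnd_apply, ← integral_conj]
  congr 1
  funext x
  rw [UnitAddTorus.mFourier_neg, neg_neg]
  simp

theorem complexify_rieszSq (f : L2R) :
    complexify (rieszSq f) = riesz 0 (riesz 0 (riesz 1 (riesz 1 (complexify f)))) := by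
  set g := riesz 0 (riesz 0 (riesz 1 (riesz 1 (complexify f)))) with hg
  have hc : ∀ (u v : L2C), (u : Torus → ℂ) =ᵐ[torusMeasure] v → ∀ k,
      UnitAddTorus.mFourierCoeff (d := Fin 2) u k = UnitAddTorus.mFourierCoeff (d := Fin 2) v k :=
    fun u v h k => by rw [Lp.ext h]
  have hstar : ∀ (u : L2C) k, UnitAddTorus.mFourierCoeff (d := Fin 2) (star u : L2C) k =
      star (UnitAddTorus.mFourierCoeff (d := Fin 2) u (-k)) := by
    intro u k
    rw [← mFourierCoeff_star]
    refine integral_congr_ae ?_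
    filter_upwards [Lp.coeFn_star u] with x hx
    rw [hx, Pi.star_apply]
  have hf : star (complexify f) = complexify f := by
    refine Lp.ext ?_
    filter_upwards [Lp.coeFn_star (complexify f), Complex.ofRealCLM.coeFn_compLp f] with x h1 h2
    rw [h1, Pi.star_apply, complexify, h2]
    simp
  have hgs : star g = g := by
    apply (UnitAddTorus.mFourierBasis (d := Fin 2)).repr.injective
    ext k
    rw [UnitAddTorus.mFourierBasis_repr, UnitAddTorus.mFourierBasis_repr, hstar, hg]
    simp only [mFourierCoeff_riesz, rieszSymbol_neg]
    conv_rhs => rw [← hf, hstar]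
    simp
  refine Lp.ext ?_
  filter_upwards [Complex.ofRealCLM.coeFn_compLp (rieszSq f), Complex.reCLM.coeFn_compLp g,
    Lp.coeFn_star g] with x h1 h2 h3
  rw [hgs] at h3
  rw [complexify, h1, rieszSq, ← hg, h2]
  exact Complex.conj_eq_iff_re.mp h3.symm

/-! ### Sobolev spaces on the torus and their duals -/

/-- The test functions on the torus: smooth periodic functions on the plane. -/
def IsTest (φ : Plane → ℝ) : Prop := ContDiff ℝ ∞ φ ∧ IsPeriodic φ

/-- Multi-indices of length at most `k`. -/
abbrev MIdx (k : ℕ) := {α : Fin (k + 1) × Fin (k + 1) // (α.1 : ℕ) + α.2 ≤ k}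

/-- The multi-index `(0, 0)`. -/
def MIdx.zero (k : ℕ) : MIdx k := ⟨(0, 0), by simp⟩

/-- The derivative `∂^α φ` of a smooth function. -/
def mpd (a b : ℕ) (φ : Plane → ℝ) : Plane → ℝ := (pd 0)^[a] ((pd 1)^[b] φ)

/-- `g` is the weak derivative `∂₁^a ∂₂^b f` of `f` on the torus. -/
def IsWeakDeriv (a b : ℕ) (f g : L2R) : Prop :=
  ∀ φ : Plane → ℝ, IsTest φ →
    ∫ x, f x * descend (mpd a b φ) x ∂torusMeasure =
      (-1) ^ (a + b) * ∫ x, g x * descend φ x ∂torusMeasure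

theorem contDiff_pd (i : Fin 2) {φ : Plane → ℝ} (h : ContDiff ℝ ∞ φ) : ContDiff ℝ ∞ (pd i φ) :=
  (h.fderiv_right (m := ∞) (by simp)).clm_apply contDiff_const

theorem contDiff_mpd (a b : ℕ) {φ : Plane → ℝ} (h : ContDiff ℝ ∞ φ) :
    ContDiff ℝ ∞ (mpd a b φ) := by
  have key : ∀ (i : Fin 2) (n : ℕ) (φ : Plane → ℝ), ContDiff ℝ ∞ φ →
      ContDiff ℝ ∞ ((pd i)^[n] φ) := by
    intro i n
    induction n with
    | zero => exact fun φ h => h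
    | succ n ih => exact fun φ h => ih _ (contDiff_pd i h)
  exact key 0 a _ (key 1 b _ h)

theorem memLp_descend {φ : Plane → ℝ} (h : Continuous φ) :
    MemLp (descend φ) 2 torusMeasure := by
  obtain ⟨C, hC⟩ := (isCompact_univ_pi fun _ : Fin 2 =>
    (isCompact_Icc : IsCompact (Icc (0 : ℝ) 1))).exists_bound_of_continuousOn h.continuousOn
  refine MemLp.of_bound ?_ C (Filter.Eventually.of_forall fun x => ?_)
  · exact (h.measurable.comp (measurable_subtype_coe.comp
      (UnitAddTorus.measurableEquivPiIoc _).measurable)).aestronglyMeasurable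
  · refine hC _ fun i _ => ?_
    have := (UnitAddTorus.measurableEquivPiIoc (fun _ : Fin 2 => (0 : ℝ)) x).2 i
    exact ⟨this.1.le, this.2.trans_eq (zero_add 1)⟩

theorem integrable_mul_descend (f : L2R) {φ : Plane → ℝ} (h : ContDiff ℝ ∞ φ) :
    Integrable (fun x => f x * descend φ x) torusMeasure :=
  (Lp.memLp f).integrable_mul (memLp_descend h.continuous)

theorem integral_add_mul_descend (f g : L2R) {φ : Plane → ℝ} (h : ContDiff ℝ ∞ φ) :
    ∫ x, (f + g : L2R) x * descend φ x ∂torusMeasure =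
      ∫ x, f x * descend φ x ∂torusMeasure + ∫ x, g x * descend φ x ∂torusMeasure := by
  rw [← integral_add (integrable_mul_descend f h) (integrable_mul_descend g h)]
  refine integral_congr_ae ?_
  filter_upwards [Lp.coeFn_add f g] with x hx
  rw [hx, Pi.add_apply, add_mul]

theorem integral_smul_mul_descend (c : ℝ) (f : L2R) (φ : Plane → ℝ) :
    ∫ x, (c • f : L2R) x * descend φ x ∂torusMeasure =
      c * ∫ x, f x * descend φ x ∂torusMeasure := by
  rw [← integral_const_mul]
  refine integral_congr_ae ?_
  filter_upwards [Lp.coeFn_smul c f] with x hx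
  rw [hx, Pi.smul_apply, smul_eq_mul, mul_assoc]

/-- The Sobolev space `W^{k,2}(𝕋²)`. An element is the family `(∂^α f)_{|α| ≤ k}` of a function
`f ∈ L²(𝕋²)` all of whose weak derivatives of order at most `k` are in `L²(𝕋²)`; the norm is
`(∑_{|α| ≤ k} ‖∂^α f‖²)^{1/2}`. -/
def Sobolev (k : ℕ) : Submodule ℝ (PiLp 2 fun _ : MIdx k => L2R) where
  carrier := {F | ∀ α : MIdx k, IsWeakDeriv α.1.1 α.1.2 (F (MIdx.zero k)) (F α)}
  add_mem' := by
    intro F G hF hG α φ hφ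
    rw [PiLp.add_apply, PiLp.add_apply, integral_add_mul_descend _ _ (contDiff_mpd _ _ hφ.1),
      integral_add_mul_descend _ _ hφ.1, hF α φ hφ, hG α φ hφ, mul_add]
  zero_mem' := by
    intro α φ hφ
    have h : ∀ χ : Plane → ℝ, ∫ x, (0 : L2R) x * descend χ x ∂torusMeasure = 0 := by
      intro χ
      have := integral_smul_mul_descend 0 0 χ
      rwa [zero_smul, zero_mul] at this
    rw [PiLp.zero_apply, PiLp.zero_apply, h, h, mul_zero]
  smul_mem' := by
    intro c F hF α φ hφ
    rw [PiLp.smul_apply, PiLp.smul_apply, integral_smul_mul_descend, integral_smul_mul_descend,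
      hF α φ hφ]
    ring

/-- The inclusion of `W^{k,2}(𝕋²)` in `L²(𝕋²)`. -/
def Sobolev.fn (k : ℕ) : Sobolev k →L[ℝ] L2R :=
  (PiLp.proj 2 (fun _ : MIdx k => L2R) (MIdx.zero k)).comp (Sobolev k).subtypeL

/-- The element `v ↦ ∫ f v` of `W^{-k,2}(𝕋²)`, the dual space of `W^{k,2}(𝕋²)`, defined by
`f ∈ L²(𝕋²)`; the integral is written as the inner product of `L²(𝕋²)`. -/
def toDual (k : ℕ) (f : L2R) : StrongDual ℝ (Sobolev k) := (innerSL ℝ f).comp (Sobolev.fn k)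

theorem toDual_apply (k : ℕ) (f : L2R) (v : Sobolev k) :
    toDual k f v = ∫ x, Sobolev.fn k v x * f x ∂torusMeasure := by
  change inner ℝ f (Sobolev.fn k v) = _
  rw [L2.inner_def]
  rfl

/-! ### Initial data and the regularised system -/

/-- `g` is locally integrable and is the distributional derivative `∂f/∂x₁` on the plane. -/
def IsWeakPartialOne (f g : Plane → ℝ) : Prop :=
  LocallyIntegrable g ∧ ∀ φ : Plane → ℝ, ContDiff ℝ ∞ φ → HasCompactSupport φ →
    ∫ x, f x * pd 0 φ x = -∫ x, g x * φ x

/-- Membership in the Zygmund space `L log L(𝕋²)`. -/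
def MemLlogL (f : Torus → ℝ) : Prop :=
  Integrable f torusMeasure ∧
    Integrable (fun x => |f x| * Real.log (Real.exp 1 + |f x|)) torusMeasure

/-- The assumptions on an initial datum `ρ₀`: it is in `L²_loc(ℝ²)`, increases by `L` over a period
in `x₁`, is periodic in `x₂`, and `∂ρ₀/∂x₁` is a nonnegative function in `L log L(𝕋²)`. -/
structure IsInitialDatum (L : ℝ) (ρ₀ : Plane → ℝ) : Prop where
  memLp_loc : ∀ K : Set Plane, IsCompact K → MemLp ρ₀ 2 (volume.restrict K)
  shift_one : ∀ᵐ x, ρ₀ (x + e 0) = ρ₀ x + L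
  shift_two : ∀ᵐ x, ρ₀ (x + e 1) = ρ₀ x
  deriv_one : ∃ g, IsWeakPartialOne ρ₀ g ∧ (∀ᵐ x, 0 ≤ g x) ∧ MemLlogL (descend g)

/-- The profiles `η` of the mollifiers. -/
structure IsMollifier (η : Plane → ℝ) : Prop where
  contDiff : ContDiff ℝ ∞ η
  compact : HasCompactSupport η
  nonneg : ∀ x, 0 ≤ η x
  integral_eq_one : ∫ x, η x = 1

/-- The regularised initial datum
`ρ₀^ε(x) = (ρ₀ - L x₁) * η_ε (x) + (L + ε) x₁`, with `η_ε(y) = ε⁻² η(y / ε)`. -/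
def regDatum (η : Plane → ℝ) (L ε : ℝ) (ρ₀ : Plane → ℝ) (x : Plane) : ℝ :=
  (∫ y, (ρ₀ (x - y) - L * (x - y) 0) * ((ε ^ 2)⁻¹ * η (ε⁻¹ • y))) + (L + ε) * x 0

/-- `R₁²R₂² f` for a function `f` on the plane that is periodic and square integrable on a
period. -/
def rieszSqFn (f : Plane → ℝ) : L2R := rieszSq (toL2 (descend f))

/-- What is asked of each of `ρ^{+,ε}`, `ρ^{-,ε}` (first `s = 1`, then `s = -1`), where `u t`
stands for the velocity `R₁²R₂²(ρ^{+,ε} - ρ^{-,ε})` at time `t`: smoothness on `ℝ² × [0,T)`, the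
equation `∂ρ/∂t - ε Δρ = -s u ∂ρ/∂x₁`, the initial condition, growth `L + ε` over a period in
`x₁`, periodicity in `x₂`, and monotonicity in `x₁`. -/
structure IsComponent (η : Plane → ℝ) (L ε T s : ℝ) (u : ℝ → L2R) (ρ₀ : Plane → ℝ)
    (ρ : ℝ → Plane → ℝ) : Prop where
  smooth : ContDiffOn ℝ ∞ (fun p : ℝ × Plane => ρ p.1 p.2) (Ico 0 T ×ˢ univ)
  equation : ∀ t ∈ Ioo 0 T, ∀ᵐ x ∂torusMeasure,
    descend (dt ρ t) x - ε * descend (lap (ρ t)) x = -s * u t x * descend (pd 0 (ρ t)) x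
  initial : ∀ x, ρ 0 x = regDatum η L ε ρ₀ x
  shift_one : ∀ t ∈ Ico 0 T, ∀ x, ρ t (x + e 0) = ρ t x + (L + ε)
  shift_two : ∀ t ∈ Ico 0 T, ∀ x, ρ t (x + e 1) = ρ t x
  monotone : ∀ t ∈ Ico 0 T, ∀ x, 0 ≤ pd 0 (ρ t) x

/-- `(ρp, ρm) = (ρ^{+,ε}, ρ^{-,ε})` is a smooth solution of the regularised system on
`ℝ² × [0,T)` with regularised initial data. -/
structure IsSolution (η : Plane → ℝ) (L ε T : ℝ) (ρp₀ ρm₀ : Plane → ℝ)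
    (ρp ρm : ℝ → Plane → ℝ) : Prop where
  plus : IsComponent η L ε T 1 (fun t => rieszSqFn fun x => ρp t x - ρm t x) ρp₀ ρp
  minus : IsComponent η L ε T (-1) (fun t => rieszSqFn fun x => ρp t x - ρm t x) ρm₀ ρm

/-! ### The estimates -/

/-- The duality estimate with constant `C` for a family `f t`, `t ∈ (0,T)`, of functions in
`L²(𝕋²)`: for every `ψ ∈ L²((0,T); W^{k,2}(𝕋²))` the pairing is integrable in time and
`|∫_{(0,T)} ∫_{𝕋²} ψ f| ≤ C ‖ψ‖_{L²((0,T); W^{k,2}(𝕋²))}`. -/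
def DualityEstimate (k : ℕ) (T C : ℝ) (f : ℝ → L2R) : Prop :=
  ∀ ψ : ℝ → Sobolev k, MemLp ψ 2 (volume.restrict (Ioo 0 T)) →
    IntegrableOn (fun t => ∫ x, Sobolev.fn k (ψ t) x * f t x ∂torusMeasure) (Ioo 0 T) ∧
    |∫ t in Ioo 0 T, ∫ x, Sobolev.fn k (ψ t) x * f t x ∂torusMeasure| ≤
      C * (eLpNorm ψ 2 (volume.restrict (Ioo 0 T))).toReal

/-- The family `f` belongs to `L²((0,T); W^{-k,2}(𝕋²))` with norm at most `C`. -/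
def NegSobolevBound (k : ℕ) (T C : ℝ) (f : ℝ → L2R) : Prop :=
  MemLp (fun t => toDual k (f t)) 2 (volume.restrict (Ioo 0 T)) ∧
    eLpNorm (fun t => toDual k (f t)) 2 (volume.restrict (Ioo 0 T)) ≤ ENNReal.ofReal C

end Dislocation

end

noncomputable section

namespace Dislocation

/-! ### The fundamental cell -/

/-- The representative in the cell `(0,1]²` of a point of the torus. -/
def cellRep (x : Torus) : Plane := (UnitAddTorus.measurableEquivPiIoc (fun _ : Fin 2 => (0 : ℝ)) x).1

/-- The quotient map from the plane to the torus. -/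
def toTorus (x : Plane) : Torus := fun i => (x i : UnitAddCircle)

theorem descend_apply (f : Plane → ℝ) (x : Torus) : descend f x = f (cellRep x) := rfl

theorem toTorus_cellRep (x : Torus) : toTorus (cellRep x) = x :=
  (UnitAddTorus.measurableEquivPiIoc (fun _ : Fin 2 => (0 : ℝ))).symm_apply_apply x

theorem cellRep_mem (x : Torus) : cellRep x ∈ Icc (0 : Plane) 1 := by
  have := (UnitAddTorus.measurableEquivPiIoc (fun _ : Fin 2 => (0 : ℝ)) x).2
  exact ⟨fun i => (this i).1.le, fun i => (this i).2.trans_eq (zero_add 1)⟩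

theorem measurePreserving_cellRep :
    MeasurePreserving cellRep torusMeasure (volume.restrict (Icc (0 : Plane) 1)) := by
  have h1 := UnitAddTorus.measurePreserving_equivPiIoc (fun _ : Fin 2 => (0 : ℝ))
  have hm : MeasurableSet {x : Plane | ∀ i, x i ∈ Ioc (0 : ℝ) (0 + 1)} :=
    MeasurableSet.univ_pi' (fun i => measurableSet_Ioc)
  have h2 : MeasurePreserving (Subtype.val : {x : Plane // ∀ i, x i ∈ Ioc (0 : ℝ) (0 + 1)} → Plane)
      (Measure.comap Subtype.val volume) (volume.restrict {x : Plane | ∀ i, x i ∈ Ioc (0 : ℝ) (0 + 1)}) :=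
    measurePreserving_subtype_coe hm
  have h3 : volume.restrict {x : Plane | ∀ i, x i ∈ Ioc (0 : ℝ) (0 + 1)} =
      volume.restrict (Icc (0 : Plane) 1) := by
    refine Measure.restrict_congr_set ?_
    have hset : {x : Plane | ∀ i, x i ∈ Ioc (0 : ℝ) (0 + 1)} =
        univ.pi fun i => Ioc ((0 : Plane) i) ((1 : Plane) i) := by
      ext x
      simp
    rw [hset]
    exact Measure.univ_pi_Ioc_ae_eq_Icc
  rw [← h3]
  exact h2.comp h1

theorem integral_descend (f : Plane → ℝ) :
    ∫ x, descend f x ∂torusMeasure = ∫ x in Icc (0 : Plane) 1, f x := by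
  have h : MeasurableEmbedding cellRep :=
    (MeasurableEmbedding.subtype_coe (MeasurableSet.univ_pi' (fun i => measurableSet_Ioc))).comp
      (UnitAddTorus.measurableEquivPiIoc (fun _ : Fin 2 => (0 : ℝ))).measurableEmbedding
  exact measurePreserving_cellRep.integral_comp h f

theorem integrable_descend {f : Plane → ℝ} (h : Continuous f) :
    Integrable (descend f) torusMeasure :=
  (memLp_descend h).integrable (by norm_num)

theorem integral_descend_pd (j : Fin 2) {φ : Plane → ℝ} (h : ContDiff ℝ 1 φ) (hp : IsPeriodic φ) :
    ∫ x, descend (pd j φ) x ∂torusMeasure = 0 := by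
  rw [integral_descend]
  have hc : Continuous (fderiv ℝ φ) := h.continuous_fderiv (by simp)
  have key := integral_divergence_of_hasFDerivAt_off_countable' (n := 1) (E := ℝ)
    (0 : Plane) 1 (fun _ => by simp) (fun i x => if i = j then φ x else 0)
    (fun i x => if i = j then fderiv ℝ φ x else 0) ∅ countable_empty
    (by
      intro i
      by_cases hi : i = j
      · simpa [hi] using h.continuous.continuousOn
      · simpa [hi] using continuousOn_const)
    (by
      intro x _ i
      by_cases hi : i = j
      · simpa [hi] using (h.differentiable (by simp) x).hasFDerivAt
      · simpa [hi] using hasFDerivAt_const _ _)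
    (by
      refine Continuous.integrableOn_Icc ?_
      refine continuous_finsetSum _ fun i _ => ?_
      by_cases hi : i = j
      · simpa [hi] using hc.clm_apply continuous_const
      · simpa [hi] using continuous_const)
  have hface : ∀ y : Fin 1 → ℝ, φ (j.insertNth 1 y) = φ (j.insertNth 0 y) := by
    intro y
    rw [← hp j (j.insertNth 0 y)]
    congr 1
    ext i
    fin_cases i <;> fin_cases j <;> simp [e, Fin.insertNth, Fin.succAboveCases] 
  have hl : ∀ x : Plane, (∑ i : Fin 2, (if i = j then fderiv ℝ φ x else 0) (Pi.single i 1)) = pd j φ x := by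
    intro x
    fin_cases j <;> simp [Fin.sum_univ_two, pd, e]
  simp only [hl] at key
  rw [key]
  refine Finset.sum_eq_zero fun i _ => ?_
  by_cases hi : i = j
  · subst hi
    simp [hface]
  · simp [hi]

theorem pd_mul {i : Fin 2} {f g : Plane → ℝ} {x : Plane} (hf : DifferentiableAt ℝ f x)
    (hg : DifferentiableAt ℝ g x) :
    pd i (fun y => f y * g y) x = f x * pd i g x + pd i f x * g x := by
  simp [pd, fderiv_fun_mul hf hg, mul_comm]

theorem pd_periodic (i : Fin 2) {f : Plane → ℝ} (hf : IsPeriodic f) : IsPeriodic (pd i f) := by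
  intro j x
  have : (fun y => f (y + e j)) = f := funext (hf j)
  unfold pd
  rw [← fderiv_comp_add_right, this]

/-- Integration by parts on the torus. -/
theorem integral_descend_mul_pd (j : Fin 2) {f g : Plane → ℝ} (hf : ContDiff ℝ 1 f)
    (hg : ContDiff ℝ 1 g) (hfp : IsPeriodic f) (hgp : IsPeriodic g) :
    ∫ x, descend f x * descend (pd j g) x ∂torusMeasure =
      -∫ x, descend (pd j f) x * descend g x ∂torusMeasure := by
  have h := integral_descend_pd j (hf.mul hg) (fun i x => by
    simp only [hfp i x, hgp i x])
  have hcf : Continuous (pd j f) := (hf.continuous_fderiv (by simp)).clm_apply continuous_const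
  have hcg : Continuous (pd j g) := (hg.continuous_fderiv (by simp)).clm_apply continuous_const
  have e1 : ∀ x, descend (pd j fun y => f y * g y) x =
      descend f x * descend (pd j g) x + descend (pd j f) x * descend g x := by
    intro x
    exact pd_mul (hf.differentiable (by simp) _) (hg.differentiable (by simp) _)
  simp only [e1] at h
  rw [integral_add] at h
  · linarith
  · exact integrable_descend (hf.continuous.mul hcg)
  · exact integrable_descend (hcf.mul hg.continuous)

/-! ### Fourier coefficients of real functions -/

/-- The Fourier coefficients of a real square integrable function. -/
def fc (f : L2R) (k : Fin 2 → ℤ) : ℂ := UnitAddTorus.mFourierCoeff (d := Fin 2) (complexify f) k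

theorem coeFn_complexify (f : L2R) :
    (complexify f : Torus → ℂ) =ᵐ[torusMeasure] fun x => ((f x : ℝ) : ℂ) :=
  Complex.ofRealCLM.coeFn_compLp f

theorem hasSum_fc (f g : L2R) :
    HasSum (fun k => (starRingEnd ℂ) (fc f k) * fc g k)
      ((∫ x, f x * g x ∂torusMeasure : ℝ) : ℂ) := by
  have h := UnitAddTorus.hasSum_prod_mFourierCoeff (d := Fin 2) (complexify f) (complexify g)
  convert! h using 1
  rw [← integral_complex_ofReal]
  refine integral_congr_ae ?_
  filter_upwards [coeFn_complexify f, coeFn_complexify g] with x h1 h2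
  rw [h1, h2]
  simp

theorem hasSum_norm_fc_sq (f : L2R) :
    HasSum (fun k => ‖fc f k‖ ^ 2) (∫ x, f x ^ 2 ∂torusMeasure) := by
  have h := UnitAddTorus.hasSum_sq_mFourierCoeff (d := Fin 2) (complexify f)
  convert! h using 1
  refine integral_congr_ae ?_
  filter_upwards [coeFn_complexify f] with x h1
  rw [h1]
  simp

theorem norm_L2R_sq (f : L2R) : ‖f‖ ^ 2 = ∫ x, f x ^ 2 ∂torusMeasure := by
  rw [← real_inner_self_eq_norm_sq, L2.inner_def]
  simp [sq]

/-- The Fourier symbol of `R₁²R₂²`. -/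
def symb (k : Fin 2 → ℤ) : ℝ := rieszSymbol 0 k ^ 2 * rieszSymbol 1 k ^ 2

theorem fc_rieszSq (f : L2R) (k : Fin 2 → ℤ) : fc (rieszSq f) k = symb k * fc f k := by
  unfold fc
  rw [complexify_rieszSq]
  simp only [mFourierCoeff_riesz, symb]
  push_cast
  ring

theorem symb_nonneg (k : Fin 2 → ℤ) : 0 ≤ symb k := by unfold symb; positivity

theorem rieszSymbol_sq_le (i : Fin 2) (k : Fin 2 → ℤ) : rieszSymbol i k ^ 2 ≤ 1 := by
  rw [sq_le_one_iff_abs_le_one]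
  exact abs_rieszSymbol_le i k

theorem symb_le_one (k : Fin 2 → ℤ) : symb k ≤ 1 :=
  mul_le_one₀ (rieszSymbol_sq_le 0 k) (sq_nonneg _) (rieszSymbol_sq_le 1 k)

theorem symb_mul_le (k : Fin 2 → ℤ) : symb k * ((k 0 : ℝ) ^ 2 + (k 1 : ℝ) ^ 2) ≤ (k 0 : ℝ) ^ 2 := by
  have h0 : rieszSymbol 0 k ^ 2 * ((k 0 : ℝ) ^ 2 + (k 1 : ℝ) ^ 2) ≤ (k 0 : ℝ) ^ 2 := by
    unfold rieszSymbol
    split_ifs with h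
    · simp [h]
    · rw [div_pow, Real.sq_sqrt (by positivity)]
      have hk : (k 0 : ℝ) ^ 2 + (k 1 : ℝ) ^ 2 ≠ 0 := by
        intro h0
        apply h
        have h1 : (k 0 : ℝ) = 0 := by nlinarith [sq_nonneg (k 0 : ℝ), sq_nonneg (k 1 : ℝ)]
        have h2 : (k 1 : ℝ) = 0 := by nlinarith [sq_nonneg (k 0 : ℝ), sq_nonneg (k 1 : ℝ)]
        ext i
        fin_cases i
        · exact_mod_cast h1
        · exact_mod_cast h2
      rw [div_mul_cancel₀ _ hk]
  have h1 := rieszSymbol_sq_le 1 k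
  calc symb k * ((k 0 : ℝ) ^ 2 + (k 1 : ℝ) ^ 2)
      = (rieszSymbol 0 k ^ 2 * ((k 0 : ℝ) ^ 2 + (k 1 : ℝ) ^ 2)) * rieszSymbol 1 k ^ 2 := by
        unfold symb; ring
    _ ≤ (k 0 : ℝ) ^ 2 * 1 := by gcongr
    _ = _ := mul_one _

theorem symb_le_mul (k : Fin 2 → ℤ) : symb k ≤ symb k * (k 0 : ℝ) ^ 2 := by
  by_cases h : k 0 = 0
  · have : rieszSymbol 0 k = 0 := by simp [rieszSymbol, h]
    simp [symb, this]
  · refine le_mul_of_one_le_right (symb_nonneg k) ?_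
    have h' : (1 : ℝ) ≤ |(k 0 : ℝ)| := by exact_mod_cast Int.one_le_abs h
    rw [← sq_abs]
    nlinarith

/-- Cauchy-Schwarz for a convergent series whose terms are dominated by products. -/
theorem norm_le_sqrt_mul_sqrt_of_hasSum {ι : Type*} {F : ι → ℂ} {s : ℂ} (h : HasSum F s)
    {a b : ι → ℝ} (hab : ∀ k, ‖F k‖ ≤ a k * b k) {A B : ℝ}
    (hA : ∀ S : Finset ι, ∑ k ∈ S, a k ^ 2 ≤ A) (hB : ∀ S : Finset ι, ∑ k ∈ S, b k ^ 2 ≤ B) :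
    ‖s‖ ≤ √A * √B := by
  refine le_of_tendsto h.norm (Filter.Eventually.of_forall fun S => ?_)
  calc ‖∑ k ∈ S, F k‖ ≤ ∑ k ∈ S, a k * b k := (norm_sum_le _ _).trans (Finset.sum_le_sum fun k _ => hab k)
    _ ≤ √(∑ k ∈ S, a k ^ 2) * √(∑ k ∈ S, b k ^ 2) := Real.sum_mul_le_sqrt_mul_sqrt S a b
    _ ≤ √A * √B := by gcongr; exacts [hA S, hB S]

/-! ### Trigonometric test functions -/

/-- The phase `2π k·x`. -/
def phase (k : Fin 2 → ℤ) (x : Plane) : ℝ := 2 * Real.pi * (k 0 * x 0 + k 1 * x 1)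

/-- `cos (2π k·x)`. -/
def cosT (k : Fin 2 → ℤ) (x : Plane) : ℝ := Real.cos (phase k x)

/-- `sin (2π k·x)`. -/
def sinT (k : Fin 2 → ℤ) (x : Plane) : ℝ := Real.sin (phase k x)

theorem contDiff_phase (k : Fin 2 → ℤ) : ContDiff ℝ ∞ (phase k) := by
  unfold phase; fun_prop

theorem phase_add_e (k : Fin 2 → ℤ) (i : Fin 2) (x : Plane) :
    phase k (x + e i) = phase k x + k i * (2 * Real.pi) := by
  fin_cases i <;> simp [phase, e] <;> ring

theorem isTest_cosT (k : Fin 2 → ℤ) : IsTest (cosT k) := by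
  refine ⟨Real.contDiff_cos.comp (contDiff_phase k), fun i x => ?_⟩
  rw [cosT, phase_add_e, Real.cos_add_int_mul_two_pi, cosT]

theorem isTest_sinT (k : Fin 2 → ℤ) : IsTest (sinT k) := by
  refine ⟨Real.contDiff_sin.comp (contDiff_phase k), fun i x => ?_⟩
  rw [sinT, phase_add_e, Real.sin_add_int_mul_two_pi, sinT]

theorem hasFDerivAt_phase (k : Fin 2 → ℤ) (x : Plane) :
    HasFDerivAt (phase k) ((2 * Real.pi) • (((k 0 : ℝ) • ContinuousLinearMap.proj (R := ℝ) (φ := fun _ : Fin 2 => ℝ) 0) +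
      ((k 1 : ℝ) • ContinuousLinearMap.proj (R := ℝ) (φ := fun _ : Fin 2 => ℝ) 1))) x := by
  unfold phase
  exact (((ContinuousLinearMap.proj (R := ℝ) (φ := fun _ : Fin 2 => ℝ) 0).hasFDerivAt.const_mul (k 0 : ℝ)).add
    ((ContinuousLinearMap.proj (R := ℝ) (φ := fun _ : Fin 2 => ℝ) 1).hasFDerivAt.const_mul (k 1 : ℝ))).const_mul _

theorem pd_cosT (i : Fin 2) (k : Fin 2 → ℤ) :
    pd i (cosT k) = fun x => -(2 * Real.pi * k i) * sinT k x := by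
  funext x
  have := ((hasFDerivAt_phase k x).cos).fderiv
  unfold pd cosT
  rw [this]
  fin_cases i <;> simp [e, sinT] <;> ring

theorem pd_sinT (i : Fin 2) (k : Fin 2 → ℤ) :
    pd i (sinT k) = fun x => (2 * Real.pi * k i) * cosT k x := by
  funext x
  have := ((hasFDerivAt_phase k x).sin).fderiv
  unfold pd sinT
  rw [this]
  fin_cases i <;> simp [e, cosT] <;> ring

theorem pd_const_mul (i : Fin 2) (c : ℝ) (f : Plane → ℝ) :
    pd i (fun x => c * f x) = fun x => c * pd i f x := by
  funext x
  have : (fun x => c * f x) = c • f := rfl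
  rw [this, pd, fderiv_const_smul_field]
  rfl

theorem mFourier_eq (k : Fin 2 → ℤ) (x : Torus) :
    UnitAddTorus.mFourier (-k) x = descend (cosT k) x - Complex.I * descend (sinT k) x := by
  conv_lhs => rw [← toTorus_cellRep x]
  rw [descend_apply, descend_apply]
  generalize cellRep x = y
  have : (UnitAddTorus.mFourier (-k)) (toTorus y) = Complex.exp (((-phase k y : ℝ) : ℂ) * Complex.I) := by
    simp only [UnitAddTorus.mFourier, ContinuousMap.coe_mk, Fin.prod_univ_two, toTorus,
      fourier_coe_apply, ← Complex.exp_add, phase]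
    congr 1
    push_cast
    simp
    ring
  rw [this, Complex.exp_mul_I, ← Complex.ofReal_cos, ← Complex.ofReal_sin, Real.cos_neg,
    Real.sin_neg, cosT, sinT]
  push_cast
  ring

theorem fc_eq (f : L2R) (k : Fin 2 → ℤ) :
    fc f k = (∫ x, f x * descend (cosT k) x ∂torusMeasure : ℝ) -
      Complex.I * (∫ x, f x * descend (sinT k) x ∂torusMeasure : ℝ) := by
  have h1 := (integrable_mul_descend f (isTest_cosT k).1).ofReal (𝕜 := ℂ)
  have h2 := (integrable_mul_descend f (isTest_sinT k).1).ofReal (𝕜 := ℂ)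
  rw [← integral_complex_ofReal, ← integral_complex_ofReal, ← integral_const_mul]
  refine Eq.trans ?_ (integral_sub h1 (h2.const_mul Complex.I))
  unfold fc UnitAddTorus.mFourierCoeff
  refine integral_congr_ae ?_
  filter_upwards [coeFn_complexify f] with x hx
  rw [hx, mFourier_eq]
  simp
  ring

/-- Fourier coefficients of a weak derivative of first order. -/
theorem fc_of_weak_pd {j : Fin 2} {f g : L2R}
    (h : ∀ φ, IsTest φ → ∫ x, f x * descend (pd j φ) x ∂torusMeasure =
      -∫ x, g x * descend φ x ∂torusMeasure) (k : Fin 2 → ℤ) :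
    fc g k = (2 * Real.pi * k j : ℝ) * Complex.I * fc f k := by
  have hc := h _ (isTest_cosT k)
  have hs := h _ (isTest_sinT k)
  have e1 : ∀ (c : ℝ) (φ : Plane → ℝ), ∫ x, f x * descend (fun y => c * φ y) x ∂torusMeasure =
      c * ∫ x, f x * descend φ x ∂torusMeasure := by
    intro c φ
    rw [← integral_const_mul]
    congr 1; funext x
    simp only [descend_apply]; ring
  rw [pd_cosT, e1] at hc
  rw [pd_sinT, e1] at hs
  rw [fc_eq, fc_eq, ← neg_eq_iff_eq_neg.2 hc, ← neg_eq_iff_eq_neg.2 hs]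
  push_cast
  linear_combination (2 * Real.pi * k j * (∫ x, f x * descend (sinT k) x ∂torusMeasure : ℝ) : ℂ) *
    Complex.I_sq

/-- Fourier coefficients of a weak derivative of second order. -/
theorem fc_of_weak_pd_pd {j : Fin 2} {f g : L2R}
    (h : ∀ φ, IsTest φ → ∫ x, f x * descend (pd j (pd j φ)) x ∂torusMeasure =
      ∫ x, g x * descend φ x ∂torusMeasure) (k : Fin 2 → ℤ) :
    fc g k = -((2 * Real.pi * k j) ^ 2 : ℝ) * fc f k := by
  have hc := h _ (isTest_cosT k)
  have hs := h _ (isTest_sinT k)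
  have e1 : ∀ (c : ℝ) (φ : Plane → ℝ), ∫ x, f x * descend (fun y => c * φ y) x ∂torusMeasure =
      c * ∫ x, f x * descend φ x ∂torusMeasure := by
    intro c φ
    rw [← integral_const_mul]
    congr 1; funext x
    simp only [descend_apply]; ring
  rw [pd_cosT, pd_const_mul, e1, pd_sinT, e1] at hc
  rw [pd_sinT, pd_const_mul, e1, pd_cosT, e1] at hs
  rw [fc_eq, fc_eq, ← hc, ← hs]
  push_cast
  ring

theorem coeFn_toL2 {φ : Plane → ℝ} (h : Continuous φ) :
    (toL2 (descend φ) : Torus → ℝ) =ᵐ[torusMeasure] descend φ := by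
  rw [toL2, dif_pos (memLp_descend h)]
  exact MemLp.coeFn_toLp _

theorem integral_toL2_mul {φ : Plane → ℝ} (h : Continuous φ) (G : Torus → ℝ) :
    ∫ x, toL2 (descend φ) x * G x ∂torusMeasure = ∫ x, descend φ x * G x ∂torusMeasure := by
  refine integral_congr_ae ?_
  filter_upwards [coeFn_toL2 h] with x hx
  rw [hx]

theorem fc_pd (j : Fin 2) {φ : Plane → ℝ} (h : ContDiff ℝ 1 φ) (hp : IsPeriodic φ) (k : Fin 2 → ℤ) :
    fc (toL2 (descend (pd j φ))) k = (2 * Real.pi * k j : ℝ) * Complex.I * fc (toL2 (descend φ)) k := by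
  refine fc_of_weak_pd (fun χ hχ => ?_) k
  have hc : Continuous (pd j φ) := (h.continuous_fderiv (by simp)).clm_apply continuous_const
  rw [integral_toL2_mul h.continuous, integral_toL2_mul hc]
  exact integral_descend_mul_pd j h (hχ.1.of_le (by simp)) hp hχ.2

/-! ### An exponential integrability inequality of Trudinger type -/

/-- The squared `W^{1,2}` norm of `a`, measured on the Fourier side, is at most `A`. -/
def H1Bound (a : L2R) (A : ℝ) : Prop :=
  ∀ S : Finset (Fin 2 → ℤ), ∑ k ∈ S, (1 + (k 0 : ℝ) ^ 2 + (k 1 : ℝ) ^ 2) * ‖fc a k‖ ^ 2 ≤ A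

theorem H1Bound.nonneg {a : L2R} {A : ℝ} (h : H1Bound a A) : 0 ≤ A := by simpa using h ∅

/-- The frequencies with `|k|_∞ ≤ 2^m`. -/
def freqBox (m : ℕ) : Finset (Fin 2 → ℤ) :=
  Fintype.piFinset fun _ => Finset.Icc (-(2 : ℤ) ^ m) (2 ^ m)

theorem mem_freqBox {m : ℕ} {k : Fin 2 → ℤ} : k ∈ freqBox m ↔ ∀ i, |k i| ≤ 2 ^ m := by
  simp [freqBox, abs_le]

theorem card_freqBox (m : ℕ) : ((freqBox m).card : ℝ) = (2 * 2 ^ m + 1) ^ 2 := by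
  have : (Finset.Icc (-(2 : ℤ) ^ m) (2 ^ m)).card = 2 * 2 ^ m + 1 := by
    rw [Int.card_Icc]
    have : (2 : ℤ) ^ m + 1 - -2 ^ m = ((2 * 2 ^ m + 1 : ℕ) : ℤ) := by push_cast; ring
    rw [this, Int.toNat_natCast]
  rw [freqBox, Fintype.card_piFinset]
  simp only [this, Finset.prod_const, Finset.card_univ, Fintype.card_fin]
  push_cast
  ring

theorem le_of_notMem_freqBox {m : ℕ} {k : Fin 2 → ℤ} (h : k ∉ freqBox m) :
    (4 : ℝ) ^ m ≤ (k 0 : ℝ) ^ 2 + (k 1 : ℝ) ^ 2 := by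
  rw [mem_freqBox] at h
  push Not at h
  obtain ⟨i, hi⟩ := h
  have h1 : (2 : ℝ) ^ m ≤ |(k i : ℝ)| := by exact_mod_cast hi.le
  have h2 : (4 : ℝ) ^ m ≤ (k i : ℝ) ^ 2 := by
    rw [← sq_abs, show (4 : ℝ) = 2 ^ 2 by norm_num, ← pow_mul, mul_comm, pow_mul]
    gcongr
  fin_cases i
  · exact h2.trans (le_add_of_nonneg_right (sq_nonneg _))
  · exact h2.trans (le_add_of_nonneg_left (sq_nonneg _))

theorem sum_freqBox_le (m : ℕ) :
    ∑ k ∈ freqBox m, (1 + (k 0 : ℝ) ^ 2 + (k 1 : ℝ) ^ 2)⁻¹ ≤ 36 * ((m : ℝ) + 1) := by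
  induction m with
  | zero =>
    calc ∑ k ∈ freqBox 0, (1 + (k 0 : ℝ) ^ 2 + (k 1 : ℝ) ^ 2)⁻¹ ≤ ∑ k ∈ freqBox 0, (1 : ℝ) :=
          Finset.sum_le_sum fun k _ => inv_le_one_of_one_le₀ (by nlinarith [sq_nonneg (k 0 : ℝ), sq_nonneg (k 1 : ℝ)])
      _ ≤ _ := by
        rw [Finset.sum_const, nsmul_eq_mul, card_freqBox]
        norm_num
  | succ m ih =>
    have hsub : freqBox m ⊆ freqBox (m + 1) := fun k hk => by
      rw [mem_freqBox] at hk ⊢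
      exact fun i => (hk i).trans (pow_le_pow_right₀ (by norm_num) (Nat.le_succ m))
    rw [← Finset.sum_sdiff hsub]
    have hshell : ∑ k ∈ freqBox (m + 1) \ freqBox m, (1 + (k 0 : ℝ) ^ 2 + (k 1 : ℝ) ^ 2)⁻¹ ≤ 36 := by
      calc ∑ k ∈ freqBox (m + 1) \ freqBox m, (1 + (k 0 : ℝ) ^ 2 + (k 1 : ℝ) ^ 2)⁻¹
          ≤ ∑ k ∈ freqBox (m + 1) \ freqBox m, ((4 : ℝ) ^ m)⁻¹ := by
            refine Finset.sum_le_sum fun k hk => ?_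
            have := le_of_notMem_freqBox (Finset.mem_sdiff.1 hk).2
            gcongr
            linarith
        _ ≤ ∑ k ∈ freqBox (m + 1), ((4 : ℝ) ^ m)⁻¹ :=
            Finset.sum_le_sum_of_subset_of_nonneg Finset.sdiff_subset fun _ _ _ => by positivity
        _ ≤ 36 := by
            rw [Finset.sum_const, nsmul_eq_mul, card_freqBox, ← div_eq_mul_inv,
              div_le_iff₀ (by positivity)]
            have h1 : (1 : ℝ) ≤ 2 ^ m := one_le_pow₀ (by norm_num)
            have h4 : (4 : ℝ) ^ m = 2 ^ m * 2 ^ m := by rw [← mul_pow]; norm_num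
            rw [h4, pow_succ 2 m]
            nlinarith
    push_cast
    linarith

/-- The partial sum of the Fourier series over `|k|_∞ ≤ 2^m`. -/
def lowPart (a : L2R) (m : ℕ) (x : Torus) : ℂ :=
  ∑ k ∈ freqBox m, fc a k * UnitAddTorus.mFourier k x

theorem norm_lowPart_sq_le {a : L2R} {A : ℝ} (h : H1Bound a A) (m : ℕ) (x : Torus) :
    ‖lowPart a m x‖ ^ 2 ≤ 36 * (m + 1) * A := by
  have hpos : ∀ k : Fin 2 → ℤ, 0 < 1 + (k 0 : ℝ) ^ 2 + (k 1 : ℝ) ^ 2 := fun k => by positivity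
  have h1 : ‖lowPart a m x‖ ≤ ∑ k ∈ freqBox m, ‖fc a k‖ := by
    refine (norm_sum_le _ _).trans (Finset.sum_le_sum fun k _ => ?_)
    rw [norm_mul]
    refine mul_le_of_le_one_right (norm_nonneg _) ?_
    exact ((UnitAddTorus.mFourier k).norm_coe_le_norm x).trans_eq UnitAddTorus.mFourier_norm
  have h2 : (∑ k ∈ freqBox m, ‖fc a k‖) ^ 2 ≤
      (∑ k ∈ freqBox m, (1 + (k 0 : ℝ) ^ 2 + (k 1 : ℝ) ^ 2)⁻¹) *
        ∑ k ∈ freqBox m, (1 + (k 0 : ℝ) ^ 2 + (k 1 : ℝ) ^ 2) * ‖fc a k‖ ^ 2 := by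
    refine Finset.sum_sq_le_sum_mul_sum_of_sq_le_mul _ (fun k _ => (inv_pos.2 (hpos k)).le)
      (fun k _ => mul_nonneg (hpos k).le (sq_nonneg _)) fun k _ => ?_
    rw [inv_mul_cancel_left₀ (hpos k).ne']
  calc ‖lowPart a m x‖ ^ 2 ≤ (∑ k ∈ freqBox m, ‖fc a k‖) ^ 2 := by gcongr
    _ ≤ _ := h2
    _ ≤ 36 * (m + 1) * A := by
        gcongr
        · exact sum_freqBox_le m
        · exact h _

theorem exists_highPart {a : L2R} {A : ℝ} (h : H1Bound a A) (m : ℕ) :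
    ∃ r : L2C, (∀ᵐ x ∂torusMeasure, ((a x : ℝ) : ℂ) = lowPart a m x + r x) ∧
      ∫ x, ‖r x‖ ^ 2 ∂torusMeasure ≤ A / 4 ^ m := by
  classical
  let b := UnitAddTorus.mFourierBasis (d := Fin 2)
  let s : L2C := ∑ k ∈ freqBox m, fc a k • b k
  refine ⟨complexify a - s, ?_, ?_⟩
  · have hs : (s : Torus → ℂ) =ᵐ[torusMeasure] lowPart a m := by
      have h1 : ∀ᵐ x ∂torusMeasure, ∀ k, (fc a k • b k : L2C) x =
          fc a k * UnitAddTorus.mFourier k x := by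
        rw [ae_all_iff]
        intro k
        filter_upwards [Lp.coeFn_smul (fc a k) (b k), UnitAddTorus.coeFn_mFourierLp 2 k] with x h1 h2
        rw [h1, Pi.smul_apply, smul_eq_mul, ← h2]
        simp only [b, UnitAddTorus.coe_mFourierBasis]
      have h2 : (s : Torus → ℂ) =ᵐ[torusMeasure]
          fun x => ∑ k ∈ freqBox m, (fc a k • b k : L2C) x := Lp.coeFn_fun_finsetSum _ _
      filter_upwards [h1, h2] with x h1 h2
      rw [h2, lowPart]
      exact Finset.sum_congr rfl fun k _ => h1 k
    filter_upwards [coeFn_complexify a, hs, Lp.coeFn_sub (complexify a) s] with x h1 h2 h3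
    rw [h3, Pi.sub_apply, h1, h2]
    ring
  · refine hasSum_le_of_sum_le (UnitAddTorus.hasSum_sq_mFourierCoeff (d := Fin 2) (complexify a - s))
      fun S => ?_
    have hc : ∀ k, UnitAddTorus.mFourierCoeff (d := Fin 2) (complexify a - s : L2C) k =
        if k ∈ freqBox m then 0 else fc a k := by
      intro k
      rw [← UnitAddTorus.mFourierBasis_repr, map_sub, map_sum]
      simp only [map_smul]
      rw [lp.coeFn_sub, Pi.sub_apply, lp.coeFn_sum, Finset.sum_apply]
      simp only [b, lp.coeFn_smul, Pi.smul_apply, HilbertBasis.repr_self, lp.coeFn_single,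
        Pi.single_apply, smul_eq_mul, mul_ite, mul_one, mul_zero]
      rw [UnitAddTorus.mFourierBasis_repr, Finset.sum_ite_eq]
      split_ifs <;> simp [fc]
    rw [le_div_iff₀ (by positivity), Finset.sum_mul]
    refine le_trans (Finset.sum_le_sum fun k _ => ?_) (h S)
    rw [hc]
    split_ifs with hk
    · simp; positivity
    · rw [mul_comm]
      gcongr
      have := le_of_notMem_freqBox hk
      linarith

theorem H1Bound.integral_sq_le {a : L2R} {A : ℝ} (h : H1Bound a A) :
    ∫ x, a x ^ 2 ∂torusMeasure ≤ A := by
  refine hasSum_le_of_sum_le (hasSum_norm_fc_sq a) fun S => (Finset.sum_le_sum fun k _ => ?_).trans (h S)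
  refine le_mul_of_one_le_left (sq_nonneg _) ?_
  nlinarith [sq_nonneg (k 0 : ℝ), sq_nonneg (k 1 : ℝ)]

theorem integrable_sq_mul (a : L2R) {g : Torus → ℝ} (hg : AEStronglyMeasurable g torusMeasure)
    {B : ℝ} (hB : ∀ x, |g x| ≤ B) : Integrable (fun x => a x ^ 2 * g x) torusMeasure :=
  (Lp.memLp a).integrable_sq.mul_bdd (c := B) hg (Filter.Eventually.of_forall hB)

/-- If `g ≥ 0` is a bounded function with `∫ g (1 + log⁺ g)` under control, then
`∫ a² g` is controlled by the squared `W^{1,2}` norm of `a`. -/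
theorem integral_sq_mul_le {a : L2R} {A : ℝ} (h : H1Bound a A) {g W : Torus → ℝ}
    (hg : AEStronglyMeasurable g torusMeasure) (hg0 : ∀ x, 0 ≤ g x) {B : ℝ} (hB : ∀ x, g x ≤ B)
    (hW : Integrable W torusMeasure) (hW0 : ∀ x, 0 ≤ W x)
    (hgW : ∀ x, 1 ≤ g x → g x * (1 + 2 * Real.log (g x)) ≤ W x) :
    ∫ x, a x ^ 2 * g x ∂torusMeasure ≤ A * (9 + 72 * ∫ x, W x ∂torusMeasure) := by
  have hA := h.nonneg
  choose r hr1 hr2 using exists_highPart h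
  obtain ⟨M, hM⟩ := pow_unbounded_of_one_lt B (one_lt_two : (1 : ℝ) < 2)
  have hint1 : Integrable (fun x => a x ^ 2) torusMeasure := (Lp.memLp a).integrable_sq
  have hint2 : ∀ n, Integrable (fun x => 4 * 2 ^ n * ‖r n x‖ ^ 2) torusMeasure := fun n =>
    ((Lp.memLp (r n)).integrable_norm_pow (p := 2) (by norm_num)).const_mul _
  have hsum : Integrable (fun x => ∑ n ∈ Finset.range M, 4 * 2 ^ n * ‖r n x‖ ^ 2) torusMeasure :=
    integrable_finsetSum _ fun n _ => hint2 n
  have hpt : ∀ᵐ x ∂torusMeasure, a x ^ 2 * g x ≤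
      a x ^ 2 + 72 * A * W x + ∑ n ∈ Finset.range M, 4 * 2 ^ n * ‖r n x‖ ^ 2 := by
    filter_upwards [ae_all_iff.2 hr1] with x hx
    have hs0 : ∀ n ∈ Finset.range M, 0 ≤ 4 * 2 ^ n * ‖r n x‖ ^ 2 := fun n _ => by positivity
    have hW' := mul_nonneg (mul_nonneg (by norm_num : (0 : ℝ) ≤ 72) hA) (hW0 x)
    rcases lt_or_ge (g x) 1 with h1 | h1
    · have := Finset.sum_nonneg hs0
      have := mul_le_of_le_one_right (sq_nonneg (a x)) h1.le
      linarith
    · obtain ⟨n, hn1, hn2⟩ := exists_nat_pow_near h1 (one_lt_two : (1 : ℝ) < 2)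
      have hnM : n ∈ Finset.range M := by
        rw [Finset.mem_range]
        exact (pow_lt_pow_iff_right₀ (one_lt_two : (1 : ℝ) < 2)).1 ((hn1.trans (hB x)).trans_lt hM)
      have hterm := Finset.single_le_sum hs0 hnM
      have hlog : (n : ℝ) ≤ 2 * Real.log (g x) := by
        have h2 := Real.log_le_log (by positivity) hn1
        rw [Real.log_pow] at h2
        nlinarith [Real.log_two_gt_d9, (Nat.cast_nonneg n : (0 : ℝ) ≤ n)]
      have hsq : a x ^ 2 ≤ 2 * ‖lowPart a n x‖ ^ 2 + 2 * ‖r n x‖ ^ 2 := by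
        have h3 : |a x| ≤ ‖lowPart a n x‖ + ‖r n x‖ := by
          rw [← Real.norm_eq_abs, ← Complex.norm_real, hx n]
          exact norm_add_le _ _
        rw [← sq_abs]
        nlinarith [sq_nonneg (‖lowPart a n x‖ - ‖r n x‖), abs_nonneg (a x)]
      have hlow := norm_lowPart_sq_le h n x
      have hg1 : 0 ≤ g x := hg0 x
      calc a x ^ 2 * g x ≤ (2 * (36 * (n + 1) * A) + 2 * ‖r n x‖ ^ 2) * g x := by
            gcongr
            linarith
        _ = 72 * A * (g x * (1 + n)) + 2 * ‖r n x‖ ^ 2 * g x := by ring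
        _ ≤ 72 * A * W x + 2 * ‖r n x‖ ^ 2 * 2 ^ (n + 1) := by
            gcongr
            exact (mul_le_mul_of_nonneg_left (by linarith) hg1).trans (hgW x h1)
        _ = 72 * A * W x + 4 * 2 ^ n * ‖r n x‖ ^ 2 := by ring
        _ ≤ _ := by nlinarith [sq_nonneg (a x)]
  have hgeom : ∑ n ∈ Finset.range M, ∫ x, 4 * 2 ^ n * ‖r n x‖ ^ 2 ∂torusMeasure ≤ 8 * A := by
    have h1 : ∀ n ∈ Finset.range M, ∫ x, 4 * 2 ^ n * ‖r n x‖ ^ 2 ∂torusMeasure ≤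
        4 * A * (1 / 2) ^ n := by
      intro n _
      rw [integral_const_mul]
      calc 4 * 2 ^ n * ∫ x, ‖r n x‖ ^ 2 ∂torusMeasure ≤ 4 * 2 ^ n * (A / 4 ^ n) := by
            gcongr
            exact hr2 n
        _ = 4 * A * (1 / 2) ^ n := by
            rw [show (4 : ℝ) ^ n = 2 ^ n * 2 ^ n by rw [← mul_pow]; norm_num]
            rw [one_div, inv_pow]
            field_simp
    refine (Finset.sum_le_sum h1).trans ?_
    rw [← Finset.mul_sum]
    have h2 := sum_geometric_two_le M
    nlinarith
  calc ∫ x, a x ^ 2 * g x ∂torusMeasure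
      ≤ ∫ x, (a x ^ 2 + 72 * A * W x + ∑ n ∈ Finset.range M, 4 * 2 ^ n * ‖r n x‖ ^ 2) ∂torusMeasure :=
        integral_mono_ae (integrable_sq_mul a hg fun x => by
          rw [abs_of_nonneg (hg0 x)]; exact hB x) ((hint1.add (hW.const_mul _)).add hsum) hpt
    _ = ∫ x, a x ^ 2 ∂torusMeasure + 72 * A * ∫ x, W x ∂torusMeasure +
        ∑ n ∈ Finset.range M, ∫ x, 4 * 2 ^ n * ‖r n x‖ ^ 2 ∂torusMeasure := by
        have h12 := hint1.add (hW.const_mul (72 * A))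
        refine (integral_add h12 hsum).trans ?_
        refine congrArg₂ _ ((integral_add hint1 (hW.const_mul _)).trans ?_) ?_
        · rw [integral_const_mul]
        · rw [integral_finsetSum _ fun n _ => hint2 n]
    _ ≤ A + 72 * A * ∫ x, W x ∂torusMeasure + 8 * A := by
        gcongr
        exact h.integral_sq_le
    _ = _ := by ring

/-! ### Functions of time and space -/

/-- Smoothness on `ℝ² × [0,T)`. -/
def SmoothOn (T : ℝ) (G : ℝ → Plane → ℝ) : Prop :=
  ContDiffOn ℝ ∞ (fun p : ℝ × Plane => G p.1 p.2) (Ico 0 T ×ˢ univ)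

theorem uniqueDiffOn_Ico_prod (T : ℝ) : UniqueDiffOn ℝ (Ico 0 T ×ˢ (univ : Set Plane)) :=
  (uniqueDiffOn_Ico 0 T).prod uniqueDiffOn_univ

section Regularity

variable {T : ℝ} {G : ℝ → Plane → ℝ}

theorem SmoothOn.pd_eq (h : SmoothOn T G) (i : Fin 2) {t : ℝ} (ht : t ∈ Ico 0 T) (x : Plane) :
    pd i (G t) x =
      fderivWithin ℝ (fun p : ℝ × Plane => G p.1 p.2) (Ico 0 T ×ˢ univ) (t, x) (0, e i) := by
  have hd := ((h.differentiableOn (by simp)) (t, x) ⟨ht, mem_univ _⟩).hasFDerivWithinAt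
  have hc : HasFDerivWithinAt (fun y : Plane => (t, y)) (ContinuousLinearMap.inr ℝ ℝ Plane) univ x :=
    (hasFDerivAt_prodMk_right t x).hasFDerivWithinAt
  have := hd.comp x hc (fun y _ => ⟨ht, mem_univ _⟩)
  have h2 := (hasFDerivWithinAt_univ.1 this).fderiv
  unfold pd
  have e1 : G t = (fun p : ℝ × Plane => G p.1 p.2) ∘ fun y : Plane => (t, y) := rfl
  rw [e1, h2]
  rfl

theorem SmoothOn.pd (h : SmoothOn T G) (i : Fin 2) : SmoothOn T fun t => pd i (G t) := by
  have h1 := (h.fderivWithin (uniqueDiffOn_Ico_prod T) (m := ∞) (by simp)).clm_apply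
    (contDiffOn_const (c := ((0 : ℝ), e i)))
  exact h1.congr fun p hp => h.pd_eq i hp.1 p.2

theorem SmoothOn.contDiff (h : SmoothOn T G) {t : ℝ} (ht : t ∈ Ico 0 T) : ContDiff ℝ ∞ (G t) := by
  rw [← contDiffOn_univ]
  exact ContDiffOn.comp (g := fun p : ℝ × Plane => G p.1 p.2) (f := fun y : Plane => (t, y)) h
    (contDiff_prodMk_right t).contDiffOn (fun y _ => ⟨ht, mem_univ _⟩)

theorem SmoothOn.continuousOn (h : SmoothOn T G) :
    ContinuousOn (fun p : ℝ × Plane => G p.1 p.2) (Ico 0 T ×ˢ univ) := ContDiffOn.continuousOn h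

theorem isOpen_Ioo_prod (T : ℝ) : IsOpen (Ioo 0 T ×ˢ (univ : Set Plane)) :=
  isOpen_Ioo.prod isOpen_univ

theorem SmoothOn.mono_Ioo (h : SmoothOn T G) :
    ContDiffOn ℝ ∞ (fun p : ℝ × Plane => G p.1 p.2) (Ioo 0 T ×ˢ univ) :=
  ContDiffOn.mono h (prod_mono Ioo_subset_Ico_self subset_rfl)

theorem SmoothOn.contDiffAt (h : SmoothOn T G) {t : ℝ} (ht : t ∈ Ioo 0 T) (x : Plane) :
    ContDiffAt ℝ ∞ (fun p : ℝ × Plane => G p.1 p.2) (t, x) :=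
  h.mono_Ioo.contDiffAt ((isOpen_Ioo_prod T).mem_nhds ⟨ht, mem_univ _⟩)

theorem SmoothOn.hasDerivAt_fderiv (h : SmoothOn T G) {t : ℝ} (ht : t ∈ Ioo 0 T) (x : Plane) :
    HasDerivAt (fun s => G s x) (fderiv ℝ (fun p : ℝ × Plane => G p.1 p.2) (t, x) (1, 0)) t := by
  have h1 := ((h.contDiffAt ht x).differentiableAt (by simp)).hasFDerivAt
  have h2 : HasFDerivAt (fun s : ℝ => (s, x)) (ContinuousLinearMap.inl ℝ ℝ Plane) t :=
    hasFDerivAt_prodMk_left t x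
  have h3 := (h1.comp t h2).hasDerivAt
  exact h3

theorem SmoothOn.dt_eq (h : SmoothOn T G) {t : ℝ} (ht : t ∈ Ioo 0 T) (x : Plane) :
    dt G t x = fderiv ℝ (fun p : ℝ × Plane => G p.1 p.2) (t, x) (1, 0) :=
  (h.hasDerivAt_fderiv ht x).deriv

theorem SmoothOn.hasDerivAt (h : SmoothOn T G) {t : ℝ} (ht : t ∈ Ioo 0 T) (x : Plane) :
    HasDerivAt (fun s => G s x) (dt G t x) t := by
  rw [h.dt_eq ht]
  exact h.hasDerivAt_fderiv ht x

theorem SmoothOn.contDiffOn_dt (h : SmoothOn T G) :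
    ContDiffOn ℝ ∞ (fun p : ℝ × Plane => dt G p.1 p.2) (Ioo 0 T ×ˢ univ) := by
  have h1 := (h.mono_Ioo.fderiv_of_isOpen (isOpen_Ioo_prod T) (m := ∞) (by simp)).clm_apply
    (contDiffOn_const (c := ((1 : ℝ), (0 : Plane))))
  exact h1.congr fun p hp => h.dt_eq hp.1 p.2

theorem SmoothOn.contDiff_dt (h : SmoothOn T G) {t : ℝ} (ht : t ∈ Ioo 0 T) :
    ContDiff ℝ ∞ (dt G t) := by
  rw [← contDiffOn_univ]
  exact ContDiffOn.comp h.contDiffOn_dt (contDiff_prodMk_right t).contDiffOn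
    (fun y _ => ⟨ht, mem_univ _⟩)

theorem SmoothOn.dt_pd (h : SmoothOn T G) (i : Fin 2) {t : ℝ} (ht : t ∈ Ioo 0 T) (x : Plane) :
    dt (fun s => Dislocation.pd i (G s)) t x = Dislocation.pd i (dt G t) x := by
  set Q : ℝ × Plane → ℝ := fun p => G p.1 p.2 with hQ
  have hQ2 := h.contDiffAt ht x
  have hsymm : IsSymmSndFDerivAt ℝ Q (t, x) := hQ2.isSymmSndFDerivAt (by
    rw [minSmoothness_of_isRCLikeNormedField]; exact WithTop.coe_le_coe.2 le_top)
  have hdd : DifferentiableAt ℝ (fderiv ℝ Q) (t, x) :=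
    (hQ2.fderiv_right (m := ∞) (by simp)).differentiableAt (by simp)
  have hpd : ∀ s ∈ Ioo 0 T, ∀ y, Dislocation.pd i (G s) y = fderiv ℝ Q (s, y) (0, e i) := by
    intro s hs y
    rw [h.pd_eq i ⟨hs.1.le, hs.2⟩ y, fderivWithin_of_mem_nhds]
    exact Filter.mem_of_superset ((isOpen_Ioo_prod T).mem_nhds ⟨hs, mem_univ _⟩)
      (prod_mono Ioo_subset_Ico_self subset_rfl)
  have hder : ∀ v, HasFDerivAt (fun p => fderiv ℝ Q p v)
      ((ContinuousLinearMap.apply ℝ ℝ v).comp (fderiv ℝ (fderiv ℝ Q) (t, x))) (t, x) := fun v =>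
    (ContinuousLinearMap.apply ℝ ℝ v).hasFDerivAt.comp (t, x) hdd.hasFDerivAt
  have h1 : HasDerivAt (fun s => fderiv ℝ Q (s, x) (0, e i))
      (fderiv ℝ (fderiv ℝ Q) (t, x) (1, 0) (0, e i)) t := by
    have h2 : HasFDerivAt (fun s : ℝ => (s, x)) (ContinuousLinearMap.inl ℝ ℝ Plane) t :=
      hasFDerivAt_prodMk_left t x
    exact ((hder (0, e i)).comp t h2).hasDerivAt
  have h1' : dt (fun s => Dislocation.pd i (G s)) t x =
      fderiv ℝ (fderiv ℝ Q) (t, x) (1, 0) (0, e i) := by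
    refine (h1.congr_of_eventuallyEq ?_).deriv
    filter_upwards [isOpen_Ioo.mem_nhds ht] with s hs
    exact hpd s hs x
  have h4 : HasFDerivAt (fun y => fderiv ℝ Q (t, y) (1, 0))
      (((ContinuousLinearMap.apply ℝ ℝ ((1 : ℝ), (0 : Plane))).comp
        (fderiv ℝ (fderiv ℝ Q) (t, x))).comp (ContinuousLinearMap.inr ℝ ℝ Plane)) x := by
    have h2 : HasFDerivAt (fun y : Plane => (t, y)) (ContinuousLinearMap.inr ℝ ℝ Plane) x :=
      hasFDerivAt_prodMk_right t x
    exact (hder (1, 0)).comp x h2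
  have h5 : dt G t = fun y => fderiv ℝ Q (t, y) (1, 0) := funext fun y => h.dt_eq ht y
  rw [h1', Dislocation.pd, h5, h4.fderiv]
  exact hsymm (1, 0) (0, e i)

theorem pd_comm {f : Plane → ℝ} (h : ContDiff ℝ ∞ f) (i j : Fin 2) :
    pd i (pd j f) = pd j (pd i f) := by
  funext x
  have hsymm : IsSymmSndFDerivAt ℝ f x := h.contDiffAt.isSymmSndFDerivAt (by
    rw [minSmoothness_of_isRCLikeNormedField]; exact WithTop.coe_le_coe.2 le_top)
  have hdd : DifferentiableAt ℝ (fderiv ℝ f) x :=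
    (h.fderiv_right (m := ∞) (by simp)).differentiable (by simp) x
  have key : ∀ i j, pd i (pd j f) x = fderiv ℝ (fderiv ℝ f) x (e i) (e j) := by
    intro i j
    have h3 := (hdd.hasFDerivAt.clm_apply (hasFDerivAt_const (e j) x)).fderiv
    unfold Dislocation.pd
    rw [h3]
    simp
  rw [key, key]
  exact hsymm _ _

/-- Continuity in time, uniformly on the fundamental cell. -/
theorem eventually_forall_cell {I : Set ℝ}
    (h : ContinuousOn (fun p : ℝ × Plane => G p.1 p.2) (I ×ˢ univ)) {t : ℝ} (ht : t ∈ I)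
    {r : ℝ} (hr : 0 < r) :
    ∀ᶠ s in nhdsWithin t I, ∀ x ∈ Icc (0 : Plane) 1, |G s x - G t x| < r := by
  rw [eventually_nhdsWithin_iff]
  have : ∀ᶠ s in nhds t, ∀ x ∈ Icc (0 : Plane) 1, s ∈ I → |G s x - G t x| < r := by
    refine IsCompact.eventually_forall_of_forall_eventually isCompact_Icc fun y _ => ?_
    have h1 := h (t, y) ⟨ht, mem_univ _⟩
    have hGt : Continuous (G t) := by
      rw [← continuousOn_univ]
      exact h.comp (Continuous.prodMk_right t).continuousOn fun y _ => ⟨ht, mem_univ _⟩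
    have h2 := Metric.tendsto_nhds.1 h1 (r / 2) (by positivity)
    have h3 : ∀ᶠ z : ℝ × Plane in nhds (t, y), dist (G t z.2) (G t y) < r / 2 :=
      Metric.tendsto_nhds.1 ((hGt.comp continuous_snd).tendsto (t, y)) (r / 2) (by positivity)
    rw [eventually_nhdsWithin_iff] at h2
    filter_upwards [h2, h3] with z h2 h3 hz
    have h4 := h2 ⟨hz, mem_univ _⟩
    rw [Real.dist_eq] at h3 h4
    rw [abs_lt] at *
    constructor <;> linarith
  filter_upwards [this] with s hs hsI x hx using hs x hx hsI

theorem continuousOn_slice {I : Set ℝ}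
    (h : ContinuousOn (fun p : ℝ × Plane => G p.1 p.2) (I ×ˢ univ)) {t : ℝ} (ht : t ∈ I) :
    Continuous (G t) := by
  rw [← continuousOn_univ]
  exact h.comp (Continuous.prodMk_right t).continuousOn fun y _ => ⟨ht, mem_univ _⟩

theorem continuousOn_integral_descend {I : Set ℝ}
    (h : ContinuousOn (fun p : ℝ × Plane => G p.1 p.2) (I ×ˢ univ)) :
    ContinuousOn (fun t => ∫ x, descend (G t) x ∂torusMeasure) I := by
  intro t ht
  refine Metric.tendsto_nhds.2 fun r hr => ?_
  filter_upwards [eventually_forall_cell h ht (half_pos hr), self_mem_nhdsWithin] with s hs hsI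
  rw [dist_eq_norm, ← integral_sub (integrable_descend (continuousOn_slice h hsI))
    (integrable_descend (continuousOn_slice h ht))]
  have := norm_integral_le_of_norm_le_const (μ := torusMeasure)
    (f := fun x => descend (G s) x - descend (G t) x) (C := r / 2)
    (Filter.Eventually.of_forall fun x => (hs _ (cellRep_mem x)).le)
  simp only [probReal_univ, mul_one] at this
  linarith

theorem norm_toL2_sub_le {f g : Plane → ℝ} (hf : Continuous f) (hg : Continuous g) {r : ℝ}
    (hr : 0 ≤ r) (h : ∀ x ∈ Icc (0 : Plane) 1, |f x - g x| ≤ r) :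
    ‖toL2 (descend f) - toL2 (descend g)‖ ≤ r := by
  refine abs_le_of_sq_le_sq' ?_ hr |>.2
  rw [norm_L2R_sq]
  have h1 : ∫ x, (toL2 (descend f) - toL2 (descend g) : L2R) x ^ 2 ∂torusMeasure ≤
      ∫ _, r ^ 2 ∂torusMeasure := by
    refine integral_mono_ae (Lp.memLp _).integrable_sq (integrable_const _) ?_
    filter_upwards [Lp.coeFn_sub (toL2 (descend f)) (toL2 (descend g)), coeFn_toL2 hf,
      coeFn_toL2 hg] with x h1 h2 h3
    rw [h1, Pi.sub_apply, h2, h3, ← sq_abs]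
    have := h _ (cellRep_mem x)
    gcongr
    exact this
  simpa using h1

theorem continuousOn_toL2 {I : Set ℝ}
    (h : ContinuousOn (fun p : ℝ × Plane => G p.1 p.2) (I ×ˢ univ)) :
    ContinuousOn (fun t => toL2 (descend (G t))) I := by
  intro t ht
  refine Metric.tendsto_nhds.2 fun r hr => ?_
  filter_upwards [eventually_forall_cell h ht (half_pos hr), self_mem_nhdsWithin] with s hs hsI
  rw [dist_eq_norm]
  have := norm_toL2_sub_le (continuousOn_slice h hsI) (continuousOn_slice h ht) (half_pos hr).le
    (fun x hx => (hs x hx).le)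
  linarith

theorem SmoothOn.hasDerivAt_integral (h : SmoothOn T G) {t : ℝ} (ht : t ∈ Ioo 0 T) :
    HasDerivAt (fun s => ∫ x, descend (G s) x ∂torusMeasure)
      (∫ x, descend (dt G t) x ∂torusMeasure) t := by
  obtain ⟨a, b, htab, hnhds, hab⟩ : ∃ a b, t ∈ Icc a b ∧ Icc a b ∈ nhds t ∧ Icc a b ⊆ Ioo 0 T :=
    exists_Icc_mem_subset_of_mem_nhds (isOpen_Ioo.mem_nhds ht)
  obtain ⟨C, hC⟩ := (isCompact_Icc (a := a) (b := b) |>.prod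
    (isCompact_Icc (a := (0 : Plane)) (b := 1))).exists_bound_of_continuousOn
    (h.contDiffOn_dt.continuousOn.mono (prod_mono hab (subset_univ _)))
  have hI : ∀ {s}, s ∈ Icc a b → s ∈ Ico 0 T := fun hs => Ioo_subset_Ico_self (hab hs)
  refine (hasDerivAt_integral_of_dominated_loc_of_deriv_le (bound := fun _ => C)
    (F' := fun s x => descend (dt G s) x) hnhds ?_ ?_ ?_ ?_ (integrable_const _) ?_).2
  · filter_upwards [hnhds] with s hs
    exact (integrable_descend (h.contDiff (hI hs)).continuous).aestronglyMeasurable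
  · exact integrable_descend (h.contDiff (hI htab)).continuous
  · exact (integrable_descend (h.contDiff_dt ht).continuous).aestronglyMeasurable
  · exact Filter.Eventually.of_forall fun x s hs => hC (s, cellRep x) ⟨hs, cellRep_mem x⟩
  · exact Filter.Eventually.of_forall fun x s hs => h.hasDerivAt (hab hs) (cellRep x)

end Regularity

/-! ### Mollification of periodic functions -/

theorem measurable_toTorus : Measurable toTorus :=
  measurable_pi_lambda _ fun i => AddCircle.measurable_mk'.comp (measurable_pi_apply i)

theorem toTorus_sub (x y : Plane) : toTorus (x - y) = toTorus x - toTorus y := rfl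

theorem exists_cellRep_toTorus (x : Plane) :
    ∃ k : Fin 2 → ℤ, cellRep (toTorus x) = x + (k 0 • e 0 + k 1 • e 1) := by
  have h : ∀ i, ∃ n : ℤ, cellRep (toTorus x) i = x i + n := by
    intro i
    have h1 : ((cellRep (toTorus x) i : ℝ) : UnitAddCircle) = (x i : UnitAddCircle) :=
      congrFun (toTorus_cellRep (toTorus x)) i
    rw [eq_comm, QuotientAddGroup.eq, AddSubgroup.mem_zmultiples_iff] at h1
    obtain ⟨n, hn⟩ := h1
    refine ⟨n, ?_⟩
    simp at hn
    linarith
  choose k hk using h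
  refine ⟨k, ?_⟩
  ext i
  rw [hk i]
  fin_cases i <;> simp [e]

/-- An almost everywhere periodic function comes from the torus. -/
theorem ae_eq_descend_toTorus {f : Plane → ℝ} (h : ∀ i, ∀ᵐ x, f (x + e i) = f x) :
    ∀ᵐ x, f x = descend f (toTorus x) := by
  have hqmp : ∀ v : Plane, Measure.QuasiMeasurePreserving (fun x : Plane => x + v) volume volume :=
    fun v => (measurePreserving_add_right volume v).quasiMeasurePreserving
  let Λ : AddSubgroup Plane :=
    { carrier := {v | ∀ᵐ x, f (x + v) = f x}
      zero_mem' := by simp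
      add_mem' := by
        intro v w hv hw
        have h1 : ∀ᵐ x, f (x + v + w) = f (x + v) := (hqmp v).ae hw
        have hv' : ∀ᵐ x, f (x + v) = f x := hv
        filter_upwards [h1, hv'] with x h1 h2
        rw [← add_assoc, h1, h2]
      neg_mem' := by
        intro v hv
        have h1 : ∀ᵐ x, f (x + -v + v) = f (x + -v) := (hqmp (-v)).ae hv
        filter_upwards [h1] with x h1
        rw [← h1, neg_add_cancel_right] }
  have hΛ : ∀ k : Fin 2 → ℤ, ∀ᵐ x, f (x + (k 0 • e 0 + k 1 • e 1)) = f x := fun k =>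
    Λ.add_mem (Λ.zsmul_mem (h 0) _) (Λ.zsmul_mem (h 1) _)
  filter_upwards [ae_all_iff.2 hΛ] with x hx
  obtain ⟨k, hk⟩ := exists_cellRep_toTorus x
  rw [descend_apply, hk, hx k]

theorem measurePreserving_sub_toTorus (ν : Measure Plane) [IsProbabilityMeasure ν] :
    MeasurePreserving (fun p : Plane × Torus => p.2 - toTorus p.1) (ν.prod torusMeasure)
      torusMeasure := by
  have h1 : MeasurePreserving (fun p : Plane × Torus => (p.1, p.2 - toTorus p.1))
      (ν.prod torusMeasure) (ν.prod torusMeasure) := by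
    refine (MeasurePreserving.id ν).skew_product (g := fun y z => z - toTorus y) ?_ ?_
    · exact measurable_snd.sub (measurable_toTorus.comp measurable_fst)
    · exact Filter.Eventually.of_forall fun y =>
        (measurePreserving_sub_right torusMeasure (toTorus y)).map_eq
  exact measurePreserving_snd.comp h1

/-- Averaging over translations decreases the integral of a convex function. -/
theorem integral_convex_average_le {F : Torus → ℝ} (hF : Integrable F torusMeasure)
    {s : Set ℝ} {Φ : ℝ → ℝ} (hΦ : ConvexOn ℝ s Φ) (hc : ContinuousOn Φ s) (hs : IsClosed s)
    (hFs : ∀ᵐ x ∂torusMeasure, F x ∈ s) (hΦF : Integrable (fun x => Φ (F x)) torusMeasure)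
    (hΦ0 : ∀ y ∈ s, 0 ≤ Φ y) (ν : Measure Plane) [IsProbabilityMeasure ν] :
    ∫ z, Φ (∫ y, F (z - toTorus y) ∂ν) ∂torusMeasure ≤ ∫ z, Φ (F z) ∂torusMeasure := by
  have hmp := measurePreserving_sub_toTorus ν
  have hi1 : Integrable (fun p : Plane × Torus => F (p.2 - toTorus p.1)) (ν.prod torusMeasure) :=
    hmp.integrable_comp_of_integrable hF
  have hi2 : Integrable (fun p : Plane × Torus => Φ (F (p.2 - toTorus p.1)))
      (ν.prod torusMeasure) := hmp.integrable_comp_of_integrable hΦF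
  have hae : ∀ᵐ p ∂(ν.prod torusMeasure), F (p.2 - toTorus p.1) ∈ s :=
    hmp.quasiMeasurePreserving.ae hFs
  have hae' : ∀ᵐ z ∂torusMeasure, ∀ᵐ y ∂ν, F (z - toTorus y) ∈ s := by
    have := (Measure.measurePreserving_swap (μ := torusMeasure) (ν := ν)).quasiMeasurePreserving.ae hae
    exact Measure.ae_ae_of_ae_prod this
  have hmem : ∀ᵐ z ∂torusMeasure, ∫ y, F (z - toTorus y) ∂ν ∈ s := by
    filter_upwards [hae', hi1.prod_left_ae] with z h1 h2
    exact hΦ.1.integral_mem hs h1 h2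
  have hjensen : ∀ᵐ z ∂torusMeasure, Φ (∫ y, F (z - toTorus y) ∂ν) ≤
      ∫ y, Φ (F (z - toTorus y)) ∂ν := by
    filter_upwards [hae', hi1.prod_left_ae, hi2.prod_left_ae] with z h1 h2 h3
    exact hΦ.map_integral_le hc hs h1 h2 h3
  calc ∫ z, Φ (∫ y, F (z - toTorus y) ∂ν) ∂torusMeasure
      ≤ ∫ z, ∫ y, Φ (F (z - toTorus y)) ∂ν ∂torusMeasure :=
        integral_mono_of_nonneg (hmem.mono fun z hz => hΦ0 _ hz) hi2.integral_prod_right hjensen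
    _ = ∫ p, Φ (F (p.2 - toTorus p.1)) ∂(ν.prod torusMeasure) := by
        rw [integral_prod_symm _ hi2]
    _ = ∫ z, Φ (F z) ∂torusMeasure := by
        have h1 := integral_map (μ := ν.prod torusMeasure) hmp.measurable.aemeasurable
          (f := fun z => Φ (F z)) (by rw [hmp.map_eq]; exact hΦF.aestronglyMeasurable)
        rw [hmp.map_eq] at h1
        exact h1.symm

/-- The rescaled mollifier `η_ε`. -/
def scaled (η : Plane → ℝ) (ε : ℝ) (y : Plane) : ℝ := (ε ^ 2)⁻¹ * η (ε⁻¹ • y)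

/-- The probability measure with density `η_ε`. -/
def mollMeasure (η : Plane → ℝ) (ε : ℝ) : Measure Plane :=
  volume.withDensity fun y => ENNReal.ofReal (scaled η ε y)

section Mollifier

variable {η : Plane → ℝ} {ε : ℝ}

theorem IsMollifier.contDiff_scaled (hη : IsMollifier η) (ε : ℝ) : ContDiff ℝ ∞ (scaled η ε) :=
  contDiff_const.mul (hη.contDiff.comp (contDiff_const_smul _))

theorem IsMollifier.hasCompactSupport_scaled (hη : IsMollifier η) (hε : 0 < ε) :
    HasCompactSupport (scaled η ε) :=
  (hη.compact.comp_smul (inv_ne_zero hε.ne')).mul_left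

theorem IsMollifier.scaled_nonneg (hη : IsMollifier η) (ε : ℝ) (y : Plane) : 0 ≤ scaled η ε y :=
  mul_nonneg (inv_nonneg.2 (sq_nonneg _)) (hη.nonneg _)

theorem IsMollifier.integral_scaled (hη : IsMollifier η) (hε : 0 < ε) :
    ∫ y, scaled η ε y = 1 := by
  unfold scaled
  rw [integral_const_mul, Measure.integral_comp_smul, hη.integral_eq_one]
  simp
  field_simp

theorem IsMollifier.isProbabilityMeasure (hη : IsMollifier η) (hε : 0 < ε) :
    IsProbabilityMeasure (mollMeasure η ε) := by
  constructor
  rw [mollMeasure, withDensity_apply _ MeasurableSet.univ, Measure.restrict_univ,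
    ← ofReal_integral_eq_lintegral_ofReal, hη.integral_scaled hε, ENNReal.ofReal_one]
  · exact (hη.contDiff_scaled ε).continuous.integrable_of_hasCompactSupport
      (hη.hasCompactSupport_scaled hε)
  · exact Filter.Eventually.of_forall (hη.scaled_nonneg ε)

theorem IsMollifier.integral_mollMeasure (hη : IsMollifier η) (f : Plane → ℝ) :
    ∫ y, f y ∂(mollMeasure η ε) = ∫ y, f y * scaled η ε y := by
  rw [mollMeasure, integral_withDensity_eq_integral_toReal_smul
    (hη.contDiff_scaled ε).continuous.measurable.ennreal_ofReal (by simp)]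
  refine integral_congr_ae (Filter.Eventually.of_forall fun y => ?_)
  simp only [ENNReal.toReal_ofReal (hη.scaled_nonneg ε y), smul_eq_mul, mul_comm]

/-- The mollification of an almost everywhere periodic function, seen on the torus. -/
theorem IsMollifier.descend_mollify (hη : IsMollifier η) {f : Plane → ℝ}
    (h : ∀ i, ∀ᵐ x, f (x + e i) = f x) (z : Torus) :
    descend (fun x => ∫ y, f (x - y) * scaled η ε y) z =
      ∫ y, descend f (z - toTorus y) ∂(mollMeasure η ε) := by
  rw [hη.integral_mollMeasure, descend_apply]
  refine integral_congr_ae ?_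
  have h1 : ∀ᵐ y, f (cellRep z - y) = descend f (toTorus (cellRep z - y)) :=
    (Measure.measurePreserving_sub_left volume (cellRep z)).quasiMeasurePreserving.ae
      (ae_eq_descend_toTorus h)
  filter_upwards [h1] with y hy
  rw [hy, toTorus_sub, toTorus_cellRep]

/-- Mollification commutes with the weak derivative. -/
theorem IsMollifier.pd_mollify (hη : IsMollifier η) (hε : 0 < ε) {f g : Plane → ℝ}
    (hf : LocallyIntegrable f) (hg : IsWeakPartialOne f g) (x : Plane) :
    HasFDerivAt (fun x => ∫ y, f (x - y) * scaled η ε y)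
      (fderiv ℝ (fun x => ∫ y, f (x - y) * scaled η ε y) x) x ∧
    pd 0 (fun x => ∫ y, f (x - y) * scaled η ε y) x = ∫ y, g (x - y) * scaled η ε y := by
  set ζ := scaled η ε with hζ
  have hζs : ContDiff ℝ ∞ ζ := hη.contDiff_scaled ε
  have hζc : HasCompactSupport ζ := hη.hasCompactSupport_scaled hε
  have hflip : ∀ (u : Plane → ℝ) x, ∫ y, u (x - y) * ζ y = ∫ y, u y * ζ (x - y) := by
    intro u x
    rw [← integral_sub_left_eq_self (fun y => u y * ζ (x - y)) volume x]
    simp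
  have hconv : (fun x => ∫ y, f (x - y) * ζ y) =
      MeasureTheory.convolution f ζ (ContinuousLinearMap.mul ℝ ℝ) volume := by
    funext x
    rw [hflip]
    rfl
  have hd := hζc.hasFDerivAt_convolution_right (ContinuousLinearMap.mul ℝ ℝ) hf
    (hζs.of_le (by simp)) x
  rw [hconv]
  refine ⟨hd.differentiableAt.hasFDerivAt, ?_⟩
  rw [pd, hd.fderiv]
  have hex := (hζc.fderiv (𝕜 := ℝ)).convolutionExists_right
    ((ContinuousLinearMap.mul ℝ ℝ).precompR Plane) hf (hζs.continuous_fderiv (by simp)) x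
  have h1 : (MeasureTheory.convolution f (fderiv ℝ ζ) ((ContinuousLinearMap.mul ℝ ℝ).precompR Plane)
      volume x) (e 0) = ∫ y, f y * pd 0 ζ (x - y) := by
    unfold MeasureTheory.convolution
    rw [ContinuousLinearMap.integral_apply hex]
    rfl
  rw [h1]
  have hφ : ContDiff ℝ ∞ fun y => ζ (x - y) := hζs.comp (contDiff_const.sub contDiff_id)
  have hφc : HasCompactSupport fun y => ζ (x - y) :=
    hζc.comp_homeomorph (Homeomorph.subLeft x)
  have hw := hg.2 _ hφ hφc
  have hpd : ∀ y, pd 0 (fun y => ζ (x - y)) y = -pd 0 ζ (x - y) := by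
    intro y
    have h2 := (hζs.differentiable (by simp) (x - y)).hasFDerivAt.comp y
      ((hasFDerivAt_id y).const_sub x)
    have h3 : fderiv ℝ (fun y => ζ (x - y)) y =
        (fderiv ℝ ζ (x - y)).comp (-ContinuousLinearMap.id ℝ Plane) := h2.fderiv
    unfold pd
    rw [h3]
    simp
  simp only [hpd, mul_neg, integral_neg, neg_inj] at hw
  rw [hw, hflip]

end Mollifier

/-! ### The regularised initial data -/

/-- The shifted entropy density `(y + δ) log (y + δ)`. -/
def ent (δ y : ℝ) : ℝ := (y + δ) * Real.log (y + δ)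

theorem mul_log_le_mul_log {y z : ℝ} (hy : 0 < y) (hyz : y ≤ z) (hz : 1 ≤ z) :
    y * Real.log y ≤ z * Real.log z := by
  rcases le_total y 1 with h | h
  · exact (mul_nonpos_of_nonneg_of_nonpos hy.le (Real.log_nonpos hy.le h)).trans
      (mul_nonneg (by linarith) (Real.log_nonneg hz))
  · exact mul_le_mul hyz (Real.log_le_log hy hyz) (Real.log_nonneg h) (by linarith)

theorem IsWeakPartialOne.ae_periodic {f g : Plane → ℝ}
    (h : IsWeakPartialOne f g) {i : Fin 2} (hp : ∀ᵐ x, f (x + e i) = f x) :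
    ∀ᵐ x, g (x + e i) = g x := by
  have hg' : LocallyIntegrable (fun x => g (x + e i)) := by
    rw [locallyIntegrable_iff]
    intro K hK
    have hK' : IsCompact ((fun x => x + e i) '' K) := hK.image (continuous_add_const _)
    have h1 := h.1.integrableOn_isCompact hK'
    exact ((measurePreserving_add_right volume (e i)).integrableOn_image
      (measurableEmbedding_addRight _)).1 h1
  refine ae_eq_of_integral_contDiff_smul_eq hg' h.1 fun φ hφ hφc => ?_
  have hφ' : ContDiff ℝ ∞ fun x => φ (x - e i) := hφ.comp (contDiff_id.sub contDiff_const)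
  have hφc' : HasCompactSupport fun x => φ (x - e i) := by
    exact hφc.comp_homeomorph (Homeomorph.subRight (e i))
  have hpd : ∀ x, pd 0 (fun x => φ (x - e i)) x = pd 0 φ (x - e i) := by
    intro x
    unfold pd
    simp only [sub_eq_add_neg]
    rw [fderiv_comp_add_right]
  have h1 := h.2 _ hφ' hφc'
  have h2 := h.2 _ hφ hφc
  have e1 : ∫ x, g x * φ (x - e i) = ∫ x, g (x + e i) * φ x := by
    rw [← integral_add_right_eq_self _ (e i)]
    simp
  have e2 : ∫ x, f x * pd 0 φ (x - e i) = ∫ x, f x * pd 0 φ x := by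
    rw [← integral_add_right_eq_self _ (e i)]
    refine integral_congr_ae ?_
    filter_upwards [hp] with x hx
    rw [hx, add_sub_cancel_right]
  simp only [hpd] at h1
  rw [e1, e2, h2, neg_inj] at h1
  simp only [smul_eq_mul, mul_comm (φ _)]
  exact h1.symm

theorem isWeakPartialOne_sub_linear {f g : Plane → ℝ} (hf : LocallyIntegrable f)
    (h : IsWeakPartialOne f g) (L : ℝ) :
    IsWeakPartialOne (fun x => f x - L * x 0) (fun x => g x - L) := by
  refine ⟨h.1.sub (locallyIntegrable_const L), fun φ hφ hφc => ?_⟩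
  have hφ1 : Continuous φ := hφ.continuous
  have hpdc : Continuous (pd 0 φ) := (contDiff_pd 0 hφ).continuous
  have hpdcs : HasCompactSupport (pd 0 φ) := hφc.fderiv_apply (𝕜 := ℝ) (e 0)
  have hi : ∀ {u v : Plane → ℝ}, LocallyIntegrable u → Continuous v → HasCompactSupport v →
      Integrable fun x => u x * v x := by
    intro u v hu hv hvc
    exact hu.integrable_smul_right_of_hasCompactSupport hv hvc
  have hlin : LocallyIntegrable (fun x : Plane => L * x 0) :=
    (continuous_const.mul (continuous_apply 0)).locallyIntegrable
  have hd : ∀ x : Plane, HasFDerivAt (fun x : Plane => L * x 0)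
      (L • ContinuousLinearMap.proj (R := ℝ) (φ := fun _ : Fin 2 => ℝ) 0) x := fun x =>
    (ContinuousLinearMap.proj (R := ℝ) (φ := fun _ : Fin 2 => ℝ) 0).hasFDerivAt.const_mul L
  have hd' : ∀ x : Plane, fderiv ℝ (fun x : Plane => L * x 0) x (e 0) = L := by
    intro x
    rw [(hd x).fderiv]
    simp [e]
  have hLφ := hi (locallyIntegrable_const L) hφ1 hφc
  have hparts : ∫ x : Plane, L * x 0 * pd 0 φ x = -∫ x, L * φ x := by
    have := integral_mul_fderiv_eq_neg_fderiv_mul_of_integrable (μ := (volume : Measure Plane))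
      (f := fun x : Plane => L * x 0) (g := φ) (v := e 0) (by simpa only [hd'] using hLφ)
      (hi hlin hpdc hpdcs) (hi hlin hφ1 hφc) (fun x _ => (hd x).differentiableAt)
      (fun x _ => hφ.differentiable (by simp) x)
    simp only [hd'] at this
    exact this
  simp only [sub_mul]
  rw [integral_sub (hi hf hpdc hpdcs) (hi hlin hpdc hpdcs), integral_sub (hi h.1 hφ1 hφc) hLφ,
    h.2 φ hφ hφc, hparts]
  ring

theorem convexOn_shifted_mul_log :
    ConvexOn ℝ (Ici 0) fun y : ℝ => (y + 2) * Real.log (y + 2) := by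
  have h := Real.convexOn_mul_log.translate_left (2 : ℝ)
  refine (h.subset (fun y hy => ?_) (convex_Ici 0))
  have : (0 : ℝ) ≤ y := hy
  simp only [mem_preimage, mem_Ici]
  linarith

theorem IsInitialDatum.locallyIntegrable {L : ℝ} {ρ₀ : Plane → ℝ} (h : IsInitialDatum L ρ₀) :
    LocallyIntegrable ρ₀ := by
  rw [locallyIntegrable_iff]
  intro K hK
  have : IsFiniteMeasure (volume.restrict K) := ⟨by simpa using hK.measure_lt_top⟩
  exact (h.memLp_loc K hK).integrable (by norm_num)

/-- The entropy and the `L²` norm of the regularised initial data are bounded uniformly in `ε`. -/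
theorem IsInitialDatum.exists_bound {η : Plane → ℝ} (hη : IsMollifier η) {L : ℝ}
    {ρ₀ : Plane → ℝ} (h : IsInitialDatum L ρ₀) :
    ∃ K : ℝ, ∀ ε, 0 < ε → ε ≤ 1 → ContDiff ℝ ∞ (regDatum η L ε ρ₀) →
      (∀ δ, 0 < δ → δ ≤ 1 →
        ∫ x, descend (fun x => ent δ (pd 0 (regDatum η L ε ρ₀) x)) x ∂torusMeasure ≤ K) ∧
      ∫ x, descend (fun x => (regDatum η L ε ρ₀ x - (L + ε) * x 0) ^ 2) x ∂torusMeasure ≤ K := by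
  obtain ⟨g, hg, hg0, hgi, hgl⟩ := h.deriv_one
  have hloc := h.locallyIntegrable
  set f : Plane → ℝ := fun x => ρ₀ x - L * x 0 with hf
  have hfloc : LocallyIntegrable f :=
    hloc.sub (continuous_const.mul (continuous_apply 0)).locallyIntegrable
  have hfg : IsWeakPartialOne f fun x => g x - L := isWeakPartialOne_sub_linear hloc hg L
  have hfp : ∀ i, ∀ᵐ x, f (x + e i) = f x := by
    intro i
    fin_cases i
    · filter_upwards [h.shift_one] with x hx
      have he : (x + e 0) 0 = x 0 + 1 := by simp [e]
      simp only [hf, hx, he, Fin.zero_eta]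
      ring
    · filter_upwards [h.shift_two] with x hx
      have he : (x + e 1) 0 = x 0 := by simp [e]
      simp only [hf, hx, he, Fin.mk_one]
  have hgp : ∀ i, ∀ᵐ x, g (x + e i) = g x := by
    intro i
    filter_upwards [hfg.ae_periodic (hfp i)] with x hx
    linarith
  have hgd0 : ∀ᵐ z ∂torusMeasure, descend g z ∈ Ici (0 : ℝ) :=
    measurePreserving_cellRep.quasiMeasurePreserving.ae (ae_restrict_of_ae hg0)
  have hfL2 : MemLp (descend f) 2 torusMeasure := by
    have h1 : MemLp f 2 (volume.restrict (Icc (0 : Plane) 1)) := by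
      refine (h.memLp_loc _ isCompact_Icc).sub ?_
      have hc : Continuous fun x : Plane => L * x 0 := continuous_const.mul (continuous_apply 0)
      obtain ⟨C, hC⟩ := (isCompact_Icc (a := (0 : Plane)) (b := 1)).exists_bound_of_continuousOn
        hc.continuousOn
      have : IsFiniteMeasure (volume.restrict (Icc (0 : Plane) 1)) :=
        ⟨by simpa using isCompact_Icc.measure_lt_top⟩
      exact MemLp.of_bound hc.aestronglyMeasurable C
        ((ae_restrict_iff' measurableSet_Icc).2 (Filter.Eventually.of_forall hC))
    exact h1.comp_measurePreserving measurePreserving_cellRep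
  set Φ : ℝ → ℝ := fun y => (y + 2) * Real.log (y + 2) with hΦ
  have hΦ0 : ∀ y ∈ Ici (0 : ℝ), 0 ≤ Φ y := fun y hy => by
    have : (0 : ℝ) ≤ y := hy
    exact mul_nonneg (by linarith) (Real.log_nonneg (by linarith))
  have hΦc : ContinuousOn Φ (Ici 0) := by
    refine ContinuousOn.mul (by fun_prop) (ContinuousOn.log (by fun_prop) fun y hy => ?_)
    have : (0 : ℝ) ≤ y := hy
    positivity
  have hΦg : Integrable (fun z => Φ (descend g z)) torusMeasure := by
    refine Integrable.mono' (g := fun z => |descend g z| * Real.log (Real.exp 1 + |descend g z|) +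
      2 * (|descend g z| + 1)) (hgl.add ((hgi.abs.add (integrable_const 1)).const_mul 2)) ?_ ?_
    · have hm := hgi.aestronglyMeasurable.aemeasurable
      exact ((hm.add_const 2).mul (Real.measurable_log.comp_aemeasurable (hm.add_const 2))).aestronglyMeasurable
    · filter_upwards [hgd0] with z hz
      have hz0 : 0 ≤ descend g z := hz
      rw [Real.norm_of_nonneg (hΦ0 _ hz), abs_of_nonneg hz0]
      have h1 : Real.log (descend g z + 2) ≤ Real.log (Real.exp 1 + descend g z) := by
        refine Real.log_le_log (by linarith) ?_
        have := Real.add_one_le_exp 1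
        linarith
      have h2 : Real.log (descend g z + 2) ≤ descend g z + 1 := by
        have := Real.log_le_sub_one_of_pos (show 0 < descend g z + 2 by linarith)
        linarith
      have h3 := mul_le_mul_of_nonneg_left h1 hz0
      simp only [hΦ]
      nlinarith
  refine ⟨max (∫ z, Φ (descend g z) ∂torusMeasure) (∫ z, descend f z ^ 2 ∂torusMeasure),
    fun ε hε hε1 hsm => ⟨fun δ hδ hδ1 => le_max_of_le_left ?_, le_max_of_le_right ?_⟩⟩
  · have := hη.isProbabilityMeasure hε
    set A : Plane → ℝ := fun x => ∫ y, g (x - y) * scaled η ε y with hA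
    have hpd : ∀ x, pd 0 (regDatum η L ε ρ₀) x = A x + ε := by
      intro x
      obtain ⟨h1, h2⟩ := hη.pd_mollify hε hfloc hfg x
      have hreg : regDatum η L ε ρ₀ =
          fun x => (∫ y, f (x - y) * scaled η ε y) + (L + ε) * x 0 := rfl
      have hlin : HasFDerivAt (fun x : Plane => (L + ε) * x 0)
          ((L + ε) • ContinuousLinearMap.proj (R := ℝ) (φ := fun _ : Fin 2 => ℝ) 0) x :=
        (ContinuousLinearMap.proj (R := ℝ) (φ := fun _ : Fin 2 => ℝ) 0).hasFDerivAt.const_mul (L + ε)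
      have h3 : pd 0 (regDatum η L ε ρ₀) x =
          pd 0 (fun x => ∫ y, f (x - y) * scaled η ε y) x + (L + ε) := by
        unfold pd
        rw [hreg, (h1.fun_add hlin).fderiv]
        simp [e]
      rw [h3, h2]
      have hsc : Integrable (scaled η ε) := (hη.contDiff_scaled ε).continuous.integrable_of_hasCompactSupport
        (hη.hasCompactSupport_scaled hε)
      have hgi' : Integrable fun y => g (x - y) * scaled η ε y := by
        have h4 : Integrable fun y => g y * scaled η ε (x - y) :=
          hg.1.integrable_smul_right_of_hasCompactSupport
            ((hη.contDiff_scaled ε).continuous.comp (continuous_const.sub continuous_id))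
            ((hη.hasCompactSupport_scaled hε).comp_homeomorph (Homeomorph.subLeft x))
        simpa using h4.comp_sub_left x
      have h5 : ∫ y, (g (x - y) - L) * scaled η ε y = A x - L := by
        simp only [sub_mul]
        rw [integral_sub hgi' (hsc.const_mul L), integral_const_mul, hη.integral_scaled hε, mul_one]
      rw [h5]
      ring
    have hA0 : ∀ x, 0 ≤ A x := by
      intro x
      refine integral_nonneg_of_ae ?_
      have h1 : ∀ᵐ y, 0 ≤ g (x - y) :=
        (Measure.measurePreserving_sub_left volume x).quasiMeasurePreserving.ae hg0
      filter_upwards [h1] with y hy using mul_nonneg hy (hη.scaled_nonneg ε y)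
    have hAc : Continuous A := by
      have h1 : A = fun x => pd 0 (regDatum η L ε ρ₀) x - ε := by
        funext x
        rw [hpd]
        ring
      rw [h1]
      exact (contDiff_pd 0 hsm).continuous.sub continuous_const
    have hΦA : Continuous fun x => Φ (A x) :=
      hΦc.comp_continuous hAc hA0
    have hent : Continuous fun x => ent δ (pd 0 (regDatum η L ε ρ₀) x) := by
      simp only [hpd]
      refine Continuous.mul (by fun_prop) (Continuous.log (by fun_prop) fun x => ?_)
      have := hA0 x
      positivity
    calc ∫ x, descend (fun x => ent δ (pd 0 (regDatum η L ε ρ₀) x)) x ∂torusMeasure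
        ≤ ∫ x, descend (fun x => Φ (A x)) x ∂torusMeasure := by
          refine integral_mono (integrable_descend hent) (integrable_descend hΦA) fun z => ?_
          simp only [descend_apply, hpd, ent, hΦ]
          have := hA0 (cellRep z)
          exact mul_log_le_mul_log (by linarith) (by linarith) (by linarith)
      _ = ∫ z, Φ (∫ y, descend g (z - toTorus y) ∂(mollMeasure η ε)) ∂torusMeasure := by
          congr 1
          funext z
          rw [← hη.descend_mollify hgp]
          rfl
      _ ≤ _ := integral_convex_average_le hgi convexOn_shifted_mul_log hΦc isClosed_Ici hgd0 hΦg
          hΦ0 _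
  · have := hη.isProbabilityMeasure hε
    calc ∫ x, descend (fun x => (regDatum η L ε ρ₀ x - (L + ε) * x 0) ^ 2) x ∂torusMeasure
        = ∫ z, (∫ y, descend f (z - toTorus y) ∂(mollMeasure η ε)) ^ 2 ∂torusMeasure := by
          congr 1
          funext z
          rw [← hη.descend_mollify hfp]
          simp only [descend_apply, regDatum, add_sub_cancel_right]
          rfl
      _ ≤ _ := integral_convex_average_le (Φ := fun y => y ^ 2) (hfL2.integrable (by norm_num))
          (Even.convexOn_pow (n := 2) (by norm_num)) (by fun_prop) isClosed_univ (by simp)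
          hfL2.integrable_sq (fun y _ => sq_nonneg y) _

/-! ### A single component of the system -/

theorem IsPeriodic.comp {f : Plane → ℝ} (h : IsPeriodic f) (F : ℝ → ℝ) :
    IsPeriodic fun x => F (f x) := fun i x => by simp only [h i x]

theorem pd_add {i : Fin 2} {f g : Plane → ℝ} {x : Plane} (hf : DifferentiableAt ℝ f x)
    (hg : DifferentiableAt ℝ g x) : pd i (fun y => f y + g y) x = pd i f x + pd i g x := by
  simp [pd, fderiv_fun_add hf hg]

theorem pd_sub {i : Fin 2} {f g : Plane → ℝ} {x : Plane} (hf : DifferentiableAt ℝ f x)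
    (hg : DifferentiableAt ℝ g x) : pd i (fun y => f y - g y) x = pd i f x - pd i g x := by
  simp [pd, fderiv_fun_sub hf hg]

theorem pd_comp {i : Fin 2} {f : Plane → ℝ} {x : Plane} {F : ℝ → ℝ} {F' : ℝ}
    (hF : HasDerivAt F F' (f x)) (hf : DifferentiableAt ℝ f x) :
    pd i (fun y => F (f y)) x = F' * pd i f x := by
  have := (hF.comp_hasFDerivAt x hf.hasFDerivAt).fderiv
  unfold pd
  change fderiv ℝ (F ∘ f) x (e i) = _
  rw [this]
  simp

theorem hasFDerivAt_linear (c : ℝ) (x : Plane) : HasFDerivAt (fun x : Plane => c * x 0)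
    (c • ContinuousLinearMap.proj (R := ℝ) (φ := fun _ : Fin 2 => ℝ) 0) x :=
  (ContinuousLinearMap.proj (R := ℝ) (φ := fun _ : Fin 2 => ℝ) 0).hasFDerivAt.const_mul c

theorem pd_linear (i : Fin 2) (c : ℝ) (x : Plane) :
    pd i (fun x : Plane => c * x 0) x = if i = 0 then c else 0 := by
  unfold pd
  rw [(hasFDerivAt_linear c x).fderiv]
  fin_cases i <;> simp [e]

theorem contDiff_lap {f : Plane → ℝ} (h : ContDiff ℝ ∞ f) : ContDiff ℝ ∞ (lap f) :=
  (contDiff_pd 0 (contDiff_pd 0 h)).add (contDiff_pd 1 (contDiff_pd 1 h))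

theorem one_le {n : ℕ∞} (hn : 1 ≤ n := by simp) : (1 : WithTop ℕ∞) ≤ (n : WithTop ℕ∞) := by
  exact_mod_cast hn

theorem integrable_descend_mul {f g : Plane → ℝ} (hf : Continuous f) (hg : Continuous g) :
    Integrable (fun x => descend f x * descend g x) torusMeasure :=
  integrable_descend (hf.mul hg)

theorem neg_one_le_ent {δ y : ℝ} (h : 0 < y + δ) : -1 ≤ ent δ y := by
  have h1 := Real.one_sub_inv_le_log_of_pos h
  have h2 := mul_le_mul_of_nonneg_left h1 h.le
  rw [mul_sub, mul_inv_cancel₀ h.ne', mul_one] at h2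
  unfold ent
  linarith

theorem log_sq_le {δ y : ℝ} (hδ : 0 < δ) (hδ1 : δ ≤ 1) (hy : 0 ≤ y) :
    Real.log (y + δ) ^ 2 ≤ Real.log δ ^ 2 + 4 * (y + 1) := by
  have hpos : 0 < y + δ := by linarith
  rcases le_total (y + δ) 1 with h | h
  · have h1 := Real.log_nonpos hpos.le h
    have h2 := Real.log_le_log hδ (show δ ≤ y + δ by linarith)
    nlinarith
  · have h1 := Real.log_nonneg h
    have h2 : Real.log (y + δ) ≤ 2 * √(y + δ) := by
      have h3 := Real.log_le_sub_one_of_pos (Real.sqrt_pos.2 hpos)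
      rw [Real.log_sqrt hpos.le] at h3
      linarith
    have h4 : Real.log (y + δ) ^ 2 ≤ (2 * √(y + δ)) ^ 2 := by gcongr
    rw [mul_pow, Real.sq_sqrt hpos.le] at h4
    nlinarith [sq_nonneg (Real.log δ)]

theorem sq_mul_log_sq_le {δ : ℝ} (hδ : 0 < δ) (hδ1 : δ ≤ 1) :
    δ ^ 2 * Real.log δ ^ 2 ≤ 4 * δ := by
  have hs := Real.sqrt_pos.2 hδ
  have h3 := Real.one_sub_inv_le_log_of_pos hs
  rw [Real.log_sqrt hδ.le] at h3
  have h1 := Real.log_nonpos hδ.le hδ1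
  have h4 : √δ * (-Real.log δ) ≤ 2 := by
    have h5 := mul_le_mul_of_nonneg_left h3 hs.le
    rw [mul_sub, mul_inv_cancel₀ hs.ne', mul_one] at h5
    nlinarith
  have h6 : (√δ * (-Real.log δ)) ^ 2 ≤ 2 ^ 2 :=
    pow_le_pow_left₀ (mul_nonneg hs.le (by linarith)) h4 2
  rw [mul_pow, Real.sq_sqrt hδ.le, neg_sq] at h6
  nlinarith

section Component

variable {η : Plane → ℝ} {L ε T s : ℝ} {u : ℝ → L2R} {ρ₀ : Plane → ℝ} {ρ : ℝ → Plane → ℝ}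

theorem IsComponent.smoothOn (hc : IsComponent η L ε T s u ρ₀ ρ) : SmoothOn T ρ := hc.smooth

/-- The shift of `ρ t` over the period `e_i`. -/
theorem IsComponent.shift (hc : IsComponent η L ε T s u ρ₀ ρ) {t : ℝ} (ht : t ∈ Ico 0 T)
    (i : Fin 2) (x : Plane) : ρ t (x + e i) = ρ t x + if i = 0 then L + ε else 0 := by
  fin_cases i
  · simpa using hc.shift_one t ht x
  · simpa using hc.shift_two t ht x

/-- The periodic part `ρ - (L + ε) x₁`. -/
def perPart (L ε : ℝ) (ρ : ℝ → Plane → ℝ) (t : ℝ) (x : Plane) : ℝ := ρ t x - (L + ε) * x 0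

theorem IsComponent.perPart_smoothOn (hc : IsComponent η L ε T s u ρ₀ ρ) :
    SmoothOn T (perPart L ε ρ) := by
  refine ContDiffOn.sub hc.smooth (ContDiff.contDiffOn ?_)
  fun_prop

theorem IsComponent.perPart_periodic (hc : IsComponent η L ε T s u ρ₀ ρ) {t : ℝ}
    (ht : t ∈ Ico 0 T) : IsPeriodic (perPart L ε ρ t) := by
  intro i x
  unfold perPart
  rw [hc.shift ht]
  fin_cases i
  · simp [e]
    ring
  · simp [e]

theorem IsComponent.contDiff (hc : IsComponent η L ε T s u ρ₀ ρ) {t : ℝ} (ht : t ∈ Ico 0 T) :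
    ContDiff ℝ ∞ (ρ t) := hc.smoothOn.contDiff ht

theorem IsComponent.pd_eq (hc : IsComponent η L ε T s u ρ₀ ρ) {t : ℝ} (ht : t ∈ Ico 0 T)
    (i : Fin 2) (x : Plane) :
    pd i (ρ t) x = pd i (perPart L ε ρ t) x + if i = 0 then L + ε else 0 := by
  have : perPart L ε ρ t = fun x => ρ t x - (L + ε) * x 0 := rfl
  rw [this, pd_sub ((hc.contDiff ht).differentiable (by simp) x)
    (hasFDerivAt_linear _ x).differentiableAt, pd_linear]
  ring

theorem IsComponent.pd_periodic (hc : IsComponent η L ε T s u ρ₀ ρ) {t : ℝ} (ht : t ∈ Ico 0 T)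
    (i : Fin 2) : IsPeriodic (pd i (ρ t)) := by
  intro j x
  rw [hc.pd_eq ht, hc.pd_eq ht, Dislocation.pd_periodic i (hc.perPart_periodic ht) j x]

theorem IsComponent.lap_eq (hc : IsComponent η L ε T s u ρ₀ ρ) {t : ℝ} (ht : t ∈ Ico 0 T) :
    lap (ρ t) = lap (perPart L ε ρ t) := by
  have h : ∀ i, pd i (pd i (ρ t)) = pd i (pd i (perPart L ε ρ t)) := by
    intro i
    have h1 : pd i (ρ t) = fun x => pd i (perPart L ε ρ t) x + if i = 0 then L + ε else 0 :=
      funext fun x => hc.pd_eq ht i x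
    rw [h1]
    funext x
    rw [pd, fderiv_add_const, pd]
  funext x
  simp only [lap, h]

theorem IsComponent.dt_periodic (hc : IsComponent η L ε T s u ρ₀ ρ) {t : ℝ} (ht : t ∈ Ioo 0 T) :
    IsPeriodic (dt ρ t) := by
  intro i x
  have h1 : (fun s => ρ s (x + e i)) =ᶠ[nhds t] fun s => ρ s x + if i = 0 then L + ε else 0 := by
    filter_upwards [isOpen_Ioo.mem_nhds ht] with r hr
    exact hc.shift ⟨hr.1.le, hr.2⟩ i x
  unfold dt
  rw [h1.deriv_eq, deriv_add_const]

theorem IsComponent.dt_perPart (x : Plane) (t : ℝ) :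
    dt (perPart L ε ρ) t x = dt ρ t x := by
  simp [dt, perPart]

/-- The mean of `∂ρ/∂x₁` is `L + ε`. -/
theorem IsComponent.integral_pd (hc : IsComponent η L ε T s u ρ₀ ρ) {t : ℝ} (ht : t ∈ Ico 0 T) :
    ∫ x, descend (pd 0 (ρ t)) x ∂torusMeasure = L + ε := by
  have hP := (hc.perPart_smoothOn.contDiff ht)
  have h1 : ∀ x, descend (pd 0 (ρ t)) x = descend (pd 0 (perPart L ε ρ t)) x + (L + ε) :=
    fun x => (hc.pd_eq ht 0 (cellRep x)).trans (by rw [if_pos rfl]; rfl)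
  simp only [h1]
  rw [integral_add (integrable_descend (contDiff_pd 0 hP).continuous) (integrable_const _),
    integral_descend_pd 0 (hP.of_le one_le) (hc.perPart_periodic ht)]
  simp

/-- The equation tested with a square integrable function. -/
theorem IsComponent.integral_mul_dt (hc : IsComponent η L ε T s u ρ₀ ρ) {t : ℝ}
    (ht : t ∈ Ioo 0 T) {w : Torus → ℝ} (hw : MemLp w 2 torusMeasure) :
    Integrable (fun x => u t x * (w x * descend (pd 0 (ρ t)) x)) torusMeasure ∧
    ∫ x, w x * descend (dt ρ t) x ∂torusMeasure =
      ε * ∫ x, w x * descend (lap (ρ t)) x ∂torusMeasure -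
        s * ∫ x, u t x * (w x * descend (pd 0 (ρ t)) x) ∂torusMeasure := by
  have ht' : t ∈ Ico 0 T := ⟨ht.1.le, ht.2⟩
  have hρ := hc.contDiff ht'
  have hθ := (contDiff_pd 0 hρ).continuous
  obtain ⟨B, hB⟩ := (isCompact_Icc (a := (0 : Plane)) (b := 1)).exists_bound_of_continuousOn
    hθ.continuousOn
  have hi : Integrable (fun x => u t x * (w x * descend (pd 0 (ρ t)) x)) torusMeasure := by
    have h1 : Integrable (fun x => u t x * w x) torusMeasure := (Lp.memLp (u t)).integrable_mul hw
    have h2 := h1.mul_bdd (c := B) (memLp_descend hθ).aestronglyMeasurable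
      (Filter.Eventually.of_forall fun x => hB _ (cellRep_mem x))
    refine h2.congr (Filter.Eventually.of_forall fun x => ?_)
    simp only
    ring
  refine ⟨hi, ?_⟩
  have hl : Integrable (fun x => w x * descend (lap (ρ t)) x) torusMeasure :=
    hw.integrable_mul (memLp_descend (contDiff_lap hρ).continuous)
  rw [← integral_const_mul, ← integral_const_mul, ← integral_sub (hl.const_mul _) (hi.const_mul _)]
  refine integral_congr_ae ?_
  filter_upwards [hc.equation t ht] with x hx
  linear_combination w x * hx

theorem IsComponent.ent_smoothOn (hc : IsComponent η L ε T s u ρ₀ ρ) {δ : ℝ} (hδ : 0 < δ) :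
    SmoothOn T fun τ y => ent δ (pd 0 (ρ τ) y) := by
  have h1 : ContDiffOn ℝ ∞ (fun p : ℝ × Plane => pd 0 (ρ p.1) p.2 + δ) (Ico 0 T ×ˢ univ) :=
    ContDiffOn.add (hc.smoothOn.pd 0) contDiffOn_const
  refine h1.mul (h1.log fun p hp => ?_)
  have := hc.monotone p.1 hp.1 p.2
  positivity

/-- The time derivative of the entropy of a component. -/
theorem IsComponent.exists_hasDerivAt_ent (hc : IsComponent η L ε T s u ρ₀ ρ) (hε : 0 ≤ ε) {δ : ℝ}
    (hδ : 0 < δ) {t : ℝ} (ht : t ∈ Ioo 0 T) :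
    ∃ E' : ℝ, HasDerivAt (fun τ => ∫ x, descend (fun y => ent δ (pd 0 (ρ τ) y)) x ∂torusMeasure) E' t ∧
      E' ≤ s * ∫ x, u t x * descend (pd 0 (pd 0 (ρ t))) x ∂torusMeasure -
        s * δ * ∫ x, u t x * descend (pd 0 fun y => Real.log (pd 0 (ρ t) y + δ)) x ∂torusMeasure := by
  have ht' : t ∈ Ico 0 T := ⟨ht.1.le, ht.2⟩
  have hρ := hc.contDiff ht'
  set θ := pd 0 (ρ t) with hθdef
  set l : Plane → ℝ := fun y => Real.log (θ y + δ) with hl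
  have hθ : ContDiff ℝ ∞ θ := contDiff_pd 0 hρ
  have hpos : ∀ τ ∈ Ico 0 T, ∀ y, 0 < pd 0 (ρ τ) y + δ := fun τ hτ y => by
    have := hc.monotone τ hτ y
    linarith
  have hls : ContDiff ℝ ∞ l := (hθ.add contDiff_const).log fun y => (hpos t ht' y).ne'
  have hθp : IsPeriodic θ := hc.pd_periodic ht' 0
  have hlp : IsPeriodic l := hθp.comp fun y => Real.log (y + δ)
  have hdts := hc.smoothOn.contDiff_dt ht
  have hG := hc.ent_smoothOn hδ
  have hdG : ∀ y, dt (fun τ y => ent δ (pd 0 (ρ τ) y)) t y = (l y + 1) * pd 0 (dt ρ t) y := by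
    intro y
    have h1 := ((hc.smoothOn.pd 0).hasDerivAt ht y).add_const δ
    have h2 := h1.mul (h1.log (hpos t ht' y).ne')
    rw [← hc.smoothOn.dt_pd 0 ht y]
    refine h2.deriv.trans ?_
    have h3 := (hpos t ht' y).ne'
    simp only [hl, hθdef]
    field_simp
  refine ⟨_, hG.hasDerivAt_integral ht, ?_⟩
  have hpdl : ∀ i y, pd i l y * (θ y + δ) = pd i θ y := by
    intro i y
    have h1 : HasDerivAt (fun z : ℝ => Real.log (z + δ)) (θ y + δ)⁻¹ (θ y) := by
      simpa using ((hasDerivAt_id (θ y)).add_const δ).log (hpos t ht' y).ne'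
    rw [hl, pd_comp h1 (hθ.differentiable (by simp) y)]
    have h3 := (hpos t ht' y).ne'
    rw [← hθdef] at h3
    field_simp
  have hderiv : ∫ x, descend (dt (fun τ y => ent δ (pd 0 (ρ τ) y)) t) x ∂torusMeasure =
      -∫ x, descend (pd 0 l) x * descend (dt ρ t) x ∂torusMeasure := by
    have h1 := integral_descend_mul_pd 0 ((hls.add contDiff_const).of_le one_le)
      (hdts.of_le one_le) (hlp.comp fun y => y + 1) (hc.dt_periodic ht)
    have h2 : pd 0 (fun y => l y + 1) = pd 0 l := by
      funext y
      simp [pd, fderiv_add_const]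
    rw [h2] at h1
    rw [← h1]
    refine integral_congr_ae (Filter.Eventually.of_forall fun x => hdG _)
  have hpdlc : Continuous (pd 0 l) := (contDiff_pd 0 hls).continuous
  obtain ⟨hi, hw⟩ := hc.integral_mul_dt ht (memLp_descend hpdlc)
  have hdiff : 0 ≤ ∫ x, descend (pd 0 l) x * descend (lap (ρ t)) x ∂torusMeasure := by
    have hlapp : IsPeriodic (lap (ρ t)) := by
      rw [hc.lap_eq ht']
      intro i x
      simp only [lap]
      rw [Dislocation.pd_periodic 0 (Dislocation.pd_periodic 0 (hc.perPart_periodic ht')) i x,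
        Dislocation.pd_periodic 1 (Dislocation.pd_periodic 1 (hc.perPart_periodic ht')) i x]
    have hlaps := contDiff_lap hρ
    have h1 := integral_descend_mul_pd 0 (hls.of_le one_le) (hlaps.of_le one_le) hlp hlapp
    have h2 : pd 0 (lap (ρ t)) = fun y => pd 0 (pd 0 θ) y + pd 1 (pd 1 θ) y := by
      funext y
      have h3 : lap (ρ t) = fun y => pd 0 (pd 0 (ρ t)) y + pd 1 (pd 1 (ρ t)) y := rfl
      rw [h3, pd_add ((contDiff_pd 0 (contDiff_pd 0 hρ)).differentiable (by simp) y)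
        ((contDiff_pd 1 (contDiff_pd 1 hρ)).differentiable (by simp) y),
        pd_comm (contDiff_pd 1 hρ) 0 1, pd_comm hρ 0 1]
    have h4 : ∀ i, 0 ≤ -∫ x, descend l x * descend (pd i (pd i θ)) x ∂torusMeasure := by
      intro i
      rw [integral_descend_mul_pd i (hls.of_le one_le) ((contDiff_pd i hθ).of_le one_le) hlp
        (Dislocation.pd_periodic i hθp), neg_neg]
      refine integral_nonneg fun x => ?_
      have h5 := hpdl i (cellRep x)
      have h6 := hpos t ht' (cellRep x)
      simp only [descend_apply, Pi.zero_apply]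
      rw [← h5]
      rw [← hθdef] at h6
      nlinarith [mul_nonneg (sq_nonneg (pd i l (cellRep x))) h6.le]
    have h7 : ∫ x, descend l x * descend (pd 0 (lap (ρ t))) x ∂torusMeasure =
        ∫ x, descend l x * descend (pd 0 (pd 0 θ)) x ∂torusMeasure +
          ∫ x, descend l x * descend (pd 1 (pd 1 θ)) x ∂torusMeasure := by
      rw [← integral_add
        (integrable_descend_mul hls.continuous (contDiff_pd 0 (contDiff_pd 0 hθ)).continuous)
        (integrable_descend_mul hls.continuous (contDiff_pd 1 (contDiff_pd 1 hθ)).continuous)]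
      refine integral_congr_ae (Filter.Eventually.of_forall fun x => ?_)
      simp only [h2, descend_apply]
      ring
    have := h4 0
    have := h4 1
    linarith
  have hflux : ∫ x, u t x * (descend (pd 0 l) x * descend (pd 0 (ρ t)) x) ∂torusMeasure =
      ∫ x, u t x * descend (pd 0 θ) x ∂torusMeasure -
        δ * ∫ x, u t x * descend (pd 0 l) x ∂torusMeasure := by
    rw [← integral_const_mul, ← integral_sub (integrable_mul_descend _ (contDiff_pd 0 hθ))
      ((integrable_mul_descend _ (contDiff_pd 0 hls)).const_mul δ)]
    refine integral_congr_ae (Filter.Eventually.of_forall fun x => ?_)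
    have h5 := hpdl 0 (cellRep x)
    simp only [descend_apply]
    rw [← h5]
    ring
  rw [hderiv, hw, hflux]
  nlinarith [mul_nonneg hε hdiff]

end Component

/-! ### The dissipation -/

/-- The Fourier terms of `‖R₁R₂ ∂v/∂x₁‖²`. -/
def dissTerm (v : L2R) (k : Fin 2 → ℤ) : ℝ := symb k * (2 * Real.pi * k 0) ^ 2 * ‖fc v k‖ ^ 2

/-- The dissipation `‖R₁R₂ ∂v/∂x₁‖²`. -/
def diss (v : L2R) : ℝ := ∑' k, dissTerm v k

theorem dissTerm_nonneg (v : L2R) (k : Fin 2 → ℤ) : 0 ≤ dissTerm v k :=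
  mul_nonneg (mul_nonneg (symb_nonneg k) (sq_nonneg _)) (sq_nonneg _)

theorem diss_nonneg (v : L2R) : 0 ≤ diss v := tsum_nonneg (dissTerm_nonneg v)

theorem integral_mul_toL2 {φ : Plane → ℝ} (h : Continuous φ) (G : Torus → ℝ) :
    ∫ x, G x * toL2 (descend φ) x ∂torusMeasure = ∫ x, G x * descend φ x ∂torusMeasure := by
  simp only [mul_comm (G _)]
  exact integral_toL2_mul h G

theorem hasSum_dissTerm {φ : Plane → ℝ} (h : ContDiff ℝ ∞ φ) (hp : IsPeriodic φ) :
    HasSum (dissTerm (toL2 (descend φ)))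
      (-∫ x, rieszSq (toL2 (descend φ)) x * descend (pd 0 (pd 0 φ)) x ∂torusMeasure) := by
  have h1 := hasSum_fc (rieszSq (toL2 (descend φ))) (toL2 (descend (pd 0 (pd 0 φ))))
  rw [integral_mul_toL2 (contDiff_pd 0 (contDiff_pd 0 h)).continuous] at h1
  have h2 := (Complex.hasSum_re h1).neg
  rw [Complex.ofReal_re] at h2
  refine h2.congr_fun fun k => ?_
  rw [fc_rieszSq, fc_pd 0 ((contDiff_pd 0 h).of_le one_le) (pd_periodic 0 hp),
    fc_pd 0 (h.of_le one_le) hp]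
  set z := fc (toL2 (descend φ)) k
  have h3 : (starRingEnd ℂ) (symb k * z) *
      ((2 * Real.pi * k 0 : ℝ) * Complex.I * ((2 * Real.pi * k 0 : ℝ) * Complex.I * z)) =
      ((-dissTerm (toL2 (descend φ)) k : ℝ) : ℂ) := by
    have h4 : (starRingEnd ℂ) z * z = ((‖z‖ ^ 2 : ℝ) : ℂ) := by
      rw [mul_comm, Complex.mul_conj, Complex.normSq_eq_norm_sq]
    rw [map_mul, Complex.conj_ofReal]
    have h5 : dissTerm (toL2 (descend φ)) k = symb k * (2 * Real.pi * k 0) ^ 2 * ‖z‖ ^ 2 := rfl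
    rw [h5]
    calc _ = (symb k : ℂ) * ((2 * Real.pi * k 0 : ℝ) : ℂ) ^ 2 * (Complex.I * Complex.I) *
          ((starRingEnd ℂ) z * z) := by ring
      _ = _ := by
        rw [h4, Complex.I_mul_I]
        push_cast
        ring
  rw [h3, Complex.ofReal_re, neg_neg]

theorem summable_dissTerm {φ : Plane → ℝ} (h : ContDiff ℝ ∞ φ) (hp : IsPeriodic φ) :
    Summable (dissTerm (toL2 (descend φ))) := (hasSum_dissTerm h hp).summable

theorem sum_dissTerm_le {v : L2R} (h : Summable (dissTerm v)) (S : Finset (Fin 2 → ℤ)) :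
    ∑ k ∈ S, dissTerm v k ≤ diss v := h.sum_le_tsum _ fun k _ => dissTerm_nonneg v k

theorem norm_fc_rieszSq_sq (v : L2R) (k : Fin 2 → ℤ) :
    ‖fc (rieszSq v) k‖ ^ 2 = symb k ^ 2 * ‖fc v k‖ ^ 2 := by
  rw [fc_rieszSq, norm_mul, Complex.norm_real, Real.norm_of_nonneg (symb_nonneg k), mul_pow]

theorem two_le_two_pi_sq : 2 ≤ (2 * Real.pi) ^ 2 := by nlinarith [Real.pi_gt_three]

theorem h1Bound_rieszSq {v : L2R} (h : Summable (dissTerm v)) : H1Bound (rieszSq v) (diss v) := by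
  intro S
  refine (Finset.sum_le_sum fun k _ => ?_).trans (sum_dissTerm_le h S)
  rw [norm_fc_rieszSq_sq, dissTerm]
  have h1 := symb_mul_le k
  have h2 := symb_le_mul k
  have h3 := symb_nonneg k
  have h4 := symb_le_one k
  have h5 : (1 + (k 0 : ℝ) ^ 2 + (k 1 : ℝ) ^ 2) * symb k ^ 2 ≤ symb k * (2 * Real.pi * k 0) ^ 2 := by
    have h6 : (1 + (k 0 : ℝ) ^ 2 + (k 1 : ℝ) ^ 2) * symb k ≤ 2 * (k 0 : ℝ) ^ 2 := by
      nlinarith [sq_nonneg (k 0 : ℝ)]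
    have h7 : 2 * (k 0 : ℝ) ^ 2 ≤ (2 * Real.pi * k 0) ^ 2 := by
      rw [mul_pow]
      exact mul_le_mul_of_nonneg_right two_le_two_pi_sq (sq_nonneg _)
    nlinarith
  calc _ = ((1 + (k 0 : ℝ) ^ 2 + (k 1 : ℝ) ^ 2) * symb k ^ 2) * ‖fc v k‖ ^ 2 := by ring
    _ ≤ _ := by gcongr

theorem sum_norm_fc_sq_le (f : L2R) (S : Finset (Fin 2 → ℤ)) :
    ∑ k ∈ S, ‖fc f k‖ ^ 2 ≤ ∫ x, f x ^ 2 ∂torusMeasure :=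
  sum_le_hasSum S (fun _ _ => sq_nonneg _) (hasSum_norm_fc_sq f)

theorem integral_toL2_sq {φ : Plane → ℝ} (h : Continuous φ) :
    ∫ x, toL2 (descend φ) x ^ 2 ∂torusMeasure = ∫ x, descend φ x ^ 2 ∂torusMeasure := by
  refine integral_congr_ae ?_
  filter_upwards [coeFn_toL2 h] with x hx
  rw [hx]

theorem abs_integral_rieszSq_mul_pd_le {v : L2R} (h : Summable (dissTerm v)) {l : Plane → ℝ}
    (hl : ContDiff ℝ ∞ l) (hlp : IsPeriodic l) :
    |∫ x, rieszSq v x * descend (pd 0 l) x ∂torusMeasure| ≤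
      √(diss v) * √(∫ x, descend l x ^ 2 ∂torusMeasure) := by
  have h1 := hasSum_fc (rieszSq v) (toL2 (descend (pd 0 l)))
  rw [integral_mul_toL2 (contDiff_pd 0 hl).continuous] at h1
  rw [← Real.norm_eq_abs, ← Complex.norm_real, ← integral_toL2_sq hl.continuous]
  refine norm_le_sqrt_mul_sqrt_of_hasSum h1
    (a := fun k => |2 * Real.pi * k 0| * (symb k * ‖fc v k‖)) (b := fun k => ‖fc (toL2 (descend l)) k‖)
    (fun k => ?_) (fun S => ?_) (sum_norm_fc_sq_le _)
  · rw [fc_pd 0 (hl.of_le one_le) hlp, fc_rieszSq]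
    simp only [norm_mul, RCLike.norm_conj, Complex.norm_real, Real.norm_of_nonneg (symb_nonneg k),
      Complex.norm_I, Real.norm_eq_abs]
    simp only [abs_mul, Nat.abs_ofNat]
    apply le_of_eq
    ring
  · refine (Finset.sum_le_sum fun k _ => ?_).trans (sum_dissTerm_le h S)
    rw [mul_pow, sq_abs, mul_pow, dissTerm]
    have h3 := symb_nonneg k
    have h4 := symb_le_one k
    have h5 : symb k ^ 2 ≤ symb k := by nlinarith
    calc _ = symb k ^ 2 * ((2 * Real.pi * k 0) ^ 2 * ‖fc v k‖ ^ 2) := by ring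
      _ ≤ symb k * ((2 * Real.pi * k 0) ^ 2 * ‖fc v k‖ ^ 2) := by gcongr
      _ = _ := by ring

/-! ### The entropy estimate -/

/-- The total entropy. -/
def totalEnt (δ : ℝ) (ρp ρm : ℝ → Plane → ℝ) (t : ℝ) : ℝ :=
  (∫ x, descend (fun y => ent δ (pd 0 (ρp t) y)) x ∂torusMeasure) +
    ∫ x, descend (fun y => ent δ (pd 0 (ρm t) y)) x ∂torusMeasure

/-- The dissipation of a solution at time `t`. -/
def dissAt (ρp ρm : ℝ → Plane → ℝ) (t : ℝ) : ℝ :=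
  diss (toL2 (descend fun x => ρp t x - ρm t x))

section Component

variable {η : Plane → ℝ} {L ε T s : ℝ} {u : ℝ → L2R} {ρ₀ : Plane → ℝ} {ρ : ℝ → Plane → ℝ}

theorem IsComponent.neg_one_le_integral_ent (hc : IsComponent η L ε T s u ρ₀ ρ) {δ : ℝ}
    (hδ : 0 < δ) {t : ℝ} (ht : t ∈ Ico 0 T) :
    -1 ≤ ∫ x, descend (fun y => ent δ (pd 0 (ρ t) y)) x ∂torusMeasure := by
  have h1 : ∫ _, (-1 : ℝ) ∂torusMeasure ≤
      ∫ x, descend (fun y => ent δ (pd 0 (ρ t) y)) x ∂torusMeasure := by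
    refine integral_mono (integrable_const _)
      (integrable_descend ((hc.ent_smoothOn hδ).contDiff ht).continuous) fun x => ?_
    have := hc.monotone t ht (cellRep x)
    exact neg_one_le_ent (by positivity)
  simpa using h1

theorem IsComponent.log_contDiff (hc : IsComponent η L ε T s u ρ₀ ρ) {δ : ℝ}
    (hδ : 0 < δ) {t : ℝ} (ht : t ∈ Ico 0 T) :
    ContDiff ℝ ∞ fun y => Real.log (pd 0 (ρ t) y + δ) :=
  ((contDiff_pd 0 (hc.contDiff ht)).add contDiff_const).log fun y => by
    have := hc.monotone t ht y
    positivity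

theorem IsComponent.integral_log_sq_le (hc : IsComponent η L ε T s u ρ₀ ρ) (hε : ε ≤ 1) {δ : ℝ}
    (hδ : 0 < δ) (hδ1 : δ ≤ 1) {t : ℝ} (ht : t ∈ Ico 0 T) :
    ∫ x, descend (fun y => Real.log (pd 0 (ρ t) y + δ)) x ^ 2 ∂torusMeasure ≤
      Real.log δ ^ 2 + 4 * (L + 2) := by
  have hθ : Integrable (descend (pd 0 (ρ t))) torusMeasure :=
    integrable_descend (contDiff_pd 0 (hc.contDiff ht)).continuous
  have h1 : ∫ x, descend (fun y => Real.log (pd 0 (ρ t) y + δ)) x ^ 2 ∂torusMeasure ≤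
      ∫ x, (Real.log δ ^ 2 + 4 * (descend (pd 0 (ρ t)) x + 1)) ∂torusMeasure := by
    refine integral_mono (integrable_descend ((hc.log_contDiff hδ ht).continuous.pow 2))
      ((integrable_const _).add ((hθ.add (integrable_const _)).const_mul _)) fun x => ?_
    exact log_sq_le hδ hδ1 (hc.monotone t ht (cellRep x))
  have h2 : ∫ x, (Real.log δ ^ 2 + 4 * (descend (pd 0 (ρ t)) x + 1)) ∂torusMeasure =
      Real.log δ ^ 2 + 4 * (L + ε + 1) := by
    have h3 := hθ.add (integrable_const (μ := torusMeasure) (1 : ℝ))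
    refine (integral_add (integrable_const _) (h3.const_mul 4)).trans ?_
    rw [integral_const_mul]
    refine congrArg₂ _ (by simp) (congrArg _ ?_)
    refine (integral_add hθ (integrable_const _)).trans ?_
    rw [hc.integral_pd ht]
    simp
  linarith

end Component

section Solution

variable {η : Plane → ℝ} {L ε T : ℝ} {ρp₀ ρm₀ : Plane → ℝ} {ρp ρm : ℝ → Plane → ℝ}

theorem IsSolution.diff_smoothOn (hs : IsSolution η L ε T ρp₀ ρm₀ ρp ρm) :
    SmoothOn T fun t x => ρp t x - ρm t x := ContDiffOn.sub hs.plus.smooth hs.minus.smooth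

theorem IsSolution.diff_periodic (hs : IsSolution η L ε T ρp₀ ρm₀ ρp ρm) {t : ℝ}
    (ht : t ∈ Ico 0 T) : IsPeriodic fun x => ρp t x - ρm t x := by
  intro i x
  simp only [hs.plus.shift ht, hs.minus.shift ht]
  ring

theorem IsSolution.summable (hs : IsSolution η L ε T ρp₀ ρm₀ ρp ρm) {t : ℝ} (ht : t ∈ Ico 0 T) :
    Summable (dissTerm (toL2 (descend fun x => ρp t x - ρm t x))) :=
  summable_dissTerm (hs.diff_smoothOn.contDiff ht) (hs.diff_periodic ht)

theorem IsSolution.exists_hasDerivAt_totalEnt (hs : IsSolution η L ε T ρp₀ ρm₀ ρp ρm)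
    (hL : 0 < L) (hε : 0 < ε) (hε1 : ε ≤ 1) {δ : ℝ} (hδ : 0 < δ) (hδ1 : δ ≤ 1) {t : ℝ}
    (ht : t ∈ Ioo 0 T) :
    ∃ E', HasDerivAt (totalEnt δ ρp ρm) E' t ∧ E' ≤ -(dissAt ρp ρm t / 2) + 8 * (L + 3) * δ := by
  have ht' : t ∈ Ico 0 T := ⟨ht.1.le, ht.2⟩
  obtain ⟨Ep, hEp, hEp'⟩ := hs.plus.exists_hasDerivAt_ent hε.le hδ ht
  obtain ⟨Em, hEm, hEm'⟩ := hs.minus.exists_hasDerivAt_ent hε.le hδ ht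
  refine ⟨Ep + Em, hEp.add hEm, ?_⟩
  have hp := hs.plus.contDiff ht'
  have hm := hs.minus.contDiff ht'
  set v := toL2 (descend fun x => ρp t x - ρm t x) with hv
  have hu : (rieszSqFn fun x => ρp t x - ρm t x) = rieszSq v := rfl
  rw [hu] at hEp' hEm'
  have hmain : ∫ x, rieszSq v x * descend (pd 0 (pd 0 (ρp t))) x ∂torusMeasure -
      ∫ x, rieszSq v x * descend (pd 0 (pd 0 (ρm t))) x ∂torusMeasure = -dissAt ρp ρm t := by
    have h1 := (hasSum_dissTerm (hs.diff_smoothOn.contDiff ht') (hs.diff_periodic ht')).tsum_eq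
    have h2 : dissAt ρp ρm t = ∑' k, dissTerm v k := rfl
    rw [h2, h1, neg_neg, ← integral_sub (integrable_mul_descend _ (contDiff_pd 0 (contDiff_pd 0 hp)))
      (integrable_mul_descend _ (contDiff_pd 0 (contDiff_pd 0 hm)))]
    refine integral_congr_ae (Filter.Eventually.of_forall fun x => ?_)
    have h3 : pd 0 (fun x => ρp t x - ρm t x) = fun x => pd 0 (ρp t) x - pd 0 (ρm t) x :=
      funext fun x => pd_sub (hp.differentiable (by simp) x) (hm.differentiable (by simp) x)
    have h4 : pd 0 (fun x => pd 0 (ρp t) x - pd 0 (ρm t) x) (cellRep x) =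
        pd 0 (pd 0 (ρp t)) (cellRep x) - pd 0 (pd 0 (ρm t)) (cellRep x) :=
      pd_sub ((contDiff_pd 0 hp).differentiable (by simp) _)
        ((contDiff_pd 0 hm).differentiable (by simp) _)
    simp only [descend_apply]
    rw [h3, h4]
    ring
  have hD : 0 ≤ dissAt ρp ρm t := diss_nonneg _
  have herr : ∀ {s : ℝ} {u : ℝ → L2R} {ρ₀ : Plane → ℝ} {ρ : ℝ → Plane → ℝ},
      IsComponent η L ε T s u ρ₀ ρ →
      δ * |∫ x, rieszSq v x * descend (pd 0 fun y => Real.log (pd 0 (ρ t) y + δ)) x ∂torusMeasure| ≤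
        dissAt ρp ρm t / 4 + 4 * (L + 3) * δ := by
    intro s u ρ₀ ρ hc
    have h1 := abs_integral_rieszSq_mul_pd_le (hs.summable ht') (hc.log_contDiff hδ ht')
      ((hc.pd_periodic ht' 0).comp fun y => Real.log (y + δ))
    have h2 := hc.integral_log_sq_le hε1 hδ hδ1 ht'
    set I := ∫ x, descend (fun y => Real.log (pd 0 (ρ t) y + δ)) x ^ 2 ∂torusMeasure with hI
    have hI0 : 0 ≤ I := integral_nonneg fun x => sq_nonneg _
    have h3 : δ * (√(diss v) * √I) ≤ diss v / 4 + δ ^ 2 * I := by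
      have h4 := Real.sq_sqrt (diss_nonneg v)
      have h5 := Real.sq_sqrt hI0
      nlinarith [sq_nonneg (√(diss v) / 2 - δ * √I)]
    have h6 : δ ^ 2 * I ≤ 4 * (L + 3) * δ := by
      have h7 := sq_mul_log_sq_le hδ hδ1
      have h8 : δ ^ 2 * I ≤ δ ^ 2 * (Real.log δ ^ 2 + 4 * (L + 2)) := by gcongr
      have h9 : δ ^ 2 ≤ δ := by nlinarith
      nlinarith
    calc _ ≤ δ * (√(diss v) * √I) := by gcongr
      _ ≤ _ := h3.trans (by
        have : dissAt ρp ρm t = diss v := rfl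
        rw [this]
        linarith)
  have e1 := herr hs.plus
  have e2 := herr hs.minus
  set Ip := ∫ x, rieszSq v x * descend (pd 0 fun y => Real.log (pd 0 (ρp t) y + δ)) x ∂torusMeasure
  set Im := ∫ x, rieszSq v x * descend (pd 0 fun y => Real.log (pd 0 (ρm t) y + δ)) x ∂torusMeasure
  have a1 := mul_le_mul_of_nonneg_left (neg_abs_le Ip) hδ.le
  have a2 := mul_le_mul_of_nonneg_left (le_abs_self Im) hδ.le
  linarith

theorem IsSolution.continuousOn_totalEnt (hs : IsSolution η L ε T ρp₀ ρm₀ ρp ρm)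
    {δ : ℝ} (hδ : 0 < δ) : ContinuousOn (totalEnt δ ρp ρm) (Ico 0 T) :=
  (continuousOn_integral_descend (hs.plus.ent_smoothOn hδ).continuousOn).add
    (continuousOn_integral_descend (hs.minus.ent_smoothOn hδ).continuousOn)

end Solution

theorem fc_eq_inner (f : L2R) (k : Fin 2 → ℤ) :
    fc f k = inner ℂ (UnitAddTorus.mFourierBasis (d := Fin 2) k)
      (Complex.ofRealCLM.compLpL 2 torusMeasure f) := by
  rw [← HilbertBasis.repr_apply_apply, UnitAddTorus.mFourierBasis_repr]
  rfl

theorem continuous_fc (k : Fin 2 → ℤ) : Continuous fun f : L2R => fc f k := by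
  simp only [fc_eq_inner]
  exact continuous_const.inner (ContinuousLinearMap.continuous _)

theorem continuous_dissTerm (k : Fin 2 → ℤ) : Continuous fun f : L2R => dissTerm f k :=
  continuous_const.mul ((continuous_fc k).norm.pow 2)

/-- A bound on the integrals of a continuous nonnegative function over `[0,b]`, `b < T`, is a bound
on the integral over `(0,T)`. -/
theorem lintegral_Ioo_le_of_forall_integral_le {T K : ℝ} {φ : ℝ → ℝ}
    (hφ : ContinuousOn φ (Ico 0 T)) (hφ0 : ∀ t ∈ Ico 0 T, 0 ≤ φ t)
    (h : ∀ b ∈ Ioo 0 T, ∫ t in (0 : ℝ)..b, φ t ≤ K) :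
    ∫⁻ t in Ioo 0 T, ENNReal.ofReal (φ t) ≤ ENNReal.ofReal K := by
  rcases le_or_gt T 0 with hT | hT
  · simp [Ioo_eq_empty_of_le hT]
  have hU : Ioo 0 T = ⋃ n : ℕ, Ioc 0 (T - T / (n + 2)) := by
    ext t
    simp only [mem_Ioo, mem_iUnion, mem_Ioc]
    constructor
    · rintro ⟨h0, h1⟩
      obtain ⟨n, hn⟩ := exists_nat_gt (T / (T - t))
      refine ⟨n, h0, ?_⟩
      have h2 : 0 < T - t := by linarith
      rw [div_lt_iff₀ h2] at hn
      have h3 : T / (n + 2) ≤ T - t := by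
        rw [div_le_iff₀ (by positivity)]
        nlinarith
      linarith
    · rintro ⟨n, h0, h1⟩
      have : 0 < T / (n + 2) := by positivity
      exact ⟨h0, by linarith⟩
  have hmono : Monotone fun n : ℕ => Ioc 0 (T - T / (n + 2)) := by
    intro m n hmn
    refine Ioc_subset_Ioc_right ?_
    have : (m : ℝ) ≤ n := by exact_mod_cast hmn
    have : T / (n + 2) ≤ T / (m + 2) := by gcongr
    linarith
  rw [hU, setLIntegral_iUnion_of_directed _ hmono.directed_le]
  refine iSup_le fun n => ?_
  have hb : T - T / (n + 2) ∈ Ioo 0 T := by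
    have h1 : 0 < T / (n + 2) := by positivity
    have h2 : T / (n + 2) < T := by
      rw [div_lt_iff₀ (by positivity)]
      nlinarith [(Nat.cast_nonneg n : (0 : ℝ) ≤ n)]
    exact ⟨by linarith, by linarith⟩
  have hsub : Icc 0 (T - T / (n + 2)) ⊆ Ico 0 T := fun t ht => ⟨ht.1, ht.2.trans_lt hb.2⟩
  have hint : IntegrableOn φ (Ioc 0 (T - T / (n + 2))) :=
    ((hφ.mono hsub).integrableOn_Icc).mono_set Ioc_subset_Icc_self
  rw [← ofReal_integral_eq_lintegral_ofReal hint
    ((ae_restrict_iff' measurableSet_Ioc).2 (Filter.Eventually.of_forall fun t ht =>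
      hφ0 t (hsub (Ioc_subset_Icc_self ht)))), ← intervalIntegral.integral_of_le hb.1.le]
  exact ENNReal.ofReal_le_ofReal (h _ hb)

section Component

variable {η : Plane → ℝ} {L ε T s : ℝ} {u : ℝ → L2R} {ρ₀ : Plane → ℝ} {ρ : ℝ → Plane → ℝ}

/-- The Trudinger type inequality with the weight `∂ρ/∂x₁`. -/
theorem IsComponent.integral_sq_mul_pd_le (hc : IsComponent η L ε T s u ρ₀ ρ) (hε1 : ε ≤ 1)
    {δ K : ℝ} (hδ : 0 < δ) {t : ℝ} (ht : t ∈ Ico 0 T)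
    (hK : ∫ x, descend (fun y => ent δ (pd 0 (ρ t) y)) x ∂torusMeasure ≤ K) {a : L2R} {A : ℝ}
    (ha : H1Bound a A) :
    Integrable (fun x => a x ^ 2 * descend (pd 0 (ρ t)) x) torusMeasure ∧
    ∫ x, a x ^ 2 * descend (pd 0 (ρ t)) x ∂torusMeasure ≤ A * (9 + 72 * (L + 3 + 2 * K)) := by
  have hθ := (contDiff_pd 0 (hc.contDiff ht)).continuous
  obtain ⟨B, hB⟩ := (isCompact_Icc (a := (0 : Plane)) (b := 1)).exists_bound_of_continuousOn
    hθ.continuousOn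
  have h0 : ∀ x, 0 ≤ descend (pd 0 (ρ t)) x := fun x => hc.monotone t ht _
  have hm := (integrable_descend hθ).aestronglyMeasurable
  have hB' : ∀ x, |descend (pd 0 (ρ t)) x| ≤ B := fun x => hB _ (cellRep_mem x)
  have hent := integrable_descend ((hc.ent_smoothOn hδ).contDiff ht).continuous
  have hWi : Integrable (fun x => descend (pd 0 (ρ t)) x +
      (2 * descend (fun y => ent δ (pd 0 (ρ t) y)) x + 2)) torusMeasure :=
    (integrable_descend hθ).add ((hent.const_mul 2).add (integrable_const 2))
  refine ⟨integrable_sq_mul a hm hB', ?_⟩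
  have key := integral_sq_mul_le ha (W := fun x => descend (pd 0 (ρ t)) x +
      (2 * descend (fun y => ent δ (pd 0 (ρ t) y)) x + 2)) hm h0
    (fun x => (le_abs_self _).trans (hB' x)) hWi ?_ ?_
  · refine key.trans (mul_le_mul_of_nonneg_left ?_ ha.nonneg)
    have h1 : ∫ x, (descend (pd 0 (ρ t)) x +
        (2 * descend (fun y => ent δ (pd 0 (ρ t) y)) x + 2)) ∂torusMeasure =
        (L + ε) + (2 * ∫ x, descend (fun y => ent δ (pd 0 (ρ t) y)) x ∂torusMeasure + 2) := by
      refine (integral_add (integrable_descend hθ)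
        ((hent.const_mul 2).add (integrable_const 2))).trans ?_
      rw [hc.integral_pd ht]
      refine congrArg _ ((integral_add (hent.const_mul 2) (integrable_const 2)).trans ?_)
      rw [integral_const_mul]
      simp
    rw [h1]
    linarith
  · intro x
    have h1 := h0 x
    have h2 : -1 ≤ descend (fun y => ent δ (pd 0 (ρ t) y)) x :=
      neg_one_le_ent (by have := hc.monotone t ht (cellRep x); positivity)
    change 0 ≤ descend (pd 0 (ρ t)) x + (2 * descend (fun y => ent δ (pd 0 (ρ t) y)) x + 2)
    linarith
  · intro x hx
    have h1 := mul_log_le_mul_log (y := descend (pd 0 (ρ t)) x)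
      (z := descend (pd 0 (ρ t)) x + δ) (by linarith) (by linarith) (by linarith)
    have h2 : descend (fun y => ent δ (pd 0 (ρ t) y)) x =
      (descend (pd 0 (ρ t)) x + δ) * Real.log (descend (pd 0 (ρ t)) x + δ) := rfl
    simp only [h2]
    linarith

/-- The time derivative of the `L²` norm of the periodic part of a component. -/
theorem IsComponent.exists_hasDerivAt_sq (hc : IsComponent η L ε T s u ρ₀ ρ) (hs : |s| = 1)
    (hL : 0 < L) (hε : 0 < ε) (hε1 : ε ≤ 1) {δ K : ℝ} (hδ : 0 < δ) {t : ℝ} (ht : t ∈ Ioo 0 T)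
    (hK : ∫ x, descend (fun y => ent δ (pd 0 (ρ t) y)) x ∂torusMeasure ≤ K) {A : ℝ}
    (hu : H1Bound (u t) A) :
    ∃ y', HasDerivAt (fun τ => ∫ x, descend (fun y => perPart L ε ρ τ y ^ 2) x ∂torusMeasure) y' t ∧
      y' ≤ (L + 1) * (9 + 72 * (L + 3 + 2 * K)) * A +
        ∫ x, descend (fun y => perPart L ε ρ t y ^ 2) x ∂torusMeasure := by
  have ht' : t ∈ Ico 0 T := ⟨ht.1.le, ht.2⟩
  have hPs := hc.perPart_smoothOn
  set P := perPart L ε ρ t with hP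
  have hPc : ContDiff ℝ ∞ P := hPs.contDiff ht'
  have hPp : IsPeriodic P := hc.perPart_periodic ht'
  have hG : SmoothOn T fun τ y => perPart L ε ρ τ y ^ 2 := ContDiffOn.pow hPs 2
  refine ⟨_, hG.hasDerivAt_integral ht, ?_⟩
  have hdG : ∀ y, dt (fun τ y => perPart L ε ρ τ y ^ 2) t y = 2 * (P y * dt ρ t y) := by
    intro y
    have h1 := (hPs.hasDerivAt ht y).pow 2
    refine h1.deriv.trans ?_
    rw [IsComponent.dt_perPart]
    simp [hP]
    ring
  obtain ⟨hi, hw⟩ := hc.integral_mul_dt ht (memLp_descend hPc.continuous)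
  have h1 : ∫ x, descend (dt (fun τ y => perPart L ε ρ τ y ^ 2) t) x ∂torusMeasure =
      2 * ∫ x, descend P x * descend (dt ρ t) x ∂torusMeasure := by
    rw [← integral_const_mul]
    exact integral_congr_ae (Filter.Eventually.of_forall fun x => hdG _)
  have hlap : ∫ x, descend P x * descend (lap (ρ t)) x ∂torusMeasure ≤ 0 := by
    rw [hc.lap_eq ht']
    have h4 : ∀ i, ∫ x, descend P x * descend (pd i (pd i P)) x ∂torusMeasure ≤ 0 := by
      intro i
      rw [integral_descend_mul_pd i (hPc.of_le one_le) ((contDiff_pd i hPc).of_le one_le) hPp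
        (Dislocation.pd_periodic i hPp), neg_nonpos]
      exact integral_nonneg fun x => mul_self_nonneg _
    have h5 : ∫ x, descend P x * descend (lap P) x ∂torusMeasure =
        ∫ x, descend P x * descend (pd 0 (pd 0 P)) x ∂torusMeasure +
          ∫ x, descend P x * descend (pd 1 (pd 1 P)) x ∂torusMeasure := by
      rw [← integral_add
        (integrable_descend_mul hPc.continuous (contDiff_pd 0 (contDiff_pd 0 hPc)).continuous)
        (integrable_descend_mul hPc.continuous (contDiff_pd 1 (contDiff_pd 1 hPc)).continuous)]
      refine integral_congr_ae (Filter.Eventually.of_forall fun x => ?_)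
      simp only [lap, descend_apply]
      ring
    rw [h5]
    linarith [h4 0, h4 1]
  set y := ∫ x, descend (fun y => P y ^ 2) x ∂torusMeasure with hy
  have hy0 : 0 ≤ y := integral_nonneg fun x => sq_nonneg _
  have hP2 : ∫ x, descend P x ^ 2 * descend (pd 0 (ρ t)) x ∂torusMeasure = (L + ε) * y := by
    have h6 := integral_descend_pd 0 ((hPc.pow 3).of_le one_le) (hPp.comp fun z => z ^ 3)
    have h7 : ∀ x, descend (pd 0 fun y => P y ^ 3) x = 3 * (descend P x ^ 2 * descend (pd 0 P) x) := by
      intro x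
      have h8 := pd_comp (i := 0) (f := P) (x := cellRep x) (hasDerivAt_pow 3 (P (cellRep x)))
        (hPc.differentiable (by simp) _)
      refine h8.trans ?_
      simp only [descend_apply]
      push_cast
      ring
    simp only [h7, integral_const_mul] at h6
    have h9 : ∀ x, descend P x ^ 2 * descend (pd 0 (ρ t)) x =
        descend P x ^ 2 * descend (pd 0 P) x + (L + ε) * descend (fun y => P y ^ 2) x := by
      intro x
      have := hc.pd_eq ht' 0 (cellRep x)
      rw [if_pos rfl] at this
      simp only [descend_apply, this, hP]
      ring
    simp only [h9]
    have i1 : Integrable (fun x => descend P x ^ 2 * descend (pd 0 P) x) torusMeasure :=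
      integrable_descend_mul (f := fun y => P y ^ 2) (hPc.continuous.pow 2)
        (contDiff_pd 0 hPc).continuous
    have i2 : Integrable (descend fun y => P y ^ 2) torusMeasure :=
      integrable_descend (hPc.continuous.pow 2)
    rw [integral_add i1 (i2.const_mul _), integral_const_mul]
    linarith
  obtain ⟨hui, hub⟩ := hc.integral_sq_mul_pd_le hε1 hδ ht' hK hu
  have hPi : Integrable (fun x => descend P x ^ 2 * descend (pd 0 (ρ t)) x) torusMeasure :=
    integrable_descend_mul (f := fun y => P y ^ 2) (hPc.continuous.pow 2)
      (contDiff_pd 0 (hc.contDiff ht')).continuous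
  have hcross : -(2 * s * ∫ x, u t x * (descend P x * descend (pd 0 (ρ t)) x) ∂torusMeasure) ≤
      (L + 1) * ∫ x, u t x ^ 2 * descend (pd 0 (ρ t)) x ∂torusMeasure +
        (L + 1)⁻¹ * ∫ x, descend P x ^ 2 * descend (pd 0 (ρ t)) x ∂torusMeasure := by
    rw [← integral_const_mul, ← integral_const_mul, ← integral_const_mul, ← integral_neg,
      ← integral_add (hui.const_mul _) (hPi.const_mul _)]
    refine integral_mono (hi.const_mul _).neg ((hui.const_mul _).add (hPi.const_mul _)) fun x => ?_
    have hθ : 0 ≤ descend (pd 0 (ρ t)) x := hc.monotone t ht' _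
    have hs2 : s ^ 2 = 1 := by rw [← sq_abs, hs, one_pow]
    have hL1 : 0 < L + 1 := by linarith
    have h10 : 0 ≤ (L + 1)⁻¹ * ((L + 1) * s * u t x + descend P x) ^ 2 * descend (pd 0 (ρ t)) x := by
      positivity
    have h11 : (L + 1)⁻¹ * ((L + 1) * s * u t x + descend P x) ^ 2 =
        (L + 1) * s ^ 2 * u t x ^ 2 + 2 * s * u t x * descend P x + (L + 1)⁻¹ * descend P x ^ 2 := by
      field_simp
      ring
    rw [h11, hs2] at h10
    simp only
    linarith
  have hL1 : 0 < L + 1 := by linarith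
  have hlast : (L + 1)⁻¹ * ((L + ε) * y) ≤ y := by
    rw [inv_mul_le_iff₀ hL1]
    nlinarith
  have hlap' := mul_nonpos_of_nonneg_of_nonpos hε.le hlap
  have hub' := mul_le_mul_of_nonneg_left hub hL1.le
  rw [hP2] at hcross
  rw [h1, hw]
  linarith

end Component

section Solution

variable {η : Plane → ℝ} {L ε T : ℝ} {ρp₀ ρm₀ : Plane → ℝ} {ρp ρm : ℝ → Plane → ℝ}

theorem IsSolution.neg_two_le_totalEnt (hs : IsSolution η L ε T ρp₀ ρm₀ ρp ρm) {δ : ℝ}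
    (hδ : 0 < δ) {t : ℝ} (ht : t ∈ Ico 0 T) : -2 ≤ totalEnt δ ρp ρm t := by
  have h1 := hs.plus.neg_one_le_integral_ent hδ ht
  have h2 := hs.minus.neg_one_le_integral_ent hδ ht
  unfold totalEnt
  linarith

theorem IsSolution.totalEnt_le (hs : IsSolution η L ε T ρp₀ ρm₀ ρp ρm)
    (hL : 0 < L) (hε : 0 < ε) (hε1 : ε ≤ 1) {δ : ℝ} (hδ : 0 < δ) (hδ1 : δ ≤ 1)
    (hδT : 8 * (L + 3) * δ * T ≤ 1) {t : ℝ} (ht : t ∈ Ico 0 T) :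
    totalEnt δ ρp ρm t ≤ totalEnt δ ρp ρm 0 + 1 := by
  have hT : 0 < T := ht.1.trans_lt ht.2
  have hanti : AntitoneOn (fun t => totalEnt δ ρp ρm t - 8 * (L + 3) * δ * t) (Ico 0 T) := by
    have hd : ∀ t ∈ Ioo 0 T, ∃ E', HasDerivAt (fun t => totalEnt δ ρp ρm t - 8 * (L + 3) * δ * t) E' t ∧
        E' ≤ 0 := by
      intro t ht
      obtain ⟨E', h1, h2⟩ := hs.exists_hasDerivAt_totalEnt hL hε hε1 hδ hδ1 ht
      refine ⟨_, h1.sub ((hasDerivAt_id t).const_mul _), ?_⟩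
      have : 0 ≤ dissAt ρp ρm t := diss_nonneg _
      linarith
    refine antitoneOn_of_deriv_nonpos (convex_Ico 0 T)
      ((hs.continuousOn_totalEnt hδ).sub (by fun_prop)) ?_ ?_
    · rw [interior_Ico]
      intro t ht
      obtain ⟨E', h1, h2⟩ := hd t ht
      exact h1.differentiableAt.differentiableWithinAt
    · rw [interior_Ico]
      intro t ht
      obtain ⟨E', h1, h2⟩ := hd t ht
      rw [h1.deriv]
      exact h2
  have h1 := hanti (show (0 : ℝ) ∈ Ico 0 T from ⟨le_rfl, hT⟩) ht ht.1
  have h2 : 8 * (L + 3) * δ * t ≤ 8 * (L + 3) * δ * T := by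
    have := ht.2.le
    gcongr
  simp only [mul_zero, sub_zero] at h1
  linarith

/-- The integrated dissipation is controlled by the initial entropy. -/
theorem IsSolution.lintegral_dissAt_le (hs : IsSolution η L ε T ρp₀ ρm₀ ρp ρm)
    (hL : 0 < L) (hε : 0 < ε) (hε1 : ε ≤ 1) {δ : ℝ} (hδ : 0 < δ) (hδ1 : δ ≤ 1)
    (hδT : 8 * (L + 3) * δ * T ≤ 1) :
    ∫⁻ t in Ioo 0 T, ENNReal.ofReal (dissAt ρp ρm t) ≤
      ENNReal.ofReal (2 * (totalEnt δ ρp ρm 0 + 3)) := by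
  set v : ℝ → L2R := fun t => toL2 (descend fun x => ρp t x - ρm t x) with hv
  have hvc : ContinuousOn v (Ico 0 T) := continuousOn_toL2 hs.diff_smoothOn.continuousOn
  have hterm : ∀ k, ContinuousOn (fun t => dissTerm (v t) k) (Ico 0 T) := fun k =>
    (continuous_dissTerm k).comp_continuousOn hvc
  have hmeas : ∀ k, AEMeasurable (fun t => ENNReal.ofReal (dissTerm (v t) k))
      (volume.restrict (Ioo 0 T)) := fun k =>
    (((hterm k).mono Ioo_subset_Ico_self).aemeasurable measurableSet_Ioo).ennreal_ofReal
  have h1 : ∫⁻ t in Ioo 0 T, ENNReal.ofReal (dissAt ρp ρm t) =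
      ∑' k, ∫⁻ t in Ioo 0 T, ENNReal.ofReal (dissTerm (v t) k) := by
    rw [← lintegral_tsum hmeas]
    refine setLIntegral_congr_fun measurableSet_Ioo fun t ht => ?_
    exact ENNReal.ofReal_tsum_of_nonneg (dissTerm_nonneg _) (hs.summable ⟨ht.1.le, ht.2⟩)
  rw [h1, ENNReal.tsum_eq_iSup_sum]
  refine iSup_le fun S => ?_
  rw [← lintegral_finsetSum' _ fun k _ => hmeas k]
  have hSc : ContinuousOn (fun t => ∑ k ∈ S, dissTerm (v t) k) (Ico 0 T) :=
    continuousOn_finsetSum _ fun k _ => hterm k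
  have hS0 : ∀ t, 0 ≤ ∑ k ∈ S, dissTerm (v t) k := fun t =>
    Finset.sum_nonneg fun k _ => dissTerm_nonneg _ _
  simp only [← ENNReal.ofReal_sum_of_nonneg fun k _ => dissTerm_nonneg _ k]
  refine lintegral_Ioo_le_of_forall_integral_le hSc (fun t _ => hS0 t) fun b hb => ?_
  have hsub : Icc 0 b ⊆ Ico 0 T := fun t ht => ⟨ht.1, ht.2.trans_lt hb.2⟩
  have hder : ∀ t, ∃ E', t ∈ Ioo 0 b → HasDerivAt (totalEnt δ ρp ρm) E' t ∧
      E' ≤ -(dissAt ρp ρm t / 2) + 8 * (L + 3) * δ := by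
    intro t
    by_cases ht : t ∈ Ioo 0 b
    · obtain ⟨E', h⟩ := hs.exists_hasDerivAt_totalEnt hL hε hε1 hδ hδ1 ⟨ht.1, ht.2.trans hb.2⟩
      exact ⟨E', fun _ => h⟩
    · exact ⟨0, fun h => absurd h ht⟩
  choose E' hE' using hder
  have key := intervalIntegral.integral_le_sub_of_hasDeriv_right_of_le
    (g := fun t => 2 * (8 * (L + 3) * δ * t - totalEnt δ ρp ρm t))
    (g' := fun t => 2 * (8 * (L + 3) * δ * 1 - E' t)) (φ := fun t => ∑ k ∈ S, dissTerm (v t) k)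
    hb.1.le
    (continuousOn_const.mul (ContinuousOn.sub (by fun_prop)
      ((hs.continuousOn_totalEnt hδ).mono hsub)))
    (fun t ht => ((((hasDerivAt_id t).const_mul _).sub (hE' t ht).1).const_mul 2).hasDerivWithinAt)
    (hSc.mono hsub).integrableOn_Icc
    (fun t ht => by
      have h2 := (hE' t ht).2
      have h3 : ∑ k ∈ S, dissTerm (v t) k ≤ dissAt ρp ρm t :=
        sum_dissTerm_le (hs.summable ⟨ht.1.le, ht.2.trans hb.2⟩) S
      linarith)
  have h4 := hs.neg_two_le_totalEnt hδ (show b ∈ Ico 0 T from ⟨hb.1.le, hb.2⟩)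
  have h5 : 8 * (L + 3) * δ * b ≤ 8 * (L + 3) * δ * T := by
    have := hb.2.le
    gcongr
  simp only [mul_zero, zero_sub] at key
  linarith

/-- The `L²` norm of the periodic part of a component stays bounded. -/
theorem IsSolution.integral_perPart_sq_le (hs : IsSolution η L ε T ρp₀ ρm₀ ρp ρm)
    (hL : 0 < L) (hε : 0 < ε) (hε1 : ε ≤ 1) {δ : ℝ} (hδ : 0 < δ) (hδ1 : δ ≤ 1)
    (hδT : 8 * (L + 3) * δ * T ≤ 1) {s : ℝ} {ρ₀ : Plane → ℝ} {ρ : ℝ → Plane → ℝ}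
    (hc : IsComponent η L ε T s (fun t => rieszSqFn fun x => ρp t x - ρm t x) ρ₀ ρ) (hs1 : |s| = 1)
    {K : ℝ} (hK0 : 0 ≤ K)
    (hK : ∀ t ∈ Ico 0 T, ∫ x, descend (fun y => ent δ (pd 0 (ρ t) y)) x ∂torusMeasure ≤ K)
    {t : ℝ} (ht : t ∈ Ico 0 T) :
    ∫ x, descend (fun y => perPart L ε ρ t y ^ 2) x ∂torusMeasure ≤
      Real.exp T * (∫ x, descend (fun y => perPart L ε ρ 0 y ^ 2) x ∂torusMeasure +
        2 * ((L + 1) * (9 + 72 * (L + 3 + 2 * K))) * (totalEnt δ ρp ρm 0 + 3)) := by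
  have hT : 0 < T := ht.1.trans_lt ht.2
  set C := (L + 1) * (9 + 72 * (L + 3 + 2 * K)) with hC
  have hC0 : 0 ≤ C := by positivity
  set κ := 8 * (L + 3) * δ with hκ
  have hκ0 : 0 ≤ κ := by positivity
  set y : ℝ → ℝ := fun t => ∫ x, descend (fun y => perPart L ε ρ t y ^ 2) x ∂torusMeasure with hy
  set z : ℝ → ℝ := fun t => Real.exp (-t) * y t + 2 * C * (totalEnt δ ρp ρm t - κ * t) with hz
  have hyc : ContinuousOn y (Ico 0 T) := by
    have hG : SmoothOn T fun τ y => perPart L ε ρ τ y ^ 2 := ContDiffOn.pow hc.perPart_smoothOn 2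
    exact continuousOn_integral_descend hG.continuousOn
  have hd : ∀ t ∈ Ioo 0 T, ∃ z', HasDerivAt z z' t ∧ z' ≤ 0 := by
    intro t ht
    have ht' : t ∈ Ico 0 T := ⟨ht.1.le, ht.2⟩
    obtain ⟨E', h1, h2⟩ := hs.exists_hasDerivAt_totalEnt hL hε hε1 hδ hδ1 ht
    obtain ⟨y', h3, h4⟩ := hc.exists_hasDerivAt_sq hs1 hL hε hε1 hδ ht (hK t ht')
      (h1Bound_rieszSq (hs.summable ht'))
    have hD : 0 ≤ dissAt ρp ρm t := diss_nonneg _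
    have h5 : HasDerivAt (fun t : ℝ => Real.exp (-t)) (-Real.exp (-t)) t := by
      simpa using (hasDerivAt_neg t).exp
    refine ⟨_, (h5.mul h3).add ((h1.sub ((hasDerivAt_id t).const_mul κ)).const_mul (2 * C)), ?_⟩
    have h6 : y' ≤ C * dissAt ρp ρm t + y t := h4
    have h7 : Real.exp (-t) ≤ 1 := Real.exp_le_one_iff.2 (by linarith [ht.1])
    have h8 : 0 < Real.exp (-t) := Real.exp_pos _
    have h9 : Real.exp (-t) * y' ≤ Real.exp (-t) * (C * dissAt ρp ρm t + y t) := by gcongr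
    have h10 : Real.exp (-t) * (C * dissAt ρp ρm t) ≤ C * dissAt ρp ρm t :=
      mul_le_of_le_one_left (mul_nonneg hC0 hD) h7
    have h11 : 2 * C * (E' - κ * 1) ≤ 2 * C * (-(dissAt ρp ρm t / 2)) := by
      gcongr
      linarith
    have h12 : (∫ x, descend (fun y => perPart L ε ρ t y ^ 2) x ∂torusMeasure) = y t := rfl
    rw [h12]
    linarith
  have hanti : AntitoneOn z (Ico 0 T) := by
    refine antitoneOn_of_deriv_nonpos (convex_Ico 0 T)
      (ContinuousOn.add (ContinuousOn.mul (by fun_prop) hyc)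
        (continuousOn_const.mul ((hs.continuousOn_totalEnt hδ).sub (by fun_prop)))) ?_ ?_
    · rw [interior_Ico]
      intro t ht
      obtain ⟨E', h1, h2⟩ := hd t ht
      exact h1.differentiableAt.differentiableWithinAt
    · rw [interior_Ico]
      intro t ht
      obtain ⟨E', h1, h2⟩ := hd t ht
      rw [h1.deriv]
      exact h2
  have h1 := hanti (show (0 : ℝ) ∈ Ico 0 T from ⟨le_rfl, hT⟩) ht ht.1
  have h2 := hs.neg_two_le_totalEnt hδ ht
  have h3 : κ * t ≤ κ * T := by
    have := ht.2.le
    gcongr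
  have h4 : z 0 = y 0 + 2 * C * totalEnt δ ρp ρm 0 := by simp [hz]
  have h5 : Real.exp (-t) * y t ≤ y 0 + 2 * C * (totalEnt δ ρp ρm 0 + 3) := by
    rw [h4] at h1
    have h6 : 2 * C * (-3) ≤ 2 * C * (totalEnt δ ρp ρm t - κ * t) := by
      gcongr
      linarith
    have h7 : z t = Real.exp (-t) * y t + 2 * C * (totalEnt δ ρp ρm t - κ * t) := rfl
    linarith
  have hyt : 0 ≤ y t := integral_nonneg fun x => sq_nonneg _
  have h8 : 0 ≤ y 0 + 2 * C * (totalEnt δ ρp ρm 0 + 3) :=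
    (mul_nonneg (Real.exp_pos _).le hyt).trans h5
  calc y t = Real.exp t * (Real.exp (-t) * y t) := by
        rw [← mul_assoc, ← Real.exp_add, add_neg_cancel, Real.exp_zero, one_mul]
    _ ≤ Real.exp T * (y 0 + 2 * C * (totalEnt δ ρp ρm 0 + 3)) := by
        have := ht.2.le
        gcongr

end Solution

/-! ### Continuity of the operators -/

theorem fc_sub (f g : L2R) (k : Fin 2 → ℤ) : fc (f - g) k = fc f k - fc g k := by
  simp only [fc_eq_inner, map_sub, inner_sub_right]

theorem norm_rieszSq_sub_le (f g : L2R) : ‖rieszSq f - rieszSq g‖ ≤ ‖f - g‖ := by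
  refine abs_le_of_sq_le_sq' ?_ (norm_nonneg _) |>.2
  rw [norm_L2R_sq, norm_L2R_sq]
  refine hasSum_le (fun k => ?_) (hasSum_norm_fc_sq _) (hasSum_norm_fc_sq _)
  rw [fc_sub, fc_sub, fc_rieszSq, fc_rieszSq, ← mul_sub, norm_mul, Complex.norm_real,
    Real.norm_of_nonneg (symb_nonneg k)]
  have := mul_le_of_le_one_left (norm_nonneg (fc f k - fc g k)) (symb_le_one k)
  have h0 := mul_nonneg (symb_nonneg k) (norm_nonneg (fc f k - fc g k))
  gcongr

theorem continuous_rieszSq : Continuous rieszSq :=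
  (LipschitzWith.of_dist_le_mul (K := 1) fun f g => by
    simpa [dist_eq_norm] using norm_rieszSq_sub_le f g).continuous

theorem continuous_toDual (k : ℕ) : Continuous (toDual k) :=
  (innerSL ℝ (E := L2R)).continuous.clm_comp continuous_const

theorem integral_mul_rieszSq (f g : L2R) :
    ∫ x, f x * rieszSq g x ∂torusMeasure = ∫ x, rieszSq f x * g x ∂torusMeasure := by
  have h1 := hasSum_fc f (rieszSq g)
  have h2 := hasSum_fc (rieszSq f) g
  have h3 : (fun k => (starRingEnd ℂ) (fc f k) * fc (rieszSq g) k) =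
      fun k => (starRingEnd ℂ) (fc (rieszSq f) k) * fc g k := by
    funext k
    rw [fc_rieszSq, fc_rieszSq, map_mul, Complex.conj_ofReal]
    ring
  rw [h3] at h1
  exact_mod_cast h1.unique h2

/-! ### Sobolev norms on the Fourier side -/

/-- The multi-index `(a, b)`. -/
def MIdx.mk {n : ℕ} (a b : ℕ) (h : a + b ≤ n) : MIdx n :=
  ⟨(⟨a, by omega⟩, ⟨b, by omega⟩), h⟩

theorem Sobolev.isWeakDeriv {n : ℕ} (v : Sobolev n) (a b : ℕ) (h : a + b ≤ n) :
    IsWeakDeriv a b (Sobolev.fn n v) ((v : PiLp 2 fun _ : MIdx n => L2R) (MIdx.mk a b h)) :=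
  v.2 (MIdx.mk a b h)

theorem Sobolev.sum_norm_sq_le {n : ℕ} (v : Sobolev n) (S : Finset (MIdx n)) :
    ∑ α ∈ S, ‖(v : PiLp 2 fun _ : MIdx n => L2R) α‖ ^ 2 ≤ ‖v‖ ^ 2 := by
  have h : ‖v‖ ^ 2 = ∑ α, ‖(v : PiLp 2 fun _ : MIdx n => L2R) α‖ ^ 2 :=
    PiLp.norm_sq_eq_of_L2 _ (v : PiLp 2 fun _ : MIdx n => L2R)
  rw [h]
  exact Finset.sum_le_sum_of_subset_of_nonneg (Finset.subset_univ S) fun _ _ _ => sq_nonneg _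

theorem sum_norm_fc_sq_le_norm (f : L2R) (S : Finset (Fin 2 → ℤ)) :
    ∑ k ∈ S, ‖fc f k‖ ^ 2 ≤ ‖f‖ ^ 2 := by
  rw [norm_L2R_sq]
  exact sum_norm_fc_sq_le f S

theorem Sobolev.norm_fc_pd_sq {n : ℕ} (hn : 1 ≤ n) (v : Sobolev n) (k : Fin 2 → ℤ) :
    ‖fc ((v : PiLp 2 fun _ : MIdx n => L2R) (MIdx.mk 1 0 hn)) k‖ ^ 2 =
        (2 * Real.pi * k 0) ^ 2 * ‖fc (Sobolev.fn n v) k‖ ^ 2 ∧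
      ‖fc ((v : PiLp 2 fun _ : MIdx n => L2R) (MIdx.mk 0 1 hn)) k‖ ^ 2 =
        (2 * Real.pi * k 1) ^ 2 * ‖fc (Sobolev.fn n v) k‖ ^ 2 := by
  have h0 := fc_of_weak_pd (j := 0) (fun φ hφ => by
    simpa using! Sobolev.isWeakDeriv v 1 0 hn φ hφ) k
  have h1 := fc_of_weak_pd (j := 1) (fun φ hφ => by
    simpa using! Sobolev.isWeakDeriv v 0 1 hn φ hφ) k
  rw [h0, h1]
  simp only [norm_mul, Complex.norm_real, Complex.norm_I, mul_one, mul_pow, Real.norm_eq_abs,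
    sq_abs, and_self]

theorem Sobolev.sum_fc_le {n : ℕ} (hn : 1 ≤ n) (v : Sobolev n) (S : Finset (Fin 2 → ℤ)) :
    ∑ k ∈ S, (1 + (2 * Real.pi) ^ 2 * ((k 0 : ℝ) ^ 2 + (k 1 : ℝ) ^ 2)) * ‖fc (Sobolev.fn n v) k‖ ^ 2 ≤
      ‖v‖ ^ 2 := by
  classical
  set F : PiLp 2 fun _ : MIdx n => L2R := v.1 with hF
  have h1 := Sobolev.sum_norm_sq_le v {MIdx.zero n, MIdx.mk 1 0 hn, MIdx.mk 0 1 hn}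
  rw [Finset.sum_insert (by simp [MIdx.zero, MIdx.mk, Fin.ext_iff]),
    Finset.sum_insert (by simp [MIdx.mk, Fin.ext_iff]), Finset.sum_singleton] at h1
  have h2 : ∑ k ∈ S, (1 + (2 * Real.pi) ^ 2 * ((k 0 : ℝ) ^ 2 + (k 1 : ℝ) ^ 2)) *
      ‖fc (Sobolev.fn n v) k‖ ^ 2 = ∑ k ∈ S, ‖fc (F (MIdx.zero n)) k‖ ^ 2 +
        (∑ k ∈ S, ‖fc (F (MIdx.mk 1 0 hn)) k‖ ^ 2 + ∑ k ∈ S, ‖fc (F (MIdx.mk 0 1 hn)) k‖ ^ 2) := by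
    rw [← Finset.sum_add_distrib, ← Finset.sum_add_distrib]
    refine Finset.sum_congr rfl fun k _ => ?_
    rw [(Sobolev.norm_fc_pd_sq hn v k).1, (Sobolev.norm_fc_pd_sq hn v k).2]
    have : Sobolev.fn n v = F (MIdx.zero n) := rfl
    rw [this]
    ring
  rw [h2]
  exact le_trans (add_le_add (sum_norm_fc_sq_le_norm _ S)
    (add_le_add (sum_norm_fc_sq_le_norm _ S) (sum_norm_fc_sq_le_norm _ S))) h1

theorem Sobolev.h1Bound {n : ℕ} (hn : 1 ≤ n) (v : Sobolev n) :
    H1Bound (Sobolev.fn n v) (‖v‖ ^ 2) := by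
  intro S
  refine (Finset.sum_le_sum fun k _ => ?_).trans (Sobolev.sum_fc_le hn v S)
  have h := two_le_two_pi_sq
  refine mul_le_mul_of_nonneg_right ?_ (sq_nonneg _)
  nlinarith [sq_nonneg (k 0 : ℝ), sq_nonneg (k 1 : ℝ)]

theorem H1Bound.rieszSq {a : L2R} {A : ℝ} (h : H1Bound a A) : H1Bound (rieszSq a) A := by
  intro S
  refine (Finset.sum_le_sum fun k _ => ?_).trans (h S)
  rw [norm_fc_rieszSq_sq]
  have h1 : symb k ^ 2 ≤ 1 := pow_le_one₀ (symb_nonneg k) (symb_le_one k)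
  gcongr
  exact mul_le_of_le_one_left (sq_nonneg _) h1

theorem fc_lap {φ : Plane → ℝ} (h : ContDiff ℝ ∞ φ) (hp : IsPeriodic φ) (k : Fin 2 → ℤ) :
    fc (toL2 (descend (lap φ))) k =
      (-((2 * Real.pi) ^ 2 * ((k 0 : ℝ) ^ 2 + (k 1 : ℝ) ^ 2)) : ℝ) * fc (toL2 (descend φ)) k := by
  have hadd : fc (toL2 (descend (lap φ))) k = fc (toL2 (descend (pd 0 (pd 0 φ)))) k +
      fc (toL2 (descend (pd 1 (pd 1 φ)))) k := by
    have e1 : toL2 (descend (lap φ)) - toL2 (descend (pd 0 (pd 0 φ))) =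
        toL2 (descend (pd 1 (pd 1 φ))) := by
      refine Lp.ext ?_
      filter_upwards [Lp.coeFn_sub (toL2 (descend (lap φ))) (toL2 (descend (pd 0 (pd 0 φ)))),
        coeFn_toL2 (contDiff_lap h).continuous, coeFn_toL2 (contDiff_pd 0 (contDiff_pd 0 h)).continuous,
        coeFn_toL2 (contDiff_pd 1 (contDiff_pd 1 h)).continuous] with x h1 h2 h3 h4
      rw [h1, Pi.sub_apply, h2, h3, h4]
      simp only [descend_apply, lap]
      ring
    rw [← e1, fc_sub]
    ring
  have h2 : ∀ j, fc (toL2 (descend (pd j (pd j φ)))) k =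
      (-((2 * Real.pi * k j) ^ 2) : ℝ) * fc (toL2 (descend φ)) k := by
    intro j
    rw [fc_pd j ((contDiff_pd j h).of_le one_le) (pd_periodic j hp), fc_pd j (h.of_le one_le) hp]
    push_cast
    linear_combination (2 * Real.pi * k j : ℂ) ^ 2 * fc (toL2 (descend φ)) k * Complex.I_sq
  rw [hadd, h2, h2]
  push_cast
  ring

/-- The pairing of `R₁²R₂² v`, `v ∈ W^{1,2}`, with a Laplacian. -/
theorem Sobolev.abs_integral_rieszSq_mul_lap_le (v : Sobolev 1) {φ : Plane → ℝ}
    (h : ContDiff ℝ ∞ φ) (hp : IsPeriodic φ) :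
    |∫ x, rieszSq (Sobolev.fn 1 v) x * descend (lap φ) x ∂torusMeasure| ≤
      ‖v‖ * √(diss (toL2 (descend φ))) := by
  have h1 := hasSum_fc (Dislocation.rieszSq (Sobolev.fn 1 v)) (toL2 (descend (lap φ)))
  rw [integral_mul_toL2 (contDiff_lap h).continuous] at h1
  rw [← Real.norm_eq_abs, ← Complex.norm_real, ← Real.sqrt_sq (norm_nonneg v)]
  have hr : ∀ k : Fin 2 → ℤ, 0 ≤ (k 0 : ℝ) ^ 2 + (k 1 : ℝ) ^ 2 := fun k => by positivity
  refine norm_le_sqrt_mul_sqrt_of_hasSum h1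
    (a := fun k => 2 * Real.pi * √((k 0 : ℝ) ^ 2 + (k 1 : ℝ) ^ 2) * ‖fc (Sobolev.fn 1 v) k‖)
    (b := fun k => 2 * Real.pi * √((k 0 : ℝ) ^ 2 + (k 1 : ℝ) ^ 2) * symb k *
      ‖fc (toL2 (descend φ)) k‖)
    (fun k => ?_) (fun S => ?_) (fun S => ?_)
  · rw [fc_lap h hp, fc_rieszSq, norm_mul, RCLike.norm_conj, norm_mul, norm_mul, Complex.norm_real,
      Complex.norm_real, Real.norm_of_nonneg (symb_nonneg k), norm_neg, Real.norm_of_nonneg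
      (mul_nonneg (sq_nonneg _) (hr k))]
    apply le_of_eq
    have := Real.sq_sqrt (hr k)
    linear_combination -(symb k * ‖fc (Sobolev.fn 1 v) k‖ * (2 * Real.pi) ^ 2 *
      ‖fc (toL2 (descend φ)) k‖) * this
  · refine (Finset.sum_le_sum fun k _ => ?_).trans (Sobolev.sum_fc_le le_rfl v S)
    simp only [mul_pow, Real.sq_sqrt (hr k)]
    gcongr
    simp
  · refine (Finset.sum_le_sum fun k _ => ?_).trans (sum_dissTerm_le (summable_dissTerm h hp) S)
    simp only [mul_pow, Real.sq_sqrt (hr k), dissTerm]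
    have h3 := mul_le_mul_of_nonneg_left (symb_mul_le k) (symb_nonneg k)
    calc _ = (2 ^ 2 * Real.pi ^ 2 * ‖fc (toL2 (descend φ)) k‖ ^ 2) *
          (symb k * (symb k * ((k 0 : ℝ) ^ 2 + (k 1 : ℝ) ^ 2))) := by ring
      _ ≤ (2 ^ 2 * Real.pi ^ 2 * ‖fc (toL2 (descend φ)) k‖ ^ 2) * (symb k * (k 0 : ℝ) ^ 2) := by
        gcongr
      _ = _ := by ring

/-- The pairing of `v ∈ W^{2,2}` with a Laplacian. -/
theorem Sobolev.abs_integral_mul_lap_le (v : Sobolev 2) {φ : Plane → ℝ}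
    (h : ContDiff ℝ ∞ φ) (hp : IsPeriodic φ) :
    |∫ x, Sobolev.fn 2 v x * descend (lap φ) x ∂torusMeasure| ≤
      √(2 * ‖v‖ ^ 2) * √(∫ x, descend (fun y => φ y ^ 2) x ∂torusMeasure) := by
  classical
  have h1 := hasSum_fc (Sobolev.fn 2 v) (toL2 (descend (lap φ)))
  rw [integral_mul_toL2 (contDiff_lap h).continuous] at h1
  have e1 : ∫ x, descend (fun y => φ y ^ 2) x ∂torusMeasure =
    ∫ x, toL2 (descend φ) x ^ 2 ∂torusMeasure := (integral_toL2_sq h.continuous).symm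
  rw [← Real.norm_eq_abs, ← Complex.norm_real, e1]
  have hr : ∀ k : Fin 2 → ℤ, 0 ≤ (k 0 : ℝ) ^ 2 + (k 1 : ℝ) ^ 2 := fun k => by positivity
  refine norm_le_sqrt_mul_sqrt_of_hasSum h1
    (a := fun k => (2 * Real.pi) ^ 2 * ((k 0 : ℝ) ^ 2 + (k 1 : ℝ) ^ 2) * ‖fc (Sobolev.fn 2 v) k‖)
    (b := fun k => ‖fc (toL2 (descend φ)) k‖) (fun k => ?_) (fun S => ?_) (sum_norm_fc_sq_le _)
  · rw [fc_lap h hp, norm_mul, RCLike.norm_conj, norm_mul, Complex.norm_real, norm_neg,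
      Real.norm_of_nonneg (mul_nonneg (sq_nonneg _) (hr k))]
    apply le_of_eq
    ring
  · set F : PiLp 2 fun _ : MIdx 2 => L2R := v.1 with hF
    have h2 := Sobolev.sum_norm_sq_le v {MIdx.mk 2 0 le_rfl, MIdx.mk 0 2 le_rfl}
    rw [Finset.sum_insert (by simp [MIdx.mk, Fin.ext_iff]), Finset.sum_singleton] at h2
    have h3 : ∀ k, ‖fc (F (MIdx.mk 2 0 le_rfl)) k‖ =
        (2 * Real.pi * k 0) ^ 2 * ‖fc (Sobolev.fn 2 v) k‖ := by
      intro k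
      rw [fc_of_weak_pd_pd (j := 0) (fun χ hχ => by
        simpa using! Sobolev.isWeakDeriv v 2 0 le_rfl χ hχ) k, norm_mul, norm_neg, Complex.norm_real,
        Real.norm_of_nonneg (sq_nonneg _)]
    have h4 : ∀ k, ‖fc (F (MIdx.mk 0 2 le_rfl)) k‖ =
        (2 * Real.pi * k 1) ^ 2 * ‖fc (Sobolev.fn 2 v) k‖ := by
      intro k
      rw [fc_of_weak_pd_pd (j := 1) (fun χ hχ => by
        simpa using! Sobolev.isWeakDeriv v 0 2 le_rfl χ hχ) k, norm_mul, norm_neg, Complex.norm_real,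
        Real.norm_of_nonneg (sq_nonneg _)]
    have h5 : ∀ k ∈ S, ((2 * Real.pi) ^ 2 * ((k 0 : ℝ) ^ 2 + (k 1 : ℝ) ^ 2) *
        ‖fc (Sobolev.fn 2 v) k‖) ^ 2 ≤ 2 * (‖fc (F (MIdx.mk 2 0 le_rfl)) k‖ ^ 2 +
          ‖fc (F (MIdx.mk 0 2 le_rfl)) k‖ ^ 2) := by
      intro k _
      rw [h3, h4]
      have h6 : (2 * Real.pi) ^ 2 * ((k 0 : ℝ) ^ 2 + (k 1 : ℝ) ^ 2) * ‖fc (Sobolev.fn 2 v) k‖ =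
          (2 * Real.pi * k 0) ^ 2 * ‖fc (Sobolev.fn 2 v) k‖ +
            (2 * Real.pi * k 1) ^ 2 * ‖fc (Sobolev.fn 2 v) k‖ := by ring
      rw [h6]
      exact add_sq_le
    refine (Finset.sum_le_sum h5).trans ?_
    rw [← Finset.mul_sum, Finset.sum_add_distrib]
    have h7 := sum_norm_fc_sq_le_norm (F (MIdx.mk 2 0 le_rfl)) S
    have h8 := sum_norm_fc_sq_le_norm (F (MIdx.mk 0 2 le_rfl)) S
    linarith

/-! ### Bounds on the time derivatives at a fixed time -/

theorem abs_integral_mul_le_sqrt {f g θ : Torus → ℝ} (hθ : ∀ x, 0 ≤ θ x)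
    (hf : Integrable (fun x => f x ^ 2 * θ x) torusMeasure)
    (hg : Integrable (fun x => g x ^ 2 * θ x) torusMeasure)
    (hfg : Integrable (fun x => f x * (g x * θ x)) torusMeasure) :
    |∫ x, f x * (g x * θ x) ∂torusMeasure| ≤
      √((∫ x, f x ^ 2 * θ x ∂torusMeasure) * ∫ x, g x ^ 2 * θ x ∂torusMeasure) := by
  refine Real.abs_le_sqrt ?_
  have h : ∀ c : ℝ, 0 ≤ (∫ x, f x ^ 2 * θ x ∂torusMeasure) * (c * c) +
      (2 * ∫ x, f x * (g x * θ x) ∂torusMeasure) * c + ∫ x, g x ^ 2 * θ x ∂torusMeasure := by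
    intro c
    have h1 : ∫ x, (c * f x + g x) ^ 2 * θ x ∂torusMeasure =
        (c * c) * (∫ x, f x ^ 2 * θ x ∂torusMeasure) +
          (2 * c) * (∫ x, f x * (g x * θ x) ∂torusMeasure) +
          ∫ x, g x ^ 2 * θ x ∂torusMeasure := by
      rw [← integral_const_mul, ← integral_const_mul,
        ← integral_add (hf.const_mul _) (hfg.const_mul _),
        ← integral_add (Integrable.fun_add (hf.const_mul _) (hfg.const_mul _)) hg]
      refine integral_congr_ae (Filter.Eventually.of_forall fun x => ?_)
      simp only
      ring
    have h2 : 0 ≤ ∫ x, (c * f x + g x) ^ 2 * θ x ∂torusMeasure :=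
      integral_nonneg fun x => mul_nonneg (sq_nonneg _) (hθ x)
    rw [h1] at h2
    linarith
  have := discrim_le_zero h
  rw [discrim] at this
  nlinarith

theorem lap_sub {f g : Plane → ℝ} (hf : ContDiff ℝ ∞ f) (hg : ContDiff ℝ ∞ g) :
    lap (fun x => f x - g x) = fun x => lap f x - lap g x := by
  have h : ∀ i, pd i (pd i fun x => f x - g x) = fun x => pd i (pd i f) x - pd i (pd i g) x := by
    intro i
    have h1 : pd i (fun x => f x - g x) = fun x => pd i f x - pd i g x := funext fun x =>
      pd_sub (hf.differentiable (by simp) x) (hg.differentiable (by simp) x)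
    rw [h1]
    exact funext fun x => pd_sub ((contDiff_pd i hf).differentiable (by simp) x)
      ((contDiff_pd i hg).differentiable (by simp) x)
  funext x
  rw [lap, h, h, lap, lap]
  ring

section Component

variable {η : Plane → ℝ} {L ε T s : ℝ} {u : ℝ → L2R} {ρ₀ : Plane → ℝ} {ρ : ℝ → Plane → ℝ}

theorem IsComponent.abs_integral_mul_pd_le (hc : IsComponent η L ε T s u ρ₀ ρ) (hL : 0 < L)
    (hε1 : ε ≤ 1) {δ K : ℝ} (hδ : 0 < δ) {t : ℝ} (ht : t ∈ Ioo 0 T) (hK0 : 0 ≤ K)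
    (hK : ∫ x, descend (fun y => ent δ (pd 0 (ρ t) y)) x ∂torusMeasure ≤ K) {b : L2R} {A B : ℝ}
    (hu : H1Bound (u t) A) (hb : H1Bound b B) :
    |∫ x, u t x * (b x * descend (pd 0 (ρ t)) x) ∂torusMeasure| ≤
      (9 + 72 * (L + 3 + 2 * K)) * (√A * √B) := by
  have ht' : t ∈ Ico 0 T := ⟨ht.1.le, ht.2⟩
  obtain ⟨hui, hu1⟩ := hc.integral_sq_mul_pd_le hε1 hδ ht' hK hu
  obtain ⟨hbi, hb1⟩ := hc.integral_sq_mul_pd_le hε1 hδ ht' hK hb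
  have h0 : ∀ x, 0 ≤ descend (pd 0 (ρ t)) x := fun x => hc.monotone t ht' _
  refine (abs_integral_mul_le_sqrt h0 hui hbi (hc.integral_mul_dt ht (Lp.memLp b)).1).trans ?_
  set Λ := 9 + 72 * (L + 3 + 2 * K) with hΛ
  have hΛ0 : 0 ≤ Λ := by positivity
  have hA := hu.nonneg
  have hB := hb.nonneg
  calc _ ≤ √((A * Λ) * (B * Λ)) := by
        refine Real.sqrt_le_sqrt (mul_le_mul hu1 hb1 ?_ (mul_nonneg hA hΛ0))
        exact integral_nonneg fun x => mul_nonneg (sq_nonneg _) (h0 x)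
    _ = √(Λ ^ 2 * (A * B)) := by ring_nf
    _ = Λ * (√A * √B) := by
      rw [Real.sqrt_mul (sq_nonneg _), Real.sqrt_sq hΛ0, Real.sqrt_mul hA]

theorem IsComponent.norm_toDual_dt_le (hc : IsComponent η L ε T s u ρ₀ ρ) (hs1 : |s| = 1)
    (hL : 0 < L) (hε : 0 < ε)
    (hε1 : ε ≤ 1) {δ K : ℝ} (hδ : 0 < δ) {t : ℝ} (ht : t ∈ Ioo 0 T) (hK0 : 0 ≤ K)
    (hK : ∫ x, descend (fun y => ent δ (pd 0 (ρ t) y)) x ∂torusMeasure ≤ K) {A : ℝ}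
    (hu : H1Bound (u t) A) :
    ‖toDual 2 (toL2 (descend (dt ρ t)))‖ ≤
      √2 * √(∫ x, descend (fun y => perPart L ε ρ t y ^ 2) x ∂torusMeasure) +
        (9 + 72 * (L + 3 + 2 * K)) * √A := by
  have ht' : t ∈ Ico 0 T := ⟨ht.1.le, ht.2⟩
  refine ContinuousLinearMap.opNorm_le_bound _ (by positivity) fun v => ?_
  rw [toDual_apply, integral_mul_toL2 (hc.smoothOn.contDiff_dt ht).continuous,
    (hc.integral_mul_dt ht (Lp.memLp _)).2, hc.lap_eq ht', Real.norm_eq_abs]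
  have h1 := Sobolev.abs_integral_mul_lap_le v (hc.perPart_smoothOn.contDiff ht')
    (hc.perPart_periodic ht')
  have h2 := hc.abs_integral_mul_pd_le hL hε1 hδ ht hK0 hK hu (Sobolev.h1Bound one_le_two v)
  rw [Real.sqrt_mul zero_le_two, Real.sqrt_sq (norm_nonneg v)] at h1
  rw [Real.sqrt_sq (norm_nonneg v)] at h2
  refine (abs_sub _ _).trans ?_
  rw [abs_mul, abs_mul, hs1, abs_of_pos hε, one_mul, add_mul]
  refine add_le_add (((mul_le_of_le_one_left (abs_nonneg _) hε1).trans h1).trans_eq ?_)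
    (h2.trans_eq ?_) <;> ring

end Component

section Solution

variable {η : Plane → ℝ} {L ε T : ℝ} {ρp₀ ρm₀ : Plane → ℝ} {ρp ρm : ℝ → Plane → ℝ}

theorem IsSolution.h1Bound_velocity (hs : IsSolution η L ε T ρp₀ ρm₀ ρp ρm) {t : ℝ}
    (ht : t ∈ Ico 0 T) : H1Bound (rieszSqFn fun x => ρp t x - ρm t x) (dissAt ρp ρm t) :=
  h1Bound_rieszSq (hs.summable ht)

theorem IsSolution.norm_toDual_rieszSqFn_dt_le (hs : IsSolution η L ε T ρp₀ ρm₀ ρp ρm)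
    (hL : 0 < L) (hε : 0 < ε)
    (hε1 : ε ≤ 1) {δ K : ℝ} (hδ : 0 < δ) {t : ℝ} (ht : t ∈ Ioo 0 T) (hK0 : 0 ≤ K)
    (hKp : ∫ x, descend (fun y => ent δ (pd 0 (ρp t) y)) x ∂torusMeasure ≤ K)
    (hKm : ∫ x, descend (fun y => ent δ (pd 0 (ρm t) y)) x ∂torusMeasure ≤ K) :
    ‖toDual 1 (rieszSqFn (dt (fun s x => ρp s x - ρm s x) t))‖ ≤
      (1 + 2 * (9 + 72 * (L + 3 + 2 * K))) * √(dissAt ρp ρm t) := by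
  have ht' : t ∈ Ico 0 T := ⟨ht.1.le, ht.2⟩
  have hu := hs.h1Bound_velocity ht'
  refine ContinuousLinearMap.opNorm_le_bound _ (by positivity) fun v => ?_
  set w := rieszSq (Sobolev.fn 1 v) with hw
  have hwb : H1Bound w (‖v‖ ^ 2) := (Sobolev.h1Bound le_rfl v).rieszSq
  have hdt : dt (fun s x => ρp s x - ρm s x) t = fun x => dt ρp t x - dt ρm t x := funext fun x =>
    ((hs.plus.smoothOn.hasDerivAt ht x).sub (hs.minus.smoothOn.hasDerivAt ht x)).deriv
  have hcp := hs.plus.smoothOn.contDiff_dt ht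
  have hcm := hs.minus.smoothOn.contDiff_dt ht
  have hsub : ∀ {f g : Plane → ℝ}, Continuous f → Continuous g →
      ∫ x, w x * descend (fun y => f y - g y) x ∂torusMeasure =
        ∫ x, w x * descend f x ∂torusMeasure - ∫ x, w x * descend g x ∂torusMeasure := by
    intro f g hf hg
    have h1 : ∀ {f : Plane → ℝ}, Continuous f →
        Integrable (fun x => w x * descend f x) torusMeasure := fun hf =>
      (Lp.memLp w).integrable_mul (memLp_descend hf)
    rw [← integral_sub (h1 hf) (h1 hg)]
    refine integral_congr_ae (Filter.Eventually.of_forall fun x => ?_)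
    simp only [descend_apply]
    ring
  have hlap := lap_sub (hs.plus.contDiff ht') (hs.minus.contDiff ht')
  have h1 := Sobolev.abs_integral_rieszSq_mul_lap_le v (hs.diff_smoothOn.contDiff ht')
    (hs.diff_periodic ht')
  have h2 := hs.plus.abs_integral_mul_pd_le hL hε1 hδ ht hK0 hKp hu hwb
  have h3 := hs.minus.abs_integral_mul_pd_le hL hε1 hδ ht hK0 hKm hu hwb
  rw [Real.sqrt_sq (norm_nonneg v)] at h2 h3
  rw [toDual_apply, rieszSqFn, integral_mul_rieszSq, hdt, integral_mul_toL2 (by fun_prop),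
    hsub hcp.continuous hcm.continuous, (hs.plus.integral_mul_dt ht (Lp.memLp _)).2,
    (hs.minus.integral_mul_dt ht (Lp.memLp _)).2, Real.norm_eq_abs]
  rw [hlap, hsub (contDiff_lap (hs.plus.contDiff ht')).continuous
    (contDiff_lap (hs.minus.contDiff ht')).continuous] at h1
  set P := ∫ x, w x * descend (lap (ρp t)) x ∂torusMeasure
  set M := ∫ x, w x * descend (lap (ρm t)) x ∂torusMeasure
  set I := ∫ x, rieszSqFn (fun x => ρp t x - ρm t x) x * (w x * descend (pd 0 (ρp t)) x) ∂torusMeasure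
  set J := ∫ x, rieszSqFn (fun x => ρp t x - ρm t x) x * (w x * descend (pd 0 (ρm t)) x) ∂torusMeasure
  have h4 : ε * P - 1 * I - (ε * M - -1 * J) = ε * (P - M) - I - J := by ring
  rw [h4]
  have h5 : |ε * (P - M)| ≤ ‖v‖ * √(dissAt ρp ρm t) := by
    rw [abs_mul, abs_of_pos hε]
    exact (mul_le_of_le_one_left (abs_nonneg _) hε1).trans h1
  have h6 := abs_sub (ε * (P - M) - I) J
  have h7 := abs_sub (ε * (P - M)) I
  linarith

end Solution

/-! ### From bounds at fixed time to bounds in time -/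

theorem negSobolevBound_of_norm_sq_le {k : ℕ} {T C : ℝ} {f : ℝ → L2R} {g : ℝ → ℝ}
    (hf : ContinuousOn f (Ioo 0 T)) (hC : 0 ≤ C) (h : ∀ t ∈ Ioo 0 T, ‖toDual k (f t)‖ ^ 2 ≤ g t)
    (hg : ∫⁻ t in Ioo 0 T, ENNReal.ofReal (g t) ≤ ENNReal.ofReal (C ^ 2)) :
    NegSobolevBound k T C f := by
  have hm : AEStronglyMeasurable (fun t => toDual k (f t)) (volume.restrict (Ioo 0 T)) :=
    (continuous_toDual k).comp_aestronglyMeasurable (hf.aestronglyMeasurable measurableSet_Ioo)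
  have hle : eLpNorm (fun t => toDual k (f t)) 2 (volume.restrict (Ioo 0 T)) ≤
      ENNReal.ofReal C := by
    rw [eLpNorm_eq_lintegral_rpow_enorm_toReal two_ne_zero ENNReal.ofNat_ne_top]
    simp only [ENNReal.toReal_ofNat, ENNReal.rpow_ofNat]
    have h1 : ∫⁻ t in Ioo 0 T, ‖toDual k (f t)‖ₑ ^ 2 ≤ ENNReal.ofReal C ^ 2 := by
      rw [← ENNReal.ofReal_pow hC]
      refine (setLIntegral_mono' measurableSet_Ioo fun t ht => ?_).trans hg
      rw [← ofReal_norm, ← ENNReal.ofReal_pow (norm_nonneg _)]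
      exact ENNReal.ofReal_le_ofReal (h t ht)
    calc _ ≤ (ENNReal.ofReal C ^ 2) ^ (1 / 2 : ℝ) := ENNReal.rpow_le_rpow h1 (by norm_num)
      _ = ENNReal.ofReal C := by
        rw [← ENNReal.rpow_ofNat, ← ENNReal.rpow_mul]
        norm_num
  exact ⟨⟨hm, hle.trans_lt ENNReal.ofReal_lt_top⟩, hle⟩

theorem abs_integral_apply_le {E α : Type*} [NormedAddCommGroup E] [NormedSpace ℝ E]
    [MeasurableSpace α] {μ : Measure α} {C : ℝ} (hC : 0 ≤ C) {F : α → StrongDual ℝ E} {ψ : α → E}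
    (hF : MemLp F 2 μ) (hFC : eLpNorm F 2 μ ≤ ENNReal.ofReal C) (hψ : MemLp ψ 2 μ) :
    Integrable (fun t => F t (ψ t)) μ ∧
      |∫ t, F t (ψ t) ∂μ| ≤ C * (eLpNorm ψ 2 μ).toReal := by
  have hm : AEStronglyMeasurable (fun t => F t (ψ t)) μ :=
    (ContinuousLinearMap.id ℝ (StrongDual ℝ E)).aestronglyMeasurable_comp₂ hF.1 hψ.1
  have h1 : eLpNorm (fun t => F t (ψ t)) 1 μ ≤ eLpNorm F 2 μ * eLpNorm ψ 2 μ := by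
    have := eLpNorm_le_eLpNorm_mul_eLpNorm'_of_norm (p := 2) (q := 2) (r := 1) hF.1 hψ.1
      (fun (l : StrongDual ℝ E) v => l v) 1
      (Filter.Eventually.of_forall fun t => by simpa using (F t).le_opNorm (ψ t))
    simpa using this
  have h2 : eLpNorm (fun t => F t (ψ t)) 1 μ ≤ ENNReal.ofReal C * eLpNorm ψ 2 μ := by
    refine h1.trans ?_
    gcongr
  have h3 : ENNReal.ofReal C * eLpNorm ψ 2 μ ≠ ⊤ :=
    ENNReal.mul_ne_top ENNReal.ofReal_ne_top hψ.2.ne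
  refine ⟨memLp_one_iff_integrable.1 ⟨hm, h2.trans_lt h3.lt_top⟩, ?_⟩
  rw [eLpNorm_one_eq_lintegral_enorm] at h2
  rw [← Real.norm_eq_abs, ← ENNReal.toReal_ofReal hC, ← ENNReal.toReal_mul]
  exact (norm_integral_le_lintegral_norm _).trans (ENNReal.toReal_mono h3 (by
    simpa only [ofReal_norm] using h2))

theorem NegSobolevBound.dualityEstimate {k : ℕ} {T C : ℝ} {f : ℝ → L2R} (hC : 0 ≤ C)
    (h : NegSobolevBound k T C f) : DualityEstimate k T C f := by
  intro ψ hψ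
  simp only [← toDual_apply]
  exact abs_integral_apply_le hC h.1 h.2 hψ

/-! ### Uniform estimates -/

theorem lintegral_ofReal_affine_le {T a b G : ℝ} {g : ℝ → ℝ} (hT : 0 ≤ T) (ha : 0 ≤ a)
    (hb : 0 ≤ b) (hG : 0 ≤ G) (hg0 : ∀ t, 0 ≤ g t)
    (hg : ∫⁻ t in Ioo 0 T, ENNReal.ofReal (g t) ≤ ENNReal.ofReal G) :
    ∫⁻ t in Ioo 0 T, ENNReal.ofReal (a + b * g t) ≤ ENNReal.ofReal (a * T + b * G) := by
  have h1 : ∀ t, ENNReal.ofReal (a + b * g t) =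
      ENNReal.ofReal a + ENNReal.ofReal b * ENNReal.ofReal (g t) := fun t => by
    rw [ENNReal.ofReal_add ha (mul_nonneg hb (hg0 t)), ENNReal.ofReal_mul hb]
  simp only [h1]
  rw [lintegral_add_left measurable_const, lintegral_const_mul' _ _ ENNReal.ofReal_ne_top,
    setLIntegral_const, Real.volume_Ioo, sub_zero,
    ENNReal.ofReal_add (mul_nonneg ha hT) (mul_nonneg hb hG), ENNReal.ofReal_mul ha,
    ENNReal.ofReal_mul hb]
  gcongr

theorem dissAt_nonneg (ρp ρm : ℝ → Plane → ℝ) (t : ℝ) : 0 ≤ dissAt ρp ρm t := diss_nonneg _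

section Solution

variable {η : Plane → ℝ} {L ε T : ℝ} {ρp₀ ρm₀ : Plane → ℝ} {ρp ρm : ℝ → Plane → ℝ}

theorem exists_entropy_parameter (hL : 0 < L) (hT : 0 < T) :
    ∃ δ, 0 < δ ∧ δ ≤ 1 ∧ 8 * (L + 3) * δ * T ≤ 1 := by
  have h : 0 < 8 * (L + 3) * T := by positivity
  refine ⟨min 1 (8 * (L + 3) * T)⁻¹, lt_min one_pos (inv_pos.2 h), min_le_left _ _, ?_⟩
  calc 8 * (L + 3) * min 1 (8 * (L + 3) * T)⁻¹ * T
      = 8 * (L + 3) * T * min 1 (8 * (L + 3) * T)⁻¹ := by ring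
    _ ≤ 8 * (L + 3) * T * (8 * (L + 3) * T)⁻¹ := by
      gcongr
      exact min_le_right _ _
    _ = 1 := mul_inv_cancel₀ h.ne'

theorem IsSolution.integral_ent_le (hs : IsSolution η L ε T ρp₀ ρm₀ ρp ρm)
    (hL : 0 < L) (hε : 0 < ε) (hε1 : ε ≤ 1) {δ : ℝ} (hδ : 0 < δ) (hδ1 : δ ≤ 1)
    (hδT : 8 * (L + 3) * δ * T ≤ 1) {K : ℝ} (hK : totalEnt δ ρp ρm 0 ≤ K) {t : ℝ}
    (ht : t ∈ Ico 0 T) :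
    ∫ x, descend (fun y => ent δ (pd 0 (ρp t) y)) x ∂torusMeasure ≤ K + 2 ∧
      ∫ x, descend (fun y => ent δ (pd 0 (ρm t) y)) x ∂torusMeasure ≤ K + 2 := by
  have h1 := hs.totalEnt_le hL hε hε1 hδ hδ1 hδT ht
  have h2 := hs.plus.neg_one_le_integral_ent hδ ht
  have h3 := hs.minus.neg_one_le_integral_ent hδ ht
  unfold totalEnt at h1 hK
  constructor <;> linarith

theorem IsSolution.negSobolevBound_rieszSqFn_dt (hs : IsSolution η L ε T ρp₀ ρm₀ ρp ρm)
    (hL : 0 < L) (hε : 0 < ε) (hε1 : ε ≤ 1) {δ : ℝ} (hδ : 0 < δ) (hδ1 : δ ≤ 1)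
    (hδT : 8 * (L + 3) * δ * T ≤ 1) (hT : 0 < T) {K : ℝ} (hK0 : 0 ≤ K)
    (hK : totalEnt δ ρp ρm 0 ≤ K) :
    NegSobolevBound 1 T (√((1 + 2 * (9 + 72 * (L + 3 + 2 * (K + 2)))) ^ 2 * (2 * (K + 3))))
      fun t => rieszSqFn (dt (fun s x => ρp s x - ρm s x) t) := by
  set Λ := 1 + 2 * (9 + 72 * (L + 3 + 2 * (K + 2))) with hΛ
  refine negSobolevBound_of_norm_sq_le (g := fun t => 0 + Λ ^ 2 * dissAt ρp ρm t)
    (continuous_rieszSq.comp_continuousOn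
      (continuousOn_toL2 hs.diff_smoothOn.contDiffOn_dt.continuousOn))
    (Real.sqrt_nonneg _) (fun t ht => ?_) ?_
  · have ht' : t ∈ Ico 0 T := ⟨ht.1.le, ht.2⟩
    obtain ⟨h1, h2⟩ := hs.integral_ent_le hL hε hε1 hδ hδ1 hδT hK ht'
    have h3 := hs.norm_toDual_rieszSqFn_dt_le hL hε hε1 hδ ht (by positivity) h1 h2
    calc _ ≤ (Λ * √(dissAt ρp ρm t)) ^ 2 := by gcongr
      _ = _ := by rw [mul_pow, Real.sq_sqrt (dissAt_nonneg ρp ρm t), zero_add]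
  · rw [Real.sq_sqrt (by positivity)]
    have h4 := lintegral_ofReal_affine_le hT.le le_rfl (sq_nonneg Λ) (by positivity)
      (dissAt_nonneg ρp ρm) ((hs.lintegral_dissAt_le hL hε hε1 hδ hδ1 hδT).trans
        (ENNReal.ofReal_le_ofReal (q := 2 * (K + 3)) (by linarith)))
    simpa only [zero_mul, zero_add] using h4

theorem IsSolution.negSobolevBound_dt (hs : IsSolution η L ε T ρp₀ ρm₀ ρp ρm)
    (hL : 0 < L) (hε : 0 < ε) (hε1 : ε ≤ 1) {δ : ℝ} (hδ : 0 < δ) (hδ1 : δ ≤ 1)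
    (hδT : 8 * (L + 3) * δ * T ≤ 1) (hT : 0 < T) {K : ℝ} (hK0 : 0 ≤ K)
    (hK : totalEnt δ ρp ρm 0 ≤ K) {s : ℝ} {ρ₀ : Plane → ℝ} {ρ : ℝ → Plane → ℝ}
    (hc : IsComponent η L ε T s (fun t => rieszSqFn fun x => ρp t x - ρm t x) ρ₀ ρ) (hs1 : |s| = 1)
    (hent : ∀ t ∈ Ico 0 T,
      ∫ x, descend (fun y => ent δ (pd 0 (ρ t) y)) x ∂torusMeasure ≤ K + 2)
    (hsq : ∫ x, descend (fun y => perPart L ε ρ 0 y ^ 2) x ∂torusMeasure ≤ K) :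
    NegSobolevBound 2 T
      (√(4 * (Real.exp T * (K + 2 * ((L + 1) * (9 + 72 * (L + 3 + 2 * (K + 2)))) * (K + 3))) * T +
        2 * (9 + 72 * (L + 3 + 2 * (K + 2))) ^ 2 * (2 * (K + 3))))
      fun t => toL2 (descend (dt ρ t)) := by
  set Λ := 9 + 72 * (L + 3 + 2 * (K + 2)) with hΛ
  have hΛ0 : 0 ≤ Λ := by positivity
  set Y := Real.exp T * (K + 2 * ((L + 1) * Λ) * (K + 3)) with hY
  have hY0 : 0 ≤ Y := by positivity
  refine negSobolevBound_of_norm_sq_le (g := fun t => 4 * Y + 2 * Λ ^ 2 * dissAt ρp ρm t)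
    (continuousOn_toL2 hc.smoothOn.contDiffOn_dt.continuousOn)
    (Real.sqrt_nonneg _) (fun t ht => ?_) ?_
  · have ht' : t ∈ Ico 0 T := ⟨ht.1.le, ht.2⟩
    have h1 := hc.norm_toDual_dt_le hs1 hL hε hε1 hδ ht (by positivity) (hent t ht')
      (hs.h1Bound_velocity ht')
    have h2 : ∫ x, descend (fun y => perPart L ε ρ t y ^ 2) x ∂torusMeasure ≤ Y := by
      refine (hs.integral_perPart_sq_le hL hε hε1 hδ hδ1 hδT hc hs1 (by positivity) hent ht').trans ?_
      rw [hY, hΛ]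
      gcongr
    calc _ ≤ (√2 * √Y + Λ * √(dissAt ρp ρm t)) ^ 2 := by
          gcongr
          refine h1.trans ?_
          gcongr
      _ ≤ 2 * ((√2 * √Y) ^ 2 + (Λ * √(dissAt ρp ρm t)) ^ 2) := add_sq_le
      _ = _ := by
        rw [mul_pow, mul_pow, Real.sq_sqrt (dissAt_nonneg ρp ρm t), Real.sq_sqrt hY0,
          Real.sq_sqrt zero_le_two]
        ring
  · rw [Real.sq_sqrt (by positivity)]
    exact lintegral_ofReal_affine_le hT.le (by positivity) (by positivity) (by positivity)
      (dissAt_nonneg ρp ρm) ((hs.lintegral_dissAt_le hL hε hε1 hδ hδ1 hδT).trans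
        (ENNReal.ofReal_le_ofReal (q := 2 * (K + 3)) (by linarith)))

end Solution

/-- Bounds on the initial entropy and `L²` norm, uniform in the regularisation. -/
theorem exists_initial_bound {η : Plane → ℝ} (hη : IsMollifier η) {L : ℝ}
    {ρp₀ ρm₀ : Plane → ℝ} (hp : IsInitialDatum L ρp₀) (hm : IsInitialDatum L ρm₀) :
    ∃ K : ℝ, 0 ≤ K ∧ ∀ T ε, 0 < T → 0 < ε → ε ≤ 1 → ∀ ρp ρm : ℝ → Plane → ℝ,
      IsSolution η L ε T ρp₀ ρm₀ ρp ρm →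
      (∀ δ, 0 < δ → δ ≤ 1 → totalEnt δ ρp ρm 0 ≤ K) ∧
      ∫ x, descend (fun y => perPart L ε ρp 0 y ^ 2) x ∂torusMeasure ≤ K ∧
      ∫ x, descend (fun y => perPart L ε ρm 0 y ^ 2) x ∂torusMeasure ≤ K := by
  obtain ⟨Kp, hKp⟩ := hp.exists_bound hη
  obtain ⟨Km, hKm⟩ := hm.exists_bound hη
  refine ⟨|Kp| + |Km|, by positivity, fun T ε hT hε hε1 ρp ρm hs => ?_⟩
  have h0 : (0 : ℝ) ∈ Ico 0 T := ⟨le_rfl, hT⟩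
  have hep : ρp 0 = regDatum η L ε ρp₀ := funext hs.plus.initial
  have hem : ρm 0 = regDatum η L ε ρm₀ := funext hs.minus.initial
  obtain ⟨hp1, hp2⟩ := hKp ε hε hε1 (hep ▸ hs.plus.contDiff h0)
  obtain ⟨hm1, hm2⟩ := hKm ε hε hε1 (hem ▸ hs.minus.contDiff h0)
  have hKp' := le_abs_self Kp
  have hKm' := le_abs_self Km
  have hKp0 := abs_nonneg Kp
  have hKm0 := abs_nonneg Km
  refine ⟨fun δ hδ hδ1 => ?_, ?_, ?_⟩
  · have h1 := hp1 δ hδ hδ1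
    have h2 := hm1 δ hδ hδ1
    rw [totalEnt, hep, hem]
    linarith
  · simp only [perPart, hep]
    linarith
  · simp only [perPart, hem]
    linarith

end Dislocation

end

open Dislocation in
theorem mainTheorem7 (η : Plane → ℝ) (hη : IsMollifier η) (L : ℝ) (hL : 0 < L)
    (ρp₀ ρm₀ : Plane → ℝ) (hp : IsInitialDatum L ρp₀) (hm : IsInitialDatum L ρm₀) :
    (∃ C : ℝ, 0 < C ∧ ∀ T : ℝ, 0 < T → ∀ ε : ℝ, 0 < ε → ε ≤ 1 →
      ∀ ρp ρm : ℝ → Plane → ℝ, IsSolution η L ε T ρp₀ ρm₀ ρp ρm →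
        DualityEstimate 1 T C (fun t => rieszSqFn (dt (fun s x => ρp s x - ρm s x) t)) ∧
        NegSobolevBound 1 T C (fun t => rieszSqFn (dt (fun s x => ρp s x - ρm s x) t))) ∧
    (∀ T : ℝ, 0 < T → ∃ C : ℝ, 0 < C ∧ ∀ ε : ℝ, 0 < ε → ε ≤ 1 →
      ∀ ρp ρm : ℝ → Plane → ℝ, IsSolution η L ε T ρp₀ ρm₀ ρp ρm →
        (DualityEstimate 2 T C (fun t => toL2 (descend (dt ρp t))) ∧
          NegSobolevBound 2 T C (fun t => toL2 (descend (dt ρp t)))) ∧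
        (DualityEstimate 2 T C (fun t => toL2 (descend (dt ρm t))) ∧
          NegSobolevBound 2 T C (fun t => toL2 (descend (dt ρm t))))) := by
  obtain ⟨K, hK0, hK⟩ := exists_initial_bound hη hp hm
  refine ⟨⟨√((1 + 2 * (9 + 72 * (L + 3 + 2 * (K + 2)))) ^ 2 * (2 * (K + 3))), by positivity,
    fun T hT ε hε hε1 ρp ρm hs => ?_⟩, fun T hT =>
    ⟨√(4 * (Real.exp T * (K + 2 * ((L + 1) * (9 + 72 * (L + 3 + 2 * (K + 2)))) * (K + 3))) * T +
      2 * (9 + 72 * (L + 3 + 2 * (K + 2))) ^ 2 * (2 * (K + 3))), by positivity,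
    fun ε hε hε1 ρp ρm hs => ?_⟩⟩
  · obtain ⟨δ, hδ, hδ1, hδT⟩ := exists_entropy_parameter hL hT
    have h := hs.negSobolevBound_rieszSqFn_dt hL hε hε1 hδ hδ1 hδT hT hK0
      ((hK T ε hT hε hε1 ρp ρm hs).1 δ hδ hδ1)
    exact ⟨h.dualityEstimate (Real.sqrt_nonneg _), h⟩
  · obtain ⟨δ, hδ, hδ1, hδT⟩ := exists_entropy_parameter hL hT
    obtain ⟨hent, hsqp, hsqm⟩ := hK T ε hT hε hε1 ρp ρm hs
    have hE := hent δ hδ hδ1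
    have h1 := hs.negSobolevBound_dt hL hε hε1 hδ hδ1 hδT hT hK0 hE hs.plus (by simp)
      (fun t ht => (hs.integral_ent_le hL hε hε1 hδ hδ1 hδT hE ht).1) hsqp
    have h2 := hs.negSobolevBound_dt hL hε hε1 hδ hδ1 hδT hT hK0 hE hs.minus (by simp)
      (fun t ht => (hs.integral_ent_le hL hε hε1 hδ hδ1 hδT hE ht).2) hsqm
    exact ⟨⟨h1.dualityEstimate (Real.sqrt_nonneg _), h1⟩,
      ⟨h2.dualityEstimate (Real.sqrt_nonneg _), h2⟩⟩
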